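/- Let $X$ be a smooth toric Fano variety with lattice $N$ of one-parameter subgroups and fan $\Sigma_X$ in $N_{\mathbb Q}=N\otimes_{\mathbb Z}\mathbb Q$. Let $G(\Sigma_X)$ be the set of generators of $\Sigma_X$, i.e. of primitive lattice vectors on the rays of $\Sigma_X$, and let $H\subseteq N_{\mathbb Q}$ be the linear span of all pairs $\{x,-x\}\subseteq G(\Sigma_X)$ of centrally symmetric generators. For $n>0$ even and $x_1,\dots,x_n$ a basis of a lattice, put $x_0=-x_1-\cdots-x_n$ and $y_i=-x_i$ for $0\le i\le n$. The Del Pezzo variety $V^n$ (respectively the pseudo Del Pezzo variety $\widetilde V^n$) is the smooth toric Fano variety whose set of generators is $\{x_0,y_0,x_1,y_1,\dots,x_n,y_n\}$ (respectively $\{x_0,x_1,y_1,\dots,x_n,y_n\}$). An equivariant morphism $p\colon Y\to Z$ of toric varieties is a toric bundle with fiber a toric variety $F$ if $p^{-1}(U)\simeq F\times U$ as toric varieties over $U$ for every affine invariant open subset $U\subseteq Z$. Then there is a direct sum decomposition \[H=H_1\oplus\cdots\oplus H_a\oplus\widetilde H_1\oplus\cdots\oplus\widetilde H_b\oplus K\]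 with $a,b\ge 0$, $h_i=\dim H_i>0$, $\widetilde h_j=\dim\widetilde H_j>0$ and $\dim K\ge 0$, such that: (i) $G(\Sigma_X)\cap H=\bigcup_{i}(G(\Sigma_X)\cap H_i)\cup\bigcup_{j}(G(\Sigma_X)\cap\widetilde H_j)\cup(G(\Sigma_X)\cap K)$; (ii) $\#(G(\Sigma_X)\cap H_i)=2(h_i+1)$ for $i=1,\dots,a$, $\#(G(\Sigma_X)\cap\widetilde H_j)=2\widetilde h_j+1$ for $j=1,\dots,b$, and $\#(G(\Sigma_X)\cap K)=2\dim K$; (iii) there are toric varieties $X',Z,Z',W$, equivariant birational maps $\varphi\colon X\dashrightarrow X'$ and $\psi\colon Z\dashrightarrow Z'$, and equivariant morphisms $X\to Z$, $X'\to Z'$, $Z'\to W$, $X'\to W$ such that the compositions $X\to Z\dashrightarrow Z'$ and $X\dashrightarrow X'\to Z'$ agree and $X'\to W$ is the composition $X'\to Z'\to W$; all of $X,X',Z,Z',W$ are smooth and projective, $Z$ and $W$ are Fano, $\varphi$ and $\psi$ are isomorphisms in codimension $1$; and the decomposition of $H$ induces toric bundle structures: $X\to Z$ and $X'\to Z'$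 are toric bundles with fiber $V^{h_1}\times\cdots\times V^{h_a}$, $Z'\to W$ is a toric bundle with fiber $\widetilde V^{\widetilde h_1}\times\cdots\times\widetilde V^{\widetilde h_b}$, and $X'\to W$ is a toric bundle with fiber $V^{h_1}\times\cdots\times V^{h_a}\times\widetilde V^{\widetilde h_1}\times\cdots\times\widetilde V^{\widetilde h_b}$. Here the inclusion of the fiber identifies the lattice of the factor $V^{h_i}$ with $N\cap H_i$ and that of the factor $\widetilde V^{\widetilde h_j}$ with $N\cap\widetilde H_j$ (for the bundle $Z'\to W$, followed by the map of lattices of $X\dashrightarrow X'\to Z'$). -/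

import Mathlib

open scoped TensorProduct

universe u

/-! ## Rational vector space of a lattice -/

/-- The rational vector space `N_ℚ = N ⊗ ℚ` of a lattice `N`. -/
abbrev NQ (N : Type*) [AddCommGroup N] : Type _ := ℚ ⊗[ℤ] N

/-- The canonical map `N → N_ℚ`. -/
noncomputable abbrev toNQ {N : Type*} [AddCommGroup N] (x : N) : NQ N := (1 : ℚ) ⊗ₜ[ℤ] x

/-- The map `N_ℚ → N'_ℚ` induced by a homomorphism of lattices `N → N'`. -/
noncomputable abbrev mapNQ {N N' : Type*} [AddCommGroup N] [AddCommGroup N']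
    (f : N →ₗ[ℤ] N') : NQ N →ₗ[ℚ] NQ N' := f.baseChange ℚ

/-- The sublattice `N ∩ H` of `N` cut out by a linear subspace `H` of `N_ℚ`. -/
noncomputable def latticeIn {N : Type*} [AddCommGroup N] (H : Submodule ℚ (NQ N)) :
    Submodule ℤ N where
  carrier := {x | toNQ x ∈ H}
  add_mem' := by
    intro x y hx hy
    simpa [toNQ, TensorProduct.tmul_add] using H.add_mem hx hy
  zero_mem' := by simp [toNQ]
  smul_mem' := by
    intro c x hx
    have h : toNQ (c • x) = c • toNQ x := by simp [toNQ, TensorProduct.tmul_smul]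
    simpa only [Set.mem_ofPred_eq, h] using zsmul_mem (show toNQ x ∈ H from hx) c

/-- The convex cone `⟨S⟩` in `N_ℚ` spanned by a set `S` of lattice points. -/
noncomputable abbrev coneOf {N : Type*} [AddCommGroup N] (S : Set N) : PointedCone ℚ (NQ N) :=
  PointedCone.hull ℚ (toNQ '' S)

/-- The dimension of a cone: the dimension of its linear span. -/
noncomputable def coneDim {N : Type*} [AddCommGroup N] (σ : PointedCone ℚ (NQ N)) : ℕ :=
  Module.finrank ℚ (Submodule.span ℚ (σ : Set (NQ N)))

/-! ## Fans and toric varieties -/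

/-- A fan: a finite nonempty set of strongly convex rational polyhedral cones, closed under
taking faces, any two of which meet along a common face. -/
structure Fan (N : Type*) [AddCommGroup N] where
  cones : Set (PointedCone ℚ (NQ N))
  finite : cones.Finite
  nonempty : cones.Nonempty
  rational_polyhedral : ∀ σ ∈ cones, ∃ S : Finset N, σ = coneOf (S : Set N)
  strongly_convex : ∀ σ ∈ cones, ∀ x ∈ σ, -x ∈ σ → x = 0
  face_mem : ∀ σ ∈ cones, ∀ τ : PointedCone ℚ (NQ N), τ.IsFaceOf σ → τ ∈ cones
  inf_isFaceOf : ∀ σ ∈ cones, ∀ τ ∈ cones, (σ ⊓ τ).IsFaceOf σ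

/-- A toric variety, given by its lattice of one-parameter subgroups `N` (free of finite rank)
and its fan in `N_ℚ`. -/
structure ToricVariety where
  N : Type u
  [addCommGroup : AddCommGroup N]
  [free : Module.Free ℤ N]
  [fin : Module.Finite ℤ N]
  fan : Fan N

attribute [instance] ToricVariety.addCommGroup ToricVariety.free ToricVariety.fin

namespace ToricVariety

/-- The generators `G(Σ_X)`: the primitive lattice vectors on the rays of the fan. -/
def gens (X : ToricVariety.{u}) : Set X.N :=
  {x | coneOf {x} ∈ X.fan.cones ∧ x ≠ 0 ∧ ∀ (k : ℕ) (y : X.N), x = k • y → k = 1}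

/-- The set `G(Σ_X) ∩ H`. -/
def gensIn (X : ToricVariety.{u}) (H : Submodule ℚ (NQ X.N)) : Set X.N :=
  {x | x ∈ X.gens ∧ toNQ x ∈ H}

/-- The linear subspace of `N_ℚ` spanned by all pairs `{x, -x}` of centrally symmetric
generators. -/
noncomputable def symSpan (X : ToricVariety.{u}) : Submodule ℚ (NQ X.N) :=
  Submodule.span ℚ (toNQ '' {x | x ∈ X.gens ∧ -x ∈ X.gens})

/-- Smoothness: every cone of the fan is spanned by a part of a basis of the lattice. -/
def IsSmooth (X : ToricVariety.{u}) : Prop :=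
  ∀ σ ∈ X.fan.cones, ∃ (x : Module.Basis (Fin (Module.finrank ℤ X.N)) ℤ X.N)
    (I : Set (Fin (Module.finrank ℤ X.N))), σ = coneOf (x '' I)

/-- Completeness: the fan covers `N_ℚ`. -/
def IsComplete (X : ToricVariety.{u}) : Prop :=
  ∀ v : NQ X.N, ∃ σ ∈ X.fan.cones, v ∈ σ

/-- Ampleness, on a complete toric variety, of the invariant divisor `∑ a(x) V(x)`
(sum over the generators `x`): the divisor is Cartier, with local equation at each maximal cone
`σ` given by an integral linear form `m` with values `a(x)` at the generators of `σ`, and the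
resulting piecewise linear function is strictly convex. -/
def IsAmple (X : ToricVariety.{u}) (a : X.N → ℤ) : Prop :=
  ∀ σ, Maximal (fun τ => τ ∈ X.fan.cones) σ → ∃ m : X.N →ₗ[ℤ] ℤ, ∀ x ∈ X.gens,
    (toNQ x ∈ σ → m x = a x) ∧ (toNQ x ∉ σ → m x < a x)

/-- Projectivity: `X` is complete and has an ample invariant divisor. -/
def IsProjective (X : ToricVariety.{u}) : Prop :=
  X.IsComplete ∧ ∃ a : X.N → ℤ, X.IsAmple a

/-- `X` is Fano: it is complete and the anticanonical divisor, the sum of all the invariant prime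
divisors `V(x)`, is ample. -/
def IsFano (X : ToricVariety.{u}) : Prop :=
  X.IsComplete ∧ X.IsAmple (fun _ => 1)

end ToricVariety

/-! ## Maps -/

/-- An equivariant morphism of toric varieties: a homomorphism of the lattices which sends each
cone of the source into a cone of the target. -/
structure ToricMorphism (X Y : ToricVariety.{u}) where
  toLin : X.N →ₗ[ℤ] Y.N
  map_le : ∀ σ ∈ X.fan.cones, ∃ τ ∈ Y.fan.cones, σ.map (mapNQ toLin) ≤ τ

/-- An equivariant birational map `X ⇢ Y`: it is the isomorphism of the two tori given by an
isomorphism of the lattices. -/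
abbrev ToricBirationalMap (X Y : ToricVariety.{u}) : Type u := X.N ≃ₗ[ℤ] Y.N

/-- An equivariant birational map is an isomorphism in codimension 1 when it is an isomorphism
between invariant open subsets with complements of codimension at least 2, i.e. when it identifies
the cones of dimension at most 1 of the two fans. -/
def ToricBirationalMap.IsIsoInCodimOne {X Y : ToricVariety.{u}}
    (φ : ToricBirationalMap X Y) : Prop :=
  ∀ σ : PointedCone ℚ (NQ X.N), coneDim σ ≤ 1 →
    (σ ∈ X.fan.cones ↔ σ.map (mapNQ φ.toLinearMap) ∈ Y.fan.cones)

/-! ## Products -/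

section Pi

variable {ι : Type} {M : ι → Type u} [∀ i, AddCommGroup (M i)]

/-- The product of a family of cones, as a cone in the rational space of the product lattice. -/
noncomputable def piCone (τ : ∀ i, PointedCone ℚ (NQ (M i))) : PointedCone ℚ (NQ (∀ i, M i)) :=
  ⨅ i, (τ i).comap (mapNQ (LinearMap.proj i))

theorem mem_piCone {τ : ∀ i, PointedCone ℚ (NQ (M i))} {x : NQ (∀ i, M i)} :
    x ∈ piCone τ ↔ ∀ i, mapNQ (LinearMap.proj i) x ∈ τ i := by
  simp [piCone, Submodule.mem_iInf, PointedCone.mem_comap]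

theorem sum_single_proj [Fintype ι] [DecidableEq ι] (x : NQ (∀ i, M i)) :
    ∑ i, mapNQ (LinearMap.single ℤ M i) (mapNQ (LinearMap.proj i) x) = x := by
  induction x using TensorProduct.induction_on with
  | zero => simp
  | tmul q y =>
    simp only [mapNQ, LinearMap.baseChange_tmul]
    rw [← TensorProduct.tmul_sum]
    congr 1
    simp [Finset.univ_sum_single]
  | add x y hx hy => simp only [map_add, Finset.sum_add_distrib, hx, hy]

theorem proj_single_same [DecidableEq ι] (i : ι) (x : NQ (M i)) :
    mapNQ (LinearMap.proj i) (mapNQ (LinearMap.single ℤ M i) x) = x := by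
  induction x using TensorProduct.induction_on with
  | zero => simp
  | tmul q y => simp [mapNQ]
  | add x y hx hy => simp only [map_add, hx, hy]

theorem proj_single_ne [DecidableEq ι] {i j : ι} (h : j ≠ i) (x : NQ (M i)) :
    mapNQ (LinearMap.proj j) (mapNQ (LinearMap.single ℤ M i) x) = 0 := by
  induction x using TensorProduct.induction_on with
  | zero => simp
  | tmul q y => simp [mapNQ, h]
  | add x y hx hy => simp only [map_add, hx, hy, add_zero]

theorem single_mem_piCone [DecidableEq ι] {τ : ∀ i, PointedCone ℚ (NQ (M i))} {i : ι}
    {x : NQ (M i)} (hx : x ∈ τ i) : mapNQ (LinearMap.single ℤ M i) x ∈ piCone τ := by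
  rw [mem_piCone]
  intro j
  by_cases h : j = i
  · subst h; rwa [proj_single_same]
  · rw [proj_single_ne h]; exact zero_mem _

/-- The product of a finite family of fans: its cones are the products of cones. -/
noncomputable def Fan.pi [Finite ι] (F : ∀ i, Fan (M i)) : Fan (∀ i, M i) where
  cones := {σ | ∃ τ : ∀ i, PointedCone ℚ (NQ (M i)), (∀ i, τ i ∈ (F i).cones) ∧ σ = piCone τ}
  finite := by
    refine ((Set.Finite.pi (fun i => (F i).finite)).image piCone).subset ?_
    rintro σ ⟨τ, h, rfl⟩
    exact ⟨τ, fun i _ => h i, rfl⟩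
  nonempty := ⟨_, fun i => (F i).nonempty.some, fun i => (F i).nonempty.some_mem, rfl⟩
  rational_polyhedral := by
    classical
    cases nonempty_fintype ι
    rintro σ ⟨τ, h, rfl⟩
    choose S hS using fun i => (F i).rational_polyhedral (τ i) (h i)
    refine ⟨Finset.univ.biUnion fun i => (S i).image (LinearMap.single ℤ M i), ?_⟩
    apply le_antisymm
    · intro x hx
      rw [mem_piCone] at hx
      rw [← sum_single_proj x]
      refine Submodule.sum_mem _ fun i _ => ?_
      have h1 := hx i
      rw [hS i] at h1
      have h2 : coneOf (S i : Set (M i)) ≤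
          (coneOf ((Finset.univ.biUnion fun i => (S i).image (LinearMap.single ℤ M i) :
            Finset (∀ i, M i)) : Set (∀ i, M i))).comap (mapNQ (LinearMap.single ℤ M i)) := by
        refine Submodule.span_le.2 ?_
        rintro _ ⟨y, hy, rfl⟩
        refine Submodule.subset_span ⟨LinearMap.single ℤ M i y, ?_, ?_⟩
        · simp only [Finset.coe_biUnion, Set.mem_iUnion, Finset.coe_image]
          exact ⟨i, by simp, y, hy, rfl⟩
        · simp [toNQ, mapNQ]
      exact h2 h1
    · refine Submodule.span_le.2 ?_
      rintro _ ⟨y, hy, rfl⟩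
      simp only [Finset.coe_biUnion, Set.mem_iUnion, Finset.coe_image] at hy
      obtain ⟨i, _, z, hz, rfl⟩ := hy
      have h3 : toNQ z ∈ τ i := by
        rw [hS i]; exact Submodule.subset_span ⟨z, hz, rfl⟩
      have h4 := single_mem_piCone (τ := τ) h3
      simpa [toNQ, mapNQ] using h4
  strongly_convex := by
    classical
    cases nonempty_fintype ι
    rintro σ ⟨τ, h, rfl⟩ x hx hx'
    rw [mem_piCone] at hx hx'
    rw [← sum_single_proj x]
    refine Finset.sum_eq_zero fun i _ => ?_
    rw [(F i).strongly_convex (τ i) (h i) _ (hx i) (by simpa only [map_neg] using hx' i), map_zero]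
  face_mem := by
    classical
    cases nonempty_fintype ι
    rintro σ ⟨τ, h, rfl⟩ G hG
    refine ⟨fun i => G.comap (mapNQ (LinearMap.single ℤ M i)), fun i => ?_, ?_⟩
    · refine (F i).face_mem (τ i) (h i) _ ⟨fun x hx => ?_, fun {x y c} hx hy hc hxy => ?_⟩
      · have h1 := mem_piCone.1 (hG.le (PointedCone.mem_comap.1 hx)) i
        rwa [proj_single_same] at h1
      · rw [PointedCone.mem_comap] at hxy ⊢
        rw [map_add, map_smul] at hxy
        exact hG.mem_of_smul_add_mem (single_mem_piCone hx) (single_mem_piCone hy) hc hxy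
    · ext x
      rw [mem_piCone]
      simp only [PointedCone.mem_comap]
      constructor
      · intro hx i
        have hx' := mem_piCone.1 (hG.le hx)
        rw [← sum_single_proj x] at hx
        exact hG.mem_of_sum_mem (fun i => single_mem_piCone (hx' i)) hx i
      · intro hx
        rw [← sum_single_proj x]
        exact Submodule.sum_mem _ fun i _ => hx i
  inf_isFaceOf := by
    rintro σ ⟨τ, h, rfl⟩ σ' ⟨τ', h', rfl⟩
    refine ⟨inf_le_left, fun {x y c} hx hy hc hxy => ⟨hx, ?_⟩⟩
    have h2 := mem_piCone.1 hxy.2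
    have h1 := mem_piCone.1 hxy.1
    have hx1 := mem_piCone.1 hx
    have hy1 := mem_piCone.1 hy
    refine mem_piCone.2 fun i => ?_
    have := ((F i).inf_isFaceOf (τ i) (h i) (τ' i) (h' i)).mem_of_smul_add_mem (hx1 i) (hy1 i) hc
      (show c • mapNQ (LinearMap.proj i) x + mapNQ (LinearMap.proj i) y ∈ τ i ⊓ τ' i by
        have e := map_add (mapNQ (LinearMap.proj (φ := M) i)) (c • x) y
        rw [map_smul] at e
        rw [← e]
        exact ⟨h1 i, h2 i⟩)
    exact this.2

end Pi

/-- The product of a finite family of toric varieties. -/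
noncomputable def ToricVariety.pi {ι : Type} [Finite ι] (F : ι → ToricVariety.{u}) :
    ToricVariety.{u} where
  N := ∀ i, (F i).N
  fan := Fan.pi fun i => (F i).fan

/-- The product of two cones, as a cone in the rational space of the product lattice. -/
noncomputable def prodCone {N N' : Type*} [AddCommGroup N] [AddCommGroup N']
    (σ : PointedCone ℚ (NQ N)) (τ : PointedCone ℚ (NQ N')) : PointedCone ℚ (NQ (N × N')) :=
  σ.comap (mapNQ (LinearMap.fst ℤ N N')) ⊓ τ.comap (mapNQ (LinearMap.snd ℤ N N'))

/-- The homomorphism `∏ M i → N`, `(y i) ↦ ∑ f i (y i)`. -/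
noncomputable def sumMap {ι : Type} [Fintype ι] (F : ι → ToricVariety.{u}) {N : Type u}
    [AddCommGroup N] (f : ∀ i, (F i).N →ₗ[ℤ] N) : (ToricVariety.pi F).N →ₗ[ℤ] N :=
  ∑ i, (f i).comp (LinearMap.proj (φ := fun i => (F i).N) i)

/-! ## Toric bundles -/

/-- The equivariant morphism `p : X → Z` is a toric bundle with fiber `F`, the lattice of `F` being
embedded in that of `X` by `j`: every affine invariant open subset `U_τ` of `Z` (`τ` a cone of the
fan of `Z`) has an inverse image isomorphic to `F × U_τ` as a toric variety over `U_τ`. The inverse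
image is described by the cones of `X` that `p` maps into `τ`, and `U_τ` by the faces of `τ`. -/
def IsToricBundle {X Z : ToricVariety.{u}} (p : ToricMorphism X Z) (F : ToricVariety.{u})
    (j : F.N →ₗ[ℤ] X.N) : Prop :=
  ∀ τ ∈ Z.fan.cones, ∃ e : X.N ≃ₗ[ℤ] F.N × Z.N,
    (∀ x, (e x).2 = p.toLin x) ∧ (∀ y, e (j y) = (y, 0)) ∧
    ∀ σ : PointedCone ℚ (NQ X.N),
      (σ ∈ X.fan.cones ∧ σ.map (mapNQ p.toLin) ≤ τ) ↔
        ∃ η ∈ F.fan.cones, ∃ τ' : PointedCone ℚ (NQ Z.N), τ'.IsFaceOf τ ∧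
          σ.map (mapNQ e.toLinearMap) = prodCone η τ'

/-! ## Del Pezzo and pseudo Del Pezzo varieties -/

/-- `V` is the Del Pezzo variety `V^n`, `n > 0` even: the smooth toric Fano variety whose generators
are `x_0, y_0, …, x_n, y_n`, where `x_1, …, x_n` is a basis of the lattice,
`x_0 = -x_1 - ⋯ - x_n` and `y_i = -x_i`. -/
def IsDelPezzo (n : ℕ) (V : ToricVariety.{u}) : Prop :=
  V.IsSmooth ∧ V.IsFano ∧ 0 < n ∧ Even n ∧ ∃ x : Module.Basis (Fin n) ℤ V.N,
    V.gens = Set.range (fun i => x i) ∪ Set.range (fun i => -x i) ∪ {-∑ i, x i, ∑ i, x i}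

/-- `V` is the pseudo Del Pezzo variety `Ṽ^n`, `n > 0` even: the smooth toric Fano variety whose
generators are `x_0, x_1, y_1, …, x_n, y_n`, where `x_1, …, x_n` is a basis of the lattice,
`x_0 = -x_1 - ⋯ - x_n` and `y_i = -x_i`. -/
def IsPseudoDelPezzo (n : ℕ) (V : ToricVariety.{u}) : Prop :=
  V.IsSmooth ∧ V.IsFano ∧ 0 < n ∧ Even n ∧ ∃ x : Module.Basis (Fin n) ℤ V.N,
    V.gens = Set.range (fun i => x i) ∪ Set.range (fun i => -x i) ∪ {-∑ i, x i}

/-- The inclusions of the factors into a lattice, for a family indexed by a disjoint union. -/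
def sumFamily {ι κ : Type} {V : ι → ToricVariety.{u}} {U : κ → ToricVariety.{u}} {N : Type u}
    [AddCommGroup N] (v : ∀ i, (V i).N →ₗ[ℤ] N) (w : ∀ k, (U k).N →ₗ[ℤ] N) :
    ∀ s : ι ⊕ κ, (Sum.elim V U s).N →ₗ[ℤ] N
  | Sum.inl i => v i
  | Sum.inr k => w k

/-! A smooth projective fan is handled through its maximal cones, each recorded as the lattice basis
`F` of its generators. In the Fano case the integral form `hgt F`, equal to 1 on `F`, is at most 0
on all other generators. Two consequences drive the proof. A generator of height 0 with negative
coordinate at `e ∈ F` must be the new vertex behind the wall of `F` opposite to `e`, and its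
coordinate is -1 (`exists_neighbour`); so there is at most one. And two generators span a cone,
cancel, or add up to a generator (`pair_cases`).

If `x` and `-x` are generators, then `x` or `-x` lies in `F`, or `x` has height 0; in the last case
its coordinates are -1, 0 or 1, and two such vectors with overlapping supports agree up to sign. The
generators in the span `H` that are not centrally symmetric all lie in one maximal cone; tilting
that cone away from them gives a cone `F` for which they too have height 0, with supports made of
symmetric generators (`exists_isAdapted`).

Relative to such an `F`, a block is a generator `ω` of height 0 in `H` whose support consists of
symmetric generators. Height 0 with coordinates ±1 means as many +1 as -1, so the support has an
even number `n` of elements. The support, its opposite and `ω` are the generators of the pseudo Del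
Pezzo variety of dimension `n`; with `-ω` they are those of the Del Pezzo variety. The supports of
different blocks are disjoint, and the remaining symmetric generators are, up to sign, a basis of
`K`.

Inside a maximal cone containing the support of a block, three wall crossings exchange two opposite
signs (`exists_swap`), so every balanced sign pattern is reached. In particular a union `S` of
supports can be replaced by `-S`. Hence twice the height function of the star of `S` is a sum of
heights of two maximal cones, and by integrality the star is again Fano (`hgt_star_le`); generators
outside the span of `S` inject into it. For Del Pezzo blocks all maximal cones of the fiber are
reached, so the fan of `X` contains that of a bundle over the star `Z`; the latter is complete, so
the two agree (`eq_bundleFacets_star`).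

The unbalanced cones of a pseudo Del Pezzo fiber need not occur in `X`. So `X'` and `Z'` are
constructed as bundles over the star `W` of all the supports. They have the same rays as `X` and
`Z`, whence the isomorphisms in codimension 1, and a support function that is large on the rays
coming from `W` makes them projective (`exists_bundle_isFacetSystem`). -/

/-! ### Lattice bases as finite sets of vectors, and the simplicial cones they span. -/

section LatticeBasis

open Classical in
/-- A finite set of lattice vectors which is a basis of the lattice. -/
def IsLatticeBasis {N : Type*} [AddCommGroup N] (F : Finset N) : Prop :=
  ∃ c : N → N →ₗ[ℤ] ℤ, (∀ f ∈ F, ∀ g ∈ F, c f g = if f = g then 1 else 0) ∧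
    ∀ x, ∑ f ∈ F, c f x • f = x

variable {N N' : Type*} [AddCommGroup N] [AddCommGroup N'] {F F' S T : Finset N}

open Classical in
/-- The coordinate functional at `f` of the lattice basis `F`; it is zero if `f ∉ F`. -/
noncomputable def co (F : Finset N) (f : N) : N →ₗ[ℤ] ℤ :=
  if h : IsLatticeBasis F then (if f ∈ F then h.choose f else 0) else 0

theorem co_self (h : IsLatticeBasis F) {f : N} (hf : f ∈ F) : co F f f = 1 := by
  simp [co, h, hf, h.choose_spec.1 f hf f hf]

theorem co_ne (h : IsLatticeBasis F) {f g : N} (hg : g ∈ F) (hfg : f ≠ g) : co F f g = 0 := by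
  by_cases hf : f ∈ F
  · simp [co, h, hf, h.choose_spec.1 f hf g hg, hfg]
  · simp [co, hf]

theorem co_of_notMem {f : N} (hf : f ∉ F) : co F f = 0 := by
  simp [co, hf]

theorem sum_co (h : IsLatticeBasis F) (x : N) : ∑ f ∈ F, co F f x • f = x := by
  conv_rhs => rw [← h.choose_spec.2 x]
  refine Finset.sum_congr rfl fun f hf => ?_
  simp [co, h, hf]

open Classical in
theorem co_apply (h : IsLatticeBasis F) (f : N) {g : N} (hg : g ∈ F) :
    co F f g = if f = g then 1 else 0 := by
  split_ifs with e
  · subst e; exact co_self h hg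
  · exact co_ne h hg e

theorem co_sum (h : IsLatticeBasis F) {f : N} (hf : f ∈ F) (n : N → ℤ) :
    co F f (∑ g ∈ F, n g • g) = n f := by
  classical
  rw [map_sum, Finset.sum_eq_single f]
  · simp [co_self h hf]
  · intro g hg hgf; simp [co_ne h hg hgf.symm]
  · exact fun h => absurd hf h

theorem linearMap_ext_of_basis (h : IsLatticeBasis F) {m m' : N →ₗ[ℤ] N'}
    (e : ∀ f ∈ F, m f = m' f) : m = m' := by
  ext x
  rw [← sum_co h x, map_sum, map_sum]
  exact Finset.sum_congr rfl fun f hf => by rw [map_smul, map_smul, e f hf]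

theorem apply_eq_sum_co (h : IsLatticeBasis F) (m : N →ₗ[ℤ] N') (x : N) :
    m x = ∑ f ∈ F, co F f x • m f := by
  conv_lhs => rw [← sum_co h x, map_sum]
  simp

theorem eq_zero_of_co (h : IsLatticeBasis F) {x : N} (e : ∀ f ∈ F, co F f x = 0) : x = 0 := by
  rw [← sum_co h x]
  exact Finset.sum_eq_zero fun f hf => by rw [e f hf, zero_smul]

theorem eq_of_co (h : IsLatticeBasis F) {x y : N} (e : ∀ f ∈ F, co F f x = co F f y) : x = y := by
  rw [← sum_co h x, ← sum_co h y]
  exact Finset.sum_congr rfl fun f hf => by rw [e f hf]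

theorem ne_zero_of_mem_basis (h : IsLatticeBasis F) {f : N} (hf : f ∈ F) : f ≠ 0 := by
  rintro rfl
  simpa using co_self h hf

theorem neg_notMem_basis (h : IsLatticeBasis F) {f : N} (hf : f ∈ F) : -f ∉ F := by
  intro h'
  have h1 := co_self h hf
  by_cases e : f = -f
  · have h2 : co F f (-f) = 1 := by rw [← e]; exact h1
    rw [map_neg] at h2
    omega
  · have h2 := co_ne h h' e
    rw [map_neg] at h2
    omega

/-- An extra vector of `F'` would be a combination of vectors of `F`, at all of which its own
`F'`-coordinate vanishes. This upgrades inclusions of maximal cones to equalities. -/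
theorem subset_basis_eq (h : IsLatticeBasis F) (h' : IsLatticeBasis F') (hs : F ⊆ F') :
    F = F' := by
  refine hs.antisymm fun f hf => ?_
  by_contra hn
  have h1 := co_self h' hf
  rw [apply_eq_sum_co h (co F' f) f, Finset.sum_eq_zero] at h1
  · exact zero_ne_one h1
  · intro g hg
    rw [co_ne h' (hs hg) (by rintro rfl; exact hn hg), smul_zero]

/-- The lattice basis as a bundled basis. -/
noncomputable def latticeBasis (h : IsLatticeBasis F) : Module.Basis F ℤ N :=
  Module.Basis.mk (v := fun f : F => (f : N))
    (by
      rw [Fintype.linearIndependent_iff]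
      intro g hg i
      have := congrArg (co F i) hg
      rw [map_sum, map_zero, Finset.sum_eq_single i] at this
      · simpa [co_self h i.2] using this
      · intro j _ hji
        rw [map_smul, co_ne h j.2 (fun e => hji (Subtype.ext e.symm)), smul_zero]
      · simp)
    (by
      intro x _
      rw [← sum_co h x]
      exact Submodule.sum_mem _ fun f hf => Submodule.smul_mem _ _
        (Submodule.subset_span ⟨⟨f, hf⟩, rfl⟩))

@[simp] theorem latticeBasis_apply (h : IsLatticeBasis F) (f : F) : latticeBasis h f = f := by
  simp [latticeBasis]

theorem card_lattice_basis (h : IsLatticeBasis F) : F.card = Module.finrank ℤ N := by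
  rw [Module.finrank_eq_card_basis (latticeBasis h), Fintype.card_coe]

open Classical in
theorem isLatticeBasis_image {ι : Type*} [Fintype ι] (b : Module.Basis ι ℤ N) :
    IsLatticeBasis (Finset.univ.image b) := by
  by_cases hne : Nonempty ι
  · refine ⟨fun f => b.coord (Function.invFun b f), ?_, fun x => ?_⟩
    · intro f hf g hg
      simp only [Finset.mem_image, Finset.mem_univ, true_and] at hf hg
      obtain ⟨i, rfl⟩ := hf
      obtain ⟨j, rfl⟩ := hg
      beta_reduce
      rw [Function.leftInverse_invFun b.injective i, b.coord_apply, b.repr_self,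
        Finsupp.single_apply]
      simp [b.injective.eq_iff, eq_comm]
    · rw [Finset.sum_image fun i _ j _ e => b.injective e]
      conv_rhs => rw [← b.sum_repr x]
      refine Finset.sum_congr rfl fun i _ => ?_
      beta_reduce
      rw [Function.leftInverse_invFun b.injective i, b.coord_apply]
  · rw [not_nonempty_iff] at hne
    have : Subsingleton N := b.repr.toEquiv.subsingleton
    exact ⟨0, by simp, fun x => Subsingleton.elim _ _⟩

/-! ### Extension of integral linear forms -/

/-- The rational extension of an integral linear form. -/
noncomputable def extQ (m : N →ₗ[ℤ] ℤ) : NQ N →ₗ[ℚ] ℚ :=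
  (TensorProduct.rid ℤ ℚ).toLinearMap.toAddMonoidHom.toRatLinearMap ∘ₗ m.baseChange ℚ

@[simp] theorem extQ_tmul (m : N →ₗ[ℤ] ℤ) (q : ℚ) (x : N) : extQ m (q ⊗ₜ x) = q * m x := by
  simp [extQ, mul_comm]

theorem extQ_toNQ (m : N →ₗ[ℤ] ℤ) (x : N) : extQ m (toNQ x) = m x := by simp

theorem extQ_zero : extQ (0 : N →ₗ[ℤ] ℤ) = 0 := by
  ext x
  simp

theorem toNQ_add (x y : N) : toNQ (x + y) = toNQ x + toNQ y := TensorProduct.tmul_add _ _ _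

theorem toNQ_zsmul (n : ℤ) (x : N) : toNQ (n • x) = (n : ℚ) • toNQ x := by
  rw [toNQ, TensorProduct.tmul_smul, Int.cast_smul_eq_zsmul]

theorem toNQ_neg (x : N) : toNQ (-x) = -toNQ x := TensorProduct.tmul_neg _ _

theorem toNQ_sum {ι : Type*} (s : Finset ι) (x : ι → N) :
    toNQ (∑ i ∈ s, x i) = ∑ i ∈ s, toNQ (x i) := TensorProduct.tmul_sum _ _ _

theorem mapNQ_toNQ (p : N →ₗ[ℤ] N') (x : N) : mapNQ p (toNQ x) = toNQ (p x) := by simp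

theorem exists_smul_eq_toNQ (v : NQ N) : ∃ d : ℕ, 0 < d ∧ ∃ x : N, (d : ℚ) • v = toNQ x := by
  induction v using TensorProduct.induction_on with
  | zero => exact ⟨1, one_pos, 0, by simp⟩
  | tmul q y =>
    refine ⟨q.den, q.pos, q.num • y, ?_⟩
    rw [toNQ_zsmul, TensorProduct.smul_tmul', TensorProduct.smul_tmul', smul_eq_mul, smul_eq_mul,
      mul_one, Rat.den_mul_eq_num]
  | add v w hv hw =>
    obtain ⟨d, hd, x, hx⟩ := hv
    obtain ⟨e, he, y, hy⟩ := hw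
    refine ⟨d * e, Nat.mul_pos hd he, (e : ℤ) • x + (d : ℤ) • y, ?_⟩
    rw [toNQ_add, toNQ_zsmul, toNQ_zsmul, ← hx, ← hy, smul_add, smul_smul, smul_smul]
    push_cast
    rw [mul_comm]

theorem sum_extQ_co (h : IsLatticeBasis F) (v : NQ N) :
    ∑ f ∈ F, extQ (co F f) v • toNQ f = v := by
  induction v using TensorProduct.induction_on with
  | zero => simp
  | tmul q y =>
    conv_rhs => rw [← sum_co h y, TensorProduct.tmul_sum]
    refine Finset.sum_congr rfl fun f _ => ?_
    rw [extQ_tmul, TensorProduct.tmul_smul, TensorProduct.smul_tmul', smul_eq_mul, mul_one,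
      TensorProduct.smul_tmul', zsmul_eq_mul, mul_comm]
  | add x y hx hy => simp only [map_add, add_smul, Finset.sum_add_distrib, hx, hy]

theorem eq_of_extQ_co (h : IsLatticeBasis F) {v w : NQ N}
    (e : ∀ f ∈ F, extQ (co F f) v = extQ (co F f) w) : v = w := by
  rw [← sum_extQ_co h v, ← sum_extQ_co h w]
  exact Finset.sum_congr rfl fun f hf => by rw [e f hf]

theorem extQ_eq_sum_co (h : IsLatticeBasis F) (m : N →ₗ[ℤ] ℤ) (v : NQ N) :
    extQ m v = ∑ f ∈ F, extQ (co F f) v * m f := by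
  conv_lhs => rw [← sum_extQ_co h v, map_sum]
  refine Finset.sum_congr rfl fun f _ => ?_
  rw [map_smul, extQ_toNQ, smul_eq_mul]

/-! ### Cones spanned by parts of a lattice basis -/

theorem toNQ_mem_coneOf {S : Set N} {x : N} (hx : x ∈ S) : toNQ x ∈ coneOf S :=
  Submodule.subset_span ⟨x, hx, rfl⟩

theorem coneOf_mono {S T : Set N} (h : S ⊆ T) : coneOf S ≤ coneOf T :=
  Submodule.span_mono (Set.image_mono h)

theorem sum_mem_coneOf {S : Set N} {T : Finset N} (hT : ∀ f ∈ T, f ∈ S) {c : N → ℚ}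
    (hc : ∀ f ∈ T, 0 ≤ c f) : ∑ f ∈ T, c f • toNQ f ∈ coneOf S :=
  Submodule.sum_mem _ fun f hf =>
    PointedCone.smul_mem _ (hc f hf) (toNQ_mem_coneOf (hT f hf))

theorem mem_coneOf_iff (h : IsLatticeBasis F) (hS : S ⊆ F) {v : NQ N} :
    v ∈ coneOf (S : Set N) ↔
      (∀ f, 0 ≤ extQ (co F f) v) ∧ ∀ f, f ∉ S → extQ (co F f) v = 0 := by
  classical
  constructor
  · intro hv
    induction hv using Submodule.span_induction with
    | mem x hx =>
      obtain ⟨s, hs, rfl⟩ := hx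
      have hs' := hS hs
      refine ⟨fun f => ?_, fun f hf => ?_⟩
      · rw [extQ_toNQ, co_apply h f hs']; split_ifs <;> simp
      · rw [extQ_toNQ, co_ne h hs' (by rintro rfl; exact hf hs)]; simp
    | zero => simp
    | add x y _ _ hx hy =>
      refine ⟨fun f => ?_, fun f hf => ?_⟩
      · rw [map_add]; exact add_nonneg (hx.1 f) (hy.1 f)
      · rw [map_add, hx.2 f hf, hy.2 f hf, add_zero]
    | smul a x _ hx =>
      have e : ∀ f, extQ (co F f) (a • x) = (a : ℚ) * extQ (co F f) x := fun f =>
        (extQ (co F f)).map_smul (a : ℚ) x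
      refine ⟨fun f => ?_, fun f hf => ?_⟩
      · rw [e]; exact mul_nonneg a.2 (hx.1 f)
      · rw [e, hx.2 f hf, mul_zero]
  · rintro ⟨h0, h1⟩
    rw [← sum_extQ_co h v, ← Finset.sum_subset hS]
    · exact sum_mem_coneOf (fun f hf => hf) fun f _ => h0 f
    · intro f _ hf; rw [h1 f hf, zero_smul]

theorem coneOf_map (p : N →ₗ[ℤ] N') (S : Set N) :
    (coneOf S).map (mapNQ p) = coneOf (p '' S) := by
  rw [coneOf, coneOf, PointedCone.hull, PointedCone.hull, PointedCone.map, Submodule.map_span]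
  congr 1
  ext v
  simp

theorem coneOf_le_iff {S : Set N} {σ : PointedCone ℚ (NQ N)} :
    coneOf S ≤ σ ↔ ∀ s ∈ S, toNQ s ∈ σ := by
  rw [coneOf, PointedCone.hull, Submodule.span_le]
  simp [Set.subset_def]

theorem smul_toNQ_mem_iff {σ : PointedCone ℚ (NQ N)} {d : ℕ} (hd : 0 < d) {v : NQ N} :
    (d : ℚ) • v ∈ σ ↔ v ∈ σ := PointedCone.smul_mem_iff σ (by exact_mod_cast hd)

open Classical in
-- If a point of the face has positive coordinate at `f`, it is a positive multiple of `f` plus a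
-- point of the cone, so the face property puts `f` itself into the face.
theorem face_coneOf (h : IsLatticeBasis F) (hS : S ⊆ F) {τ : PointedCone ℚ (NQ N)}
    (hτ : τ.IsFaceOf (coneOf (S : Set N))) :
    τ = coneOf ((S.filter fun f => toNQ f ∈ τ : Finset N) : Set N) := by
  apply le_antisymm
  · intro v hv
    have hv' := (mem_coneOf_iff h hS).1 (hτ.le hv)
    refine (mem_coneOf_iff h ((Finset.filter_subset _ _).trans hS)).2 ⟨hv'.1, fun f hf => ?_⟩
    by_cases hfS : f ∈ S
    · have hfτ : toNQ f ∉ τ := fun h' => hf (Finset.mem_filter.2 ⟨hfS, h'⟩)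
      by_contra hne
      refine hfτ (hτ.mem_of_smul_add_mem (y := v - extQ (co F f) v • toNQ f)
        (toNQ_mem_coneOf hfS) ?_ (lt_of_le_of_ne (hv'.1 f) (Ne.symm hne)) (by simpa using hv))
      refine (mem_coneOf_iff h hS).2 ⟨fun g => ?_, fun g hg => ?_⟩
      · rw [map_sub, map_smul, extQ_toNQ, co_apply h g (hS hfS)]
        split_ifs with e
        · subst e; simp
        · simpa using hv'.1 g
      · rw [map_sub, map_smul, extQ_toNQ, co_ne h (hS hfS) (by rintro rfl; exact hg hfS),
          hv'.2 g hg]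
        simp
    · exact hv'.2 f hfS
  · rw [coneOf_le_iff]
    intro s hs
    exact (Finset.mem_filter.1 hs).2

theorem isFaceOf_coneOf (h : IsLatticeBasis F) (hS : S ⊆ F) (hT : T ⊆ S) :
    (coneOf (T : Set N)).IsFaceOf (coneOf (S : Set N)) := by
  refine ⟨coneOf_mono hT, fun {x y a} hx hy ha hxy => ?_⟩
  rw [mem_coneOf_iff h hS] at hx hy
  rw [mem_coneOf_iff h (hT.trans hS)] at hxy ⊢
  refine ⟨hx.1, fun f hf => ?_⟩
  have h1 := hxy.2 f hf
  rw [map_add, map_smul, smul_eq_mul] at h1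
  have h2 := hx.1 f
  have h3 := hy.1 f
  have h4 : a * extQ (co F f) x = 0 := by
    have := mul_nonneg ha.le h2
    linarith
  exact (mul_eq_zero.1 h4).resolve_left ha.ne'

end LatticeBasis

/-! ### Smooth projective fans described by their maximal cones. -/

section FacetSystem

variable {N N' : Type*} [AddCommGroup N] [AddCommGroup N']

/-- The maximal cones of a smooth projective fan, given by the sets of their generators: lattice
bases covering the lattice by their cones, with a strictly convex support function taking the
values `a` at the generators. -/
structure IsFacetSystem (𝓕 : Set (Finset N)) (a : N → ℤ) : Prop where
  finite : 𝓕.Finite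
  basis : ∀ F ∈ 𝓕, IsLatticeBasis F
  form : ∀ F ∈ 𝓕, ∃ m : N →ₗ[ℤ] ℤ,
    (∀ f ∈ F, m f = a f) ∧ ∀ F' ∈ 𝓕, ∀ x ∈ F', x ∉ F → m x < a x
  cover : ∀ x : N, ∃ F ∈ 𝓕, ∀ f ∈ F, 0 ≤ co F f x

namespace IsFacetSystem

variable {𝓕 : Set (Finset N)} {a : N → ℤ} (H : IsFacetSystem 𝓕 a)
include H

theorem exists_mem_coneOf (v : NQ N) : ∃ F ∈ 𝓕, v ∈ coneOf (F : Set N) := by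
  obtain ⟨d, hd, x, hx⟩ := exists_smul_eq_toNQ v
  obtain ⟨F, hF, h⟩ := H.cover x
  refine ⟨F, hF, (smul_toNQ_mem_iff hd).1 ?_⟩
  rw [hx, mem_coneOf_iff (H.basis F hF) subset_rfl]
  refine ⟨fun f => ?_, fun f hf => by rw [co_of_notMem hf, extQ_zero]; rfl⟩
  rw [extQ_toNQ]
  by_cases hf : f ∈ F
  · exact_mod_cast h f hf
  · simp [co_of_notMem hf]

/-- Strict convexity: the forms `m` and `m'` of the two cones both compute the support function at
`v`. Each is at most `a` on the generators of the other cone, so `m v = m' v`; a generator of `F`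
occurring in `v` but missing from `F'` would make one inequality strict. This is what makes the
cones meet along common faces. -/
theorem mem_of_mem_coneOf {F F' : Finset N} (hF : F ∈ 𝓕) (hF' : F' ∈ 𝓕) {v : NQ N}
    (hv : v ∈ coneOf (F : Set N)) (hv' : v ∈ coneOf (F' : Set N)) {f : N}
    (hf : extQ (co F f) v ≠ 0) : f ∈ F' := by
  obtain ⟨m', hm', hlt'⟩ := H.form F' hF'
  obtain ⟨m, hm, hlt⟩ := H.form F hF
  rw [mem_coneOf_iff (H.basis F hF) subset_rfl] at hv
  rw [mem_coneOf_iff (H.basis F' hF') subset_rfl] at hv'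
  have hfF : f ∈ F := by
    by_contra h
    rw [hv.2 f h] at hf; exact hf rfl
  by_contra hn
  have e1 : extQ m v = ∑ f ∈ F, extQ (co F f) v * a f := by
    rw [extQ_eq_sum_co (H.basis F hF)]
    exact Finset.sum_congr rfl fun f hf => by rw [hm f hf]
  have e2 : extQ m' v = ∑ f ∈ F', extQ (co F' f) v * a f := by
    rw [extQ_eq_sum_co (H.basis F' hF')]
    exact Finset.sum_congr rfl fun f hf => by rw [hm' f hf]
  have l1 : extQ m' v < extQ m v := by
    rw [e1, extQ_eq_sum_co (H.basis F hF)]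
    refine Finset.sum_lt_sum (fun g hg => mul_le_mul_of_nonneg_left ?_ (hv.1 g)) ⟨f, hfF, ?_⟩
    · by_cases hgF : g ∈ F'
      · rw [hm' g hgF]
      · exact_mod_cast (hlt' F hF g hg hgF).le
    · exact mul_lt_mul_of_pos_left (by exact_mod_cast hlt' F hF f hfF hn)
        (lt_of_le_of_ne (hv.1 f) hf.symm)
  have l2 : extQ m v ≤ extQ m' v := by
    rw [e2, extQ_eq_sum_co (H.basis F' hF')]
    refine Finset.sum_le_sum (fun g hg => mul_le_mul_of_nonneg_left ?_ (hv'.1 g))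
    by_cases hgF : g ∈ F
    · rw [hm g hgF]
    · exact_mod_cast (hlt F' hF' g hg hgF).le
  exact absurd l1 (not_lt.2 l2)

theorem extQ_co_eq {F F' : Finset N} (hF : F ∈ 𝓕) (hF' : F' ∈ 𝓕) {v : NQ N}
    (hv : v ∈ coneOf (F : Set N)) (hv' : v ∈ coneOf (F' : Set N)) (g : N) :
    extQ (co F g) v = extQ (co F' g) v := by
  classical
  by_cases hg : g ∈ F'
  · conv_rhs => rw [← sum_extQ_co (H.basis F hF) v, map_sum]
    have key : ∀ f ∈ F, extQ (co F' g) (extQ (co F f) v • toNQ f)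
        = if g = f then extQ (co F f) v else 0 := by
      intro f hf
      rw [map_smul, extQ_toNQ]
      by_cases h0 : extQ (co F f) v = 0
      · simp [h0]
      · rw [co_apply (H.basis F' hF') g (H.mem_of_mem_coneOf hF hF' hv hv' h0)]
        split_ifs <;> simp
    rw [Finset.sum_congr rfl key, Finset.sum_ite_eq]
    split_ifs with h
    · rfl
    · rw [co_of_notMem h, extQ_zero]; rfl
  · rw [co_of_notMem hg, extQ_zero]
    by_contra hne
    exact hg (H.mem_of_mem_coneOf hF hF' hv hv' hne)

theorem subset_of_coneOf_le {F F' S S' : Finset N} (hF : F ∈ 𝓕) (hF' : F' ∈ 𝓕) (hS : S ⊆ F)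
    (hS' : S' ⊆ F') (h : coneOf (S : Set N) ≤ coneOf (S' : Set N)) : S ⊆ S' := by
  intro s hs
  have h1 : toNQ s ∈ coneOf (S' : Set N) := h (toNQ_mem_coneOf hs)
  have h2 := H.extQ_co_eq hF hF' (coneOf_mono hS (toNQ_mem_coneOf hs)) (coneOf_mono hS' h1) s
  rw [extQ_toNQ, co_self (H.basis F hF) (hS hs)] at h2
  by_contra hn
  rw [((mem_coneOf_iff (H.basis F' hF') hS').1 h1).2 s hn] at h2
  simp at h2

theorem mem_of_toNQ_mem {F F' S' : Finset N} (hF : F ∈ 𝓕) (hF' : F' ∈ 𝓕)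
    (hS' : S' ⊆ F') {x : N} (hx : x ∈ F) (h : toNQ x ∈ coneOf (S' : Set N)) : x ∈ S' := by
  have := H.subset_of_coneOf_le (S := {x}) hF hF' (by simpa using hx) hS'
    (by rw [coneOf_le_iff]; simpa using h)
  simpa using this

theorem nonempty : 𝓕.Nonempty := by
  obtain ⟨F, hF, -⟩ := H.cover 0
  exact ⟨F, hF⟩

/-- The fan of a facet system. -/
noncomputable def fan : Fan N where
  cones := {σ | ∃ F ∈ 𝓕, ∃ S : Finset N, S ⊆ F ∧ σ = coneOf (S : Set N)}
  finite := by
    refine (H.finite.biUnion (t := fun F => (fun S : Finset N => coneOf (S : Set N)) ''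
      (F.powerset : Set (Finset N))) fun F _ => (F.powerset.finite_toSet.image _)).subset ?_
    rintro σ ⟨F, hF, S, hS, rfl⟩
    exact Set.mem_biUnion hF ⟨S, by simpa using hS, rfl⟩
  nonempty := by
    obtain ⟨F, hF⟩ := H.nonempty
    exact ⟨_, F, hF, ∅, Finset.empty_subset _, rfl⟩
  rational_polyhedral := by
    rintro σ ⟨F, hF, S, hS, rfl⟩
    exact ⟨S, rfl⟩
  strongly_convex := by
    rintro σ ⟨F, hF, S, hS, rfl⟩ x hx hx'
    rw [mem_coneOf_iff (H.basis F hF) hS] at hx hx'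
    refine eq_of_extQ_co (H.basis F hF) fun f _ => ?_
    have h1 := hx.1 f
    have h2 := hx'.1 f
    rw [map_neg] at h2
    rw [map_zero]
    linarith
  face_mem := by
    rintro σ ⟨F, hF, S, hS, rfl⟩ τ hτ
    classical
    exact ⟨F, hF, _, (Finset.filter_subset _ _).trans hS, face_coneOf (H.basis F hF) hS hτ⟩
  inf_isFaceOf := by
    rintro σ ⟨F, hF, S, hS, rfl⟩ τ ⟨F', hF', S', hS', rfl⟩
    classical
    have : coneOf (S : Set N) ⊓ coneOf (S' : Set N) = coneOf ((S ∩ S' : Finset N) : Set N) := by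
      apply le_antisymm
      · rintro v ⟨h1, h2⟩
        have key := H.extQ_co_eq hF hF' (coneOf_mono hS h1) (coneOf_mono hS' h2)
        have h1' := (mem_coneOf_iff (H.basis F hF) hS).1 h1
        have h2' := (mem_coneOf_iff (H.basis F' hF') hS').1 h2
        refine (mem_coneOf_iff (H.basis F hF) (Finset.inter_subset_left.trans hS)).2
          ⟨h1'.1, fun f hf => ?_⟩
        by_cases hfS : f ∈ S
        · rw [key]
          exact h2'.2 f fun h => hf (Finset.mem_inter.2 ⟨hfS, h⟩)
        · exact h1'.2 f hfS
      · exact le_inf (coneOf_mono (by simp)) (coneOf_mono (by simp))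
    rw [this]
    exact isFaceOf_coneOf (H.basis F hF) hS Finset.inter_subset_left

end IsFacetSystem

/-- The toric variety of a facet system. -/
noncomputable def IsFacetSystem.variety {N : Type u} [AddCommGroup N] [Module.Free ℤ N]
    [Module.Finite ℤ N] {𝓕 : Set (Finset N)} {a : N → ℤ} (H : IsFacetSystem 𝓕 a) :
    ToricVariety.{u} where
  N := N
  fan := H.fan

/-- The maximal cones of the fan of `X` are the cones spanned by the members of `𝓕`. -/
def ToricVariety.HasFacets (X : ToricVariety.{u}) (𝓕 : Set (Finset X.N)) : Prop :=
  ∀ σ, σ ∈ X.fan.cones ↔ ∃ F ∈ 𝓕, ∃ S : Finset X.N, S ⊆ F ∧ σ = coneOf (S : Set X.N)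

theorem IsFacetSystem.hasFacets_variety {N : Type u} [AddCommGroup N] [Module.Free ℤ N]
    [Module.Finite ℤ N] {𝓕 : Set (Finset N)} {a : N → ℤ} (H : IsFacetSystem 𝓕 a) :
    H.variety.HasFacets 𝓕 := fun _ => Iff.rfl

namespace ToricVariety

variable {X : ToricVariety.{u}} {𝓕 : Set (Finset X.N)} {a : X.N → ℤ}

theorem HasFacets.mem_cones (hX : X.HasFacets 𝓕) {F S : Finset X.N} (hF : F ∈ 𝓕) (hS : S ⊆ F) :
    coneOf (S : Set X.N) ∈ X.fan.cones := (hX _).2 ⟨F, hF, S, hS, rfl⟩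

theorem HasFacets.isSmooth (hX : X.HasFacets 𝓕) (H : IsFacetSystem 𝓕 a) : X.IsSmooth := by
  intro σ hσ
  obtain ⟨F, hF, S, hS, rfl⟩ := (hX σ).1 hσ
  have hb := H.basis F hF
  let e : F ≃ Fin (Module.finrank ℤ X.N) := F.equivFinOfCardEq (card_lattice_basis hb)
  refine ⟨(latticeBasis hb).reindex e, {i | ((e.symm i : F) : X.N) ∈ S}, ?_⟩
  congr 1
  ext x
  simp only [Set.mem_image, Set.mem_ofPred_eq, Module.Basis.reindex_apply, latticeBasis_apply]
  constructor
  · intro hx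
    exact ⟨e ⟨x, hS hx⟩, by simpa using hx, by simp⟩
  · rintro ⟨i, hi, rfl⟩
    exact hi

theorem HasFacets.isComplete (hX : X.HasFacets 𝓕) (H : IsFacetSystem 𝓕 a) : X.IsComplete := by
  intro v
  obtain ⟨F, hF, hv⟩ := H.exists_mem_coneOf v
  exact ⟨_, hX.mem_cones hF subset_rfl, hv⟩

/-- Some `s ∈ S` occurs in `x` and lies on the ray of `x`, so `x` is an integral multiple of `s`;
primitivity makes the factor 1. -/
theorem mem_of_coneOf_singleton_eq {N : Type*} [AddCommGroup N] {F S : Finset N}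
    (hb : IsLatticeBasis F) (hS : S ⊆ F) {x : N} (hx0 : x ≠ 0)
    (hprim : ∀ (k : ℕ) (y : N), x = k • y → k = 1)
    (hσ : coneOf ({x} : Set N) = coneOf (S : Set N)) : x ∈ S := by
  have hxS : toNQ x ∈ coneOf (S : Set N) := by
    rw [← hσ]; exact toNQ_mem_coneOf rfl
  have hS0 : ∃ s ∈ S, co F s x ≠ 0 := by
    by_contra! h
    refine hx0 (eq_zero_of_co hb fun f hf => ?_)
    by_cases hfS : f ∈ S
    · exact h f hfS
    · have := ((mem_coneOf_iff hb hS).1 hxS).2 f hfS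
      rw [extQ_toNQ] at this
      exact_mod_cast this
  obtain ⟨s, hs, hs0⟩ := hS0
  have hspos : 0 < co F s x := by
    have := ((mem_coneOf_iff hb hS).1 hxS).1 s
    rw [extQ_toNQ] at this
    exact lt_of_le_of_ne (by exact_mod_cast this) hs0.symm
  have hsx : toNQ s ∈ coneOf ({x} : Set N) := by
    rw [hσ]; exact toNQ_mem_coneOf hs
  rw [coneOf, Set.image_singleton, PointedCone.hull, Submodule.mem_span_singleton] at hsx
  obtain ⟨q, hq⟩ := hsx
  have hq' : ∀ f, (q : ℚ) * co F f x = co F f s := by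
    intro f
    have := congrArg (extQ (co F f)) hq
    rw [extQ_toNQ] at this
    rw [← this, ← extQ_toNQ (co F f) x]
    exact ((extQ (co F f)).map_smul (q : ℚ) (toNQ x)).symm
  have hqne : (q : ℚ) ≠ 0 := by
    intro h0
    have := hq' s
    rw [h0, co_self hb (hS hs)] at this
    simp at this
  have hxs : x = co F s x • s := by
    refine eq_of_co hb fun f hf => ?_
    rw [map_smul, smul_eq_mul]
    by_cases hfs : f = s
    · subst hfs; rw [co_self hb (hS hs), mul_one]
    · have := hq' f
      rw [co_ne hb (hS hs) hfs] at this ⊢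
      simpa [hqne] using this
  have hnat : ((co F s x).toNat : ℤ) = co F s x := Int.toNat_of_nonneg hspos.le
  have h1 := hprim (co F s x).toNat s (by rw [← natCast_zsmul, hnat]; exact hxs)
  have h2 : co F s x = 1 := by rw [← hnat, h1]; rfl
  rw [h2, one_smul] at hxs
  exact hxs ▸ hs

theorem primitive_of_mem_basis {N : Type*} [AddCommGroup N] {F : Finset N}
    (hb : IsLatticeBasis F) {x : N} (hx : x ∈ F) (k : ℕ) (y : N) (hy : x = k • y) : k = 1 := by
  have h1 := co_self hb hx
  have h2 : (k : ℤ) * co F x y = 1 := by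
    have := congrArg (co F x) hy
    rw [h1, map_nsmul, nsmul_eq_mul] at this
    exact this.symm
  have := Int.eq_one_or_neg_one_of_mul_eq_one h2
  omega

theorem mem_gens_of_basis {F : Finset X.N} (hb : IsLatticeBasis F)
    (hF : coneOf (F : Set X.N) ∈ X.fan.cones) {x : X.N} (hx : x ∈ F) : x ∈ X.gens := by
  refine ⟨?_, ne_zero_of_mem_basis hb hx, primitive_of_mem_basis hb hx⟩
  have := X.fan.face_mem _ hF _
    (isFaceOf_coneOf (T := {x}) hb subset_rfl (by simpa using hx))
  simpa using this

theorem HasFacets.mem_gens_iff (hX : X.HasFacets 𝓕) (H : IsFacetSystem 𝓕 a) {x : X.N} :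
    x ∈ X.gens ↔ ∃ F ∈ 𝓕, x ∈ F := by
  constructor
  · rintro ⟨hx, hx0, hprim⟩
    obtain ⟨F, hF, S, hS, hσ⟩ := (hX _).1 hx
    exact ⟨F, hF, hS (mem_of_coneOf_singleton_eq (H.basis F hF) hS hx0 hprim hσ)⟩
  · rintro ⟨F, hF, hx⟩
    exact mem_gens_of_basis (H.basis F hF) (hX.mem_cones hF subset_rfl) hx

theorem HasFacets.maximal_iff (hX : X.HasFacets 𝓕) {σ : PointedCone ℚ (NQ X.N)}
    (h : Maximal (fun τ => τ ∈ X.fan.cones) σ) : ∃ F ∈ 𝓕, σ = coneOf (F : Set X.N) := by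
  obtain ⟨F, hF, S, hS, rfl⟩ := (hX _).1 h.1
  exact ⟨F, hF, h.eq_of_le (hX.mem_cones hF subset_rfl) (coneOf_mono hS)⟩

theorem HasFacets.isAmple (hX : X.HasFacets 𝓕) (H : IsFacetSystem 𝓕 a) : X.IsAmple a := by
  intro σ hσ
  obtain ⟨F, hF, rfl⟩ := hX.maximal_iff hσ
  obtain ⟨m, hm, hlt⟩ := H.form F hF
  refine ⟨m, fun x hx => ?_⟩
  obtain ⟨F', hF', hx⟩ := (hX.mem_gens_iff H).1 hx
  exact ⟨fun h => hm x (H.mem_of_toNQ_mem hF' hF subset_rfl hx h),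
    fun h => hlt F' hF' x hx fun h' => h (toNQ_mem_coneOf h')⟩

theorem HasFacets.isProjective (hX : X.HasFacets 𝓕) (H : IsFacetSystem 𝓕 a) : X.IsProjective :=
  ⟨hX.isComplete H, a, hX.isAmple H⟩

theorem HasFacets.isFano (hX : X.HasFacets 𝓕) (H : IsFacetSystem 𝓕 fun _ => 1) : X.IsFano :=
  ⟨hX.isComplete H, hX.isAmple H⟩

end ToricVariety

end FacetSystem

/-! ### The facet system of a smooth complete toric variety. -/

namespace ToricVariety

variable {X : ToricVariety.{u}}

/-- The lattice bases spanning a cone of the fan. -/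
def facets (X : ToricVariety.{u}) : Set (Finset X.N) :=
  {F | IsLatticeBasis F ∧ coneOf (F : Set X.N) ∈ X.fan.cones}

theorem IsSmooth.exists_basis (hs : X.IsSmooth) {σ : PointedCone ℚ (NQ X.N)}
    (hσ : σ ∈ X.fan.cones) : ∃ F : Finset X.N, IsLatticeBasis F ∧ ∃ S : Finset X.N, S ⊆ F ∧
      σ = coneOf (S : Set X.N) := by
  classical
  obtain ⟨b, I, rfl⟩ := hs σ hσ
  refine ⟨_, isLatticeBasis_image b, (Finset.univ.filter (· ∈ I)).image b,
    Finset.image_subset_image (Finset.filter_subset _ _), ?_⟩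
  congr 1
  ext x
  simp

/-- A generic direction exists because finitely many proper subspaces do not cover a vector space
over an infinite field. -/
theorem exists_notMem_span (X : ToricVariety.{u}) : ∃ d : NQ X.N, ∀ σ ∈ X.fan.cones,
    Submodule.span ℚ (σ : Set (NQ X.N)) ≠ ⊤ → d ∉ Submodule.span ℚ (σ : Set (NQ X.N)) := by
  classical
  let s : Finset (Subspace ℚ (NQ X.N)) :=
    (Finset.image (fun σ : PointedCone ℚ (NQ X.N) => Submodule.span ℚ (σ : Set (NQ X.N)))
      X.fan.finite.toFinset).filter (· ≠ ⊤)
  have h : ⊤ ∉ s := by simp [s]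
  have := Subspace.biUnion_ne_univ_of_top_notMem h
  rw [Ne, Set.eq_univ_iff_forall] at this
  push Not at this
  obtain ⟨d, hd⟩ := this
  refine ⟨d, fun σ hσ hne hdσ => hd ?_⟩
  simp only [Set.mem_iUnion]
  refine ⟨_, ?_, hdσ⟩
  simp only [s, Finset.mem_filter, Finset.mem_image, Set.Finite.mem_toFinset]
  exact ⟨⟨σ, hσ, rfl⟩, hne⟩

theorem nonneg_of_frequently {c e : ℚ} {s : Set ℕ} (hs : s.Infinite)
    (h : ∀ n ∈ s, 0 ≤ c + (1 / ((n : ℚ) + 1)) * e) : 0 ≤ c := by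
  by_contra! hc
  obtain ⟨n, hn⟩ := exists_nat_gt (e / -c)
  obtain ⟨k, hk, hnk⟩ := hs.exists_gt n
  have h1 := h k hk
  have hpos : (0 : ℚ) < (k : ℚ) + 1 := by positivity
  have h2 : 0 ≤ (c + (1 / ((k : ℚ) + 1)) * e) * ((k : ℚ) + 1) := mul_nonneg h1 hpos.le
  have h3 : (c + (1 / ((k : ℚ) + 1)) * e) * ((k : ℚ) + 1) = c * ((k : ℚ) + 1) + e := by
    field_simp
  rw [h3] at h2
  rw [div_lt_iff₀ (by linarith)] at hn
  have h4 : (n : ℚ) < k := by exact_mod_cast hnk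
  nlinarith

/-- Perturb `v` by `d / (n + 1)` with `d` generic. Infinitely many of these points lie in the same
cone, which must be of full dimension, and letting `n` grow shows that `v` lies in it too. -/
theorem exists_mem_facets (hs : X.IsSmooth) (hc : X.IsComplete) (v : NQ X.N) :
    ∃ F ∈ X.facets, v ∈ coneOf (F : Set X.N) := by
  obtain ⟨d, hd⟩ := X.exists_notMem_span
  choose σ hσ hv using fun n : ℕ => hc (v + (1 / ((n : ℚ) + 1)) • d)
  have : Finite X.fan.cones := X.fan.finite
  obtain ⟨⟨τ, hτ⟩, hinf⟩ := Finite.exists_infinite_fiber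
    (fun n => (⟨σ n, hσ n⟩ : X.fan.cones))
  have hinf' : {n | σ n = τ}.Infinite := by
    have h := Set.infinite_coe_iff.1 hinf
    refine h.mono fun n hn => ?_
    simpa using hn
  obtain ⟨F, hb, S, hS, rfl⟩ := hs.exists_basis hτ
  have hv' : ∀ n ∈ {n | σ n = coneOf (S : Set X.N)},
      v + (1 / ((n : ℚ) + 1)) • d ∈ coneOf (S : Set X.N) := fun n hn => by
    have := hv n
    rwa [show σ n = _ from hn] at this
  -- If `S` were smaller, the cone would span a proper subspace; it contains two perturbations of
  -- `v`, hence a nonzero multiple of `d`, against genericity.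
  have hSF : S = F := by
    refine hS.antisymm fun f hf => ?_
    by_contra hfS
    have hle : Submodule.span ℚ (coneOf (S : Set X.N) : Set (NQ X.N))
        ≤ LinearMap.ker (extQ (co F f)) := by
      rw [Submodule.span_le]
      intro w hw
      exact ((mem_coneOf_iff hb hS).1 hw).2 f hfS
    have hne : Submodule.span ℚ (coneOf (S : Set X.N) : Set (NQ X.N)) ≠ ⊤ := by
      intro e
      rw [e, top_le_iff, LinearMap.ker_eq_top] at hle
      have := extQ_toNQ (co F f) f
      rw [hle, co_self hb hf] at this
      simp at this
    refine hd _ hτ hne ?_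
    obtain ⟨n, hn⟩ := hinf'.nonempty
    obtain ⟨k, hk, hnk⟩ := hinf'.exists_gt n
    have h1 := Submodule.subset_span (R := ℚ) (hv' n hn)
    have h2 := Submodule.subset_span (R := ℚ) (hv' k hk)
    have h3 := Submodule.sub_mem _ h1 h2
    rw [add_sub_add_left_eq_sub, ← sub_smul] at h3
    have hne' : (1 / ((n : ℚ) + 1) - 1 / ((k : ℚ) + 1)) ≠ 0 := by
      have : (n : ℚ) < k := by exact_mod_cast hnk
      have := one_div_lt_one_div_of_lt (a := (n : ℚ) + 1) (b := (k : ℚ) + 1) (by positivity)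
        (by linarith)
      linarith
    exact (Submodule.smul_mem_iff _ hne').1 h3
  subst hSF
  refine ⟨S, ⟨hb, hτ⟩, (mem_coneOf_iff hb subset_rfl).2 ⟨fun f => ?_, fun f hf => ?_⟩⟩
  · refine nonneg_of_frequently (e := extQ (co S f) d) hinf' fun n hn => ?_
    have := ((mem_coneOf_iff hb subset_rfl).1 (hv' n hn)).1 f
    rwa [map_add, map_smul, smul_eq_mul] at this
  · rw [co_of_notMem hf, extQ_zero]; rfl

/-- The sum of the generators of a cone is a relative interior point. A full-dimensional cone
containing that point meets the given cone in a face, which contains every summand. -/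
theorem hasFacets_facets (hs : X.IsSmooth) (hc : X.IsComplete) : X.HasFacets X.facets := by
  intro σ
  constructor
  · intro hσ
    obtain ⟨F₁, hb₁, S, hS, rfl⟩ := hs.exists_basis hσ
    obtain ⟨F, ⟨hb, hF⟩, hv⟩ := exists_mem_facets hs hc (∑ s : S, toNQ (s : X.N))
    have h1 := X.fan.inf_isFaceOf _ hσ _ hF
    have hle : coneOf (S : Set X.N) ≤ coneOf (F : Set X.N) := by
      rw [coneOf_le_iff]
      intro s hs
      exact (h1.mem_of_sum_mem (f := fun s : S => toNQ (s : X.N))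
        (fun s => toNQ_mem_coneOf s.2)
        ⟨Submodule.sum_mem _ fun s _ => toNQ_mem_coneOf s.2, hv⟩ ⟨s, hs⟩).2
    have h2 := X.fan.inf_isFaceOf _ hF _ hσ
    rw [inf_eq_right.2 hle] at h2
    classical
    exact ⟨F, ⟨hb, hF⟩, _, Finset.filter_subset _ _, face_coneOf hb subset_rfl h2⟩
  · rintro ⟨F, ⟨hb, hF⟩, S, hS, rfl⟩
    exact X.fan.face_mem _ hF _ (isFaceOf_coneOf hb subset_rfl hS)

theorem mem_of_toNQ_mem_facet {F : Finset X.N} (hF : F ∈ X.facets) {x : X.N} (hx : x ∈ X.gens)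
    (h : toNQ x ∈ coneOf (F : Set X.N)) : x ∈ F := by
  have h1 := X.fan.inf_isFaceOf _ hF.2 _ hx.1
  have hle : coneOf ({x} : Set X.N) ≤ coneOf (F : Set X.N) := by
    rw [coneOf_le_iff]; simpa using h
  rw [inf_eq_right.2 hle] at h1
  classical
  exact Finset.filter_subset _ _
    (mem_of_coneOf_singleton_eq hF.1 (Finset.filter_subset _ _) hx.2.1 hx.2.2
      (face_coneOf hF.1 subset_rfl h1))

/-- Adding a large multiple of `∑ f ∈ F, f` moves any vector into the cone of `F`. If that cone is a
face of a larger one, every vector of the larger cone therefore lies in it already. -/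
theorem maximal_of_mem_facets {F : Finset X.N} (hF : F ∈ X.facets) :
    Maximal (fun τ => τ ∈ X.fan.cones) (coneOf (F : Set X.N)) := by
  refine ⟨hF.2, fun τ hτ hle x hx => ?_⟩
  have h1 := X.fan.inf_isFaceOf _ hτ _ hF.2
  rw [inf_eq_right.2 hle] at h1
  have hb := hF.1
  let t : ℚ := ∑ f ∈ F, |extQ (co F f) x|
  have ht : 0 ≤ t := Finset.sum_nonneg fun f _ => abs_nonneg _
  have hz : (∑ f ∈ F, t • toNQ f) ∈ coneOf (F : Set X.N) :=
    sum_mem_coneOf (fun f hf => hf) fun f _ => ht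
  refine h1.mem_of_smul_add_mem hx (hle hz) one_pos ?_
  rw [one_smul, ← sum_extQ_co hb x, ← Finset.sum_add_distrib]
  simp_rw [← add_smul]
  refine sum_mem_coneOf (fun f hf => hf) fun f hf => ?_
  have h2 : |extQ (co F f) x| ≤ t :=
    Finset.single_le_sum (f := fun f => |extQ (co F f) x|) (fun f _ => abs_nonneg _) hf
  have := neg_abs_le (extQ (co F f) x)
  linarith

theorem isFacetSystem_facets (hs : X.IsSmooth) (hc : X.IsComplete) {a : X.N → ℤ}
    (ha : X.IsAmple a) : IsFacetSystem X.facets a where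
  finite := by
    refine Set.Finite.of_finite_image (f := fun F => coneOf (F : Set X.N))
      (X.fan.finite.subset ?_) ?_
    · rintro _ ⟨F, hF, rfl⟩
      exact hF.2
    · intro F hF F' hF' e
      refine subset_basis_eq hF.1 hF'.1 fun f hf => ?_
      refine mem_of_toNQ_mem_facet hF' (mem_gens_of_basis hF.1 hF.2 hf) ?_
      rw [← show coneOf (F : Set X.N) = coneOf (F' : Set X.N) from e]
      exact toNQ_mem_coneOf hf
  basis F hF := hF.1
  form F hF := by
    obtain ⟨m, hm⟩ := ha _ (maximal_of_mem_facets hF)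
    refine ⟨m, fun f hf => (hm f (mem_gens_of_basis hF.1 hF.2 hf)).1 (toNQ_mem_coneOf hf),
      fun F' hF' x hx hxF => ?_⟩
    have hg := mem_gens_of_basis hF'.1 hF'.2 hx
    exact (hm x hg).2 fun h => hxF (mem_of_toNQ_mem_facet hF hg h)
  cover x := by
    obtain ⟨F, hF, h⟩ := exists_mem_facets hs hc (toNQ x)
    refine ⟨F, hF, fun f _ => ?_⟩
    have := ((mem_coneOf_iff hF.1 subset_rfl).1 h).1 f
    rw [extQ_toNQ] at this
    exact_mod_cast this

end ToricVariety

/-! ### Facet systems of bundles. -/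

section BundleFacets

variable {L N M : Type*} [AddCommGroup L] [AddCommGroup N] [AddCommGroup M]

/-- The trivialization over the maximal cone `R`: the section of `p` is prescribed on the basis `R`
by the lift `l`, so lifted generators become horizontal. It depends on `R`, which is how the bundle
may be globally twisted. -/
theorem exists_splitting {j : L →ₗ[ℤ] N} {p : N →ₗ[ℤ] M} (hj : Function.Injective j)
    (hex : ∀ x, p x = 0 ↔ ∃ y, j y = x) {R : Finset M} (hR : IsLatticeBasis R) {l : M → N}
    (hl : ∀ r ∈ R, p (l r) = r) :
    ∃ e : N ≃ₗ[ℤ] L × M, (∀ x, (e x).2 = p x) ∧ (∀ y, e (j y) = (y, 0)) ∧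
      ∀ r ∈ R, e (l r) = (0, r) := by
  classical
  let s : M →ₗ[ℤ] N := ∑ r ∈ R, (co R r).smulRight (l r)
  have hs : ∀ z, s z = ∑ r ∈ R, co R r z • l r := fun z => by simp [s]
  have hps : ∀ z, p (s z) = z := fun z => by
    rw [hs, map_sum]
    conv_rhs => rw [← sum_co hR z]
    exact Finset.sum_congr rfl fun r hr => by rw [map_smul, hl r hr]
  have hpj : ∀ y, p (j y) = 0 := fun y => (hex _).2 ⟨y, rfl⟩
  let g : L × M →ₗ[ℤ] N := j ∘ₗ LinearMap.fst ℤ L M + s ∘ₗ LinearMap.snd ℤ L M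
  have hg : ∀ y z, g (y, z) = j y + s z := fun y z => rfl
  have hbij : Function.Bijective g := by
    constructor
    · rw [← LinearMap.ker_eq_bot, LinearMap.ker_eq_bot']
      rintro ⟨y, z⟩ h
      rw [hg] at h
      have hz := congrArg p h
      rw [map_add, hpj, hps, zero_add, map_zero] at hz
      subst hz
      rw [map_zero, add_zero, ← map_zero j] at h
      rw [hj h]; rfl
    · intro x
      obtain ⟨y, hy⟩ := (hex (x - s (p x))).1 (by rw [map_sub, hps, sub_self])
      exact ⟨(y, p x), by rw [hg, hy, sub_add_cancel]⟩
  let e := LinearEquiv.ofBijective g hbij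
  refine ⟨e.symm, fun x => ?_, fun y => ?_, fun r hr => ?_⟩
  · obtain ⟨⟨y, z⟩, rfl⟩ := e.surjective x
    rw [e.symm_apply_apply]
    change z = p (g (y, z))
    rw [hg, map_add, hpj, hps, zero_add]
  · rw [LinearEquiv.symm_apply_eq]
    change j y = g (y, 0)
    rw [hg, map_zero, add_zero]
  · rw [LinearEquiv.symm_apply_eq]
    change l r = g (0, r)
    rw [hg, map_zero, zero_add, hs, Finset.sum_eq_single r]
    · rw [co_self hR hr, one_smul]
    · intro q _ hqr; rw [co_ne hR hr hqr, zero_smul]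
    · exact fun h => absurd hr h

open Classical in
theorem co_eq_of_apply {F : Finset N} (h : IsLatticeBasis F) {f : N}
    {m : N →ₗ[ℤ] ℤ} (hm : ∀ g ∈ F, m g = if f = g then 1 else 0) : co F f = m :=
  linearMap_ext_of_basis h fun g hg => by rw [co_apply h f hg, hm g hg]

open Classical in
theorem bundle_basis {j : L →ₗ[ℤ] N} {p : N →ₗ[ℤ] M} {E : Finset L} {R : Finset M}
    (hE : IsLatticeBasis E) (hR : IsLatticeBasis R) {l : M → N}
    {e : N ≃ₗ[ℤ] L × M} (he : ∀ x, (e x).2 = p x) (hej : ∀ y, e (j y) = (y, 0))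
    (hel : ∀ r ∈ R, e (l r) = (0, r)) :
    IsLatticeBasis (E.image j ∪ R.image l) ∧
      (∀ f ∈ E, ∀ x, co (E.image j ∪ R.image l) (j f) x = co E f (e x).1) ∧
      ∀ r ∈ R, ∀ x, co (E.image j ∪ R.image l) (l r) x = co R r (p x) := by
  have hb : IsLatticeBasis (E.image j ∪ R.image l) := by
    convert isLatticeBasis_image (((latticeBasis hE).prod (latticeBasis hR)).map e.symm) using 1
    ext x
    simp only [Finset.mem_union, Finset.mem_image, Finset.mem_univ, true_and, Sum.exists,
      Module.Basis.map_apply, Module.Basis.prod_apply, Sum.elim_inl, Sum.elim_inr,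
      Function.comp_apply, latticeBasis_apply, LinearMap.coe_inl, LinearMap.coe_inr,
      Subtype.exists, exists_prop, LinearEquiv.symm_apply_eq]
    refine or_congr (exists_congr fun y => and_congr_right fun hy => ?_)
      (exists_congr fun r => and_congr_right fun hr => ?_)
    · rw [← hej, e.injective.eq_iff]
    · rw [← hel r hr, e.injective.eq_iff]
  refine ⟨hb, fun f hf x => ?_, fun r hr x => ?_⟩
  · refine LinearMap.congr_fun (co_eq_of_apply hb (m := co E f ∘ₗ LinearMap.fst ℤ L M ∘ₗ
      e.toLinearMap) fun g hg => ?_) x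
    rcases Finset.mem_union.1 hg with hg | hg <;> obtain ⟨y, hy, rfl⟩ := Finset.mem_image.1 hg
    · have : (j f = j y) ↔ f = y := by
        rw [← e.injective.eq_iff, hej, hej]; simp
      simp [hej, co_apply hE f hy, this]
    · have : j f ≠ l y := by
        intro h
        have := congrArg e h
        rw [hej, hel y hy] at this
        exact ne_zero_of_mem_basis hE hf (Prod.ext_iff.1 this).1
      simp [hel y hy, this]
  · refine LinearMap.congr_fun (co_eq_of_apply hb (m := co R r ∘ₗ p)
      fun g hg => ?_) x
    rcases Finset.mem_union.1 hg with hg | hg <;> obtain ⟨y, hy, rfl⟩ := Finset.mem_image.1 hg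
    · have : l r ≠ j y := by
        intro h
        have := congrArg e h
        rw [hej, hel r hr] at this
        exact ne_zero_of_mem_basis hR hr (Prod.ext_iff.1 this).2
      simp [← he, hej, this]
    · have : (l r = l y) ↔ r = y := by
        rw [← e.injective.eq_iff, hel r hr, hel y hy]; simp
      simp [← he, hel y hy, co_apply hR r hy, this]

open Classical in
/-- The facets of a bundle with fiber having the facets `𝓔` and base having the facets `𝓡`, the
generators of the base being lifted by `l`. -/
def bundleFacets (j : L →ₗ[ℤ] N) (l : M → N) (𝓔 : Set (Finset L)) (𝓡 : Set (Finset M)) :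
    Set (Finset N) :=
  {F | ∃ E ∈ 𝓔, ∃ R ∈ 𝓡, F = E.image j ∪ R.image l}

/-- The sum of the coordinates with respect to a lattice basis. -/
noncomputable def hgt (F : Finset N) : N →ₗ[ℤ] ℤ := ∑ f ∈ F, co F f

theorem hgt_apply (F : Finset N) (x : N) : hgt F x = ∑ f ∈ F, co F f x := by
  simp [hgt]

theorem hgt_of_mem {F : Finset N} (h : IsLatticeBasis F) {f : N} (hf : f ∈ F) : hgt F f = 1 := by
  classical
  rw [hgt_apply, Finset.sum_congr rfl fun g _ => co_apply h g hf]
  simp [hf]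

theorem eq_hgt {F : Finset N} (h : IsLatticeBasis F) {m : N →ₗ[ℤ] ℤ} (hm : ∀ f ∈ F, m f = 1) :
    m = hgt F :=
  linearMap_ext_of_basis h fun f hf => by rw [hm f hf, hgt_of_mem h hf]

theorem IsFacetSystem.hgt_lt {𝓕 : Set (Finset N)} (H : IsFacetSystem 𝓕 fun _ => 1)
    {F F' : Finset N} (hF : F ∈ 𝓕) (hF' : F' ∈ 𝓕) {x : N} (hx : x ∈ F') (hn : x ∉ F) :
    hgt F x < 1 := by
  obtain ⟨m, hm, hlt⟩ := H.form F hF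
  rw [← eq_hgt (H.basis F hF) hm]
  exact hlt F' hF' x hx hn

/-- The base cone is chosen from `p x`, then the fiber cone from the fiber component of `x` in the
trivialization belonging to that base cone. -/
theorem bundle_cover {j : L →ₗ[ℤ] N} {p : N →ₗ[ℤ] M} (hj : Function.Injective j)
    (hex : ∀ x, p x = 0 ↔ ∃ y, j y = x) {𝓔 : Set (Finset L)} {𝓡 : Set (Finset M)}
    {a : L → ℤ} {a' : M → ℤ}
    (HE : IsFacetSystem 𝓔 a) (HR : IsFacetSystem 𝓡 a') {l : M → N}
    (hl : ∀ R ∈ 𝓡, ∀ r ∈ R, p (l r) = r) (x : N) :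
    ∃ F ∈ bundleFacets j l 𝓔 𝓡, ∀ f ∈ F, 0 ≤ co F f x := by
  classical
  obtain ⟨R, hR, hxR⟩ := HR.cover (p x)
  obtain ⟨e, he, hej, hel⟩ := exists_splitting hj hex (HR.basis R hR) (hl R hR)
  obtain ⟨E, hE, hxE⟩ := HE.cover (e x).1
  obtain ⟨-, h1, h2⟩ := bundle_basis (HE.basis E hE) (HR.basis R hR) he hej hel
  refine ⟨_, ⟨E, hE, R, hR, rfl⟩, fun f hf => ?_⟩
  rcases Finset.mem_union.1 hf with hf | hf <;> obtain ⟨y, hy, rfl⟩ := Finset.mem_image.1 hf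
  · rw [h1 y hy]; exact hxE y hy
  · rw [h2 y hy]; exact hxR y hy

/-- The usual relatively ample plus large multiple of ample: the support function is 1 on fiber
generators and `c` on lifted ones, with local form the fiber height plus `c` times the base height.
-/
theorem exists_bundle_isFacetSystem {j : L →ₗ[ℤ] N} {p : N →ₗ[ℤ] M}
    (hj : Function.Injective j) (hex : ∀ x, p x = 0 ↔ ∃ y, j y = x) {𝓔 : Set (Finset L)}
    {𝓡 : Set (Finset M)} (HE : IsFacetSystem 𝓔 fun _ => 1) (HR : IsFacetSystem 𝓡 fun _ => 1)
    {l : M → N} (hl : ∀ R ∈ 𝓡, ∀ r ∈ R, p (l r) = r) :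
    ∃ a : N → ℤ, IsFacetSystem (bundleFacets j l 𝓔 𝓡) a := by
  classical
  choose e he hej hel using fun R hR => exists_splitting hj hex (HR.basis R hR) (hl R hR)
  -- The constant `c` has to exceed the fiber heights of all lifts in all trivializations, a finite
  -- set of integers. A lift off `R` has base height at most 0, so its value stays below `c`.
  have hbd : ∀ᶠ c : ℤ in Filter.atTop, ∀ E ∈ 𝓔, ∀ R : 𝓡, ∀ R' ∈ 𝓡, ∀ r ∈ (R' : Set M),
      hgt E (e R.1 R.2 (l r)).1 < c := by
    rw [Filter.eventually_all_finite HE.finite]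
    intro E _
    have := HR.finite.to_subtype
    rw [Filter.eventually_all]
    intro R
    rw [Filter.eventually_all_finite HR.finite]
    intro R' _
    rw [Filter.eventually_all_finite R'.finite_toSet]
    intro r _
    exact Filter.eventually_gt_atTop _
  obtain ⟨c, hc, hc1⟩ := (hbd.and (Filter.eventually_gt_atTop 0)).exists
  have hpj : ∀ y, p (j y) = 0 := fun y => (hex _).2 ⟨y, rfl⟩
  have hpl : ∀ R ∈ 𝓡, ∀ r ∈ R, r ≠ 0 := fun R hR r hr =>
    ne_zero_of_mem_basis (HR.basis R hR) hr
  refine ⟨fun x => if p x = 0 then 1 else c, ?_, ?_, ?_, bundle_cover hj hex HE HR hl⟩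
  · refine (HE.finite.image2 (fun E R => E.image j ∪ R.image l) HR.finite).subset ?_
    rintro _ ⟨E, hE, R, hR, rfl⟩
    exact ⟨E, hE, R, hR, rfl⟩
  · rintro _ ⟨E, hE, R, hR, rfl⟩
    exact (bundle_basis (HE.basis E hE) (HR.basis R hR) (he R hR) (hej R hR) (hel R hR)).1
  · rintro _ ⟨E, hE, R, hR, rfl⟩
    refine ⟨hgt E ∘ₗ LinearMap.fst ℤ L M ∘ₗ (e R hR).toLinearMap + c • (hgt R ∘ₗ p), ?_, ?_⟩
    · intro f hf
      rcases Finset.mem_union.1 hf with hf | hf <;> obtain ⟨y, hy, rfl⟩ := Finset.mem_image.1 hf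
      · simp [hej R hR, hpj, hgt_of_mem (HE.basis E hE) hy]
      · simp [hel R hR y hy, hpl R hR y hy, hl R hR y hy, hgt_of_mem (HR.basis R hR) hy]
    · rintro _ ⟨E', hE', R', hR', rfl⟩ f hf hn
      rw [Finset.mem_union, not_or] at hn
      rcases Finset.mem_union.1 hf with hf | hf <;> obtain ⟨y, hy, rfl⟩ := Finset.mem_image.1 hf
      · have : y ∉ E := fun h => hn.1 (Finset.mem_image_of_mem _ h)
        simpa [hej R hR, hpj] using HE.hgt_lt hE hE' hy this
      · have hy' : y ∉ R := fun h => hn.2 (Finset.mem_image_of_mem _ h)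
        have h1 := HR.hgt_lt hR hR' hy hy'
        have h2 := hc E hE ⟨R, hR⟩ R' hR' y hy
        have h3 : c * hgt R y ≤ 0 := mul_nonpos_of_nonneg_of_nonpos hc1.le (by omega)
        simp only [LinearMap.add_apply, LinearMap.coe_comp, Function.comp_apply,
          LinearMap.smul_apply, hl R' hR' y hy, hpl R' hR' y hy, if_false, smul_eq_mul,
          LinearMap.fst_apply, LinearEquiv.coe_coe]
        linarith

/-- A complete subfan is the whole fan: the interior point `∑ f ∈ F, f` of a maximal cone lies in a
cone of the subfamily, which must then contain all of `F`. -/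
theorem IsFacetSystem.eq_of_subset {𝓕 𝓕' : Set (Finset N)} {a : N → ℤ}
    (H : IsFacetSystem 𝓕 a) (hs : 𝓕' ⊆ 𝓕) (hc : ∀ x : N, ∃ F ∈ 𝓕', ∀ f ∈ F, 0 ≤ co F f x) :
    𝓕 = 𝓕' := by
  refine Set.Subset.antisymm (fun F hF => ?_) hs
  obtain ⟨F', hF', h⟩ := hc (∑ f ∈ F, f)
  have hb := H.basis F hF
  have e : ∀ f ∈ F, co F f (∑ f ∈ F, f) = 1 := fun f hf => by
    have := co_sum hb hf (fun _ => 1)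
    simpa using this
  have hs' : F ⊆ F' := fun f hf => by
    refine H.mem_of_mem_coneOf hF (hs hF') (v := toNQ (∑ f ∈ F, f)) ?_ ?_ (f := f) ?_
    · rw [toNQ_sum]
      exact Submodule.sum_mem _ fun f hf => toNQ_mem_coneOf hf
    · refine (mem_coneOf_iff (H.basis F' (hs hF')) subset_rfl).2
        ⟨fun g => ?_, fun g hg => by rw [co_of_notMem hg, extQ_zero]; rfl⟩
      rw [extQ_toNQ]
      by_cases hg : g ∈ F'
      · exact_mod_cast h g hg
      · simp [co_of_notMem hg]
    · rw [extQ_toNQ, e f hf]; simp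
  rw [subset_basis_eq hb (H.basis F' (hs hF')) hs']
  exact hF'

theorem prodCone_coneOf (S : Set L) (T : Set M) :
    prodCone (coneOf S) (coneOf T)
      = coneOf (LinearMap.inl ℤ L M '' S ∪ LinearMap.inr ℤ L M '' T) := by
  apply le_antisymm
  · intro v hv
    have hv1 : mapNQ (LinearMap.fst ℤ L M) v ∈ coneOf S := hv.1
    have hv2 : mapNQ (LinearMap.snd ℤ L M) v ∈ coneOf T := hv.2
    have e : v = mapNQ (LinearMap.inl ℤ L M) (mapNQ (LinearMap.fst ℤ L M) v)
        + mapNQ (LinearMap.inr ℤ L M) (mapNQ (LinearMap.snd ℤ L M) v) := by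
      clear hv hv1 hv2
      induction v using TensorProduct.induction_on with
      | zero => simp
      | tmul q y => simp [← TensorProduct.tmul_add]
      | add x y hx hy =>
        simp only [map_add]
        nth_rewrite 1 [hx, hy]
        abel
    rw [e]
    refine add_mem (coneOf_mono Set.subset_union_left ?_) (coneOf_mono Set.subset_union_right ?_)
    · rw [← coneOf_map]; exact PointedCone.mem_map.2 ⟨_, hv1, rfl⟩
    · rw [← coneOf_map]; exact PointedCone.mem_map.2 ⟨_, hv2, rfl⟩
  · rw [coneOf_le_iff]
    rintro _ (⟨s, hs, rfl⟩ | ⟨t, ht, rfl⟩)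
    · refine ⟨?_, ?_⟩
      · change mapNQ _ (toNQ _) ∈ coneOf S
        rw [mapNQ_toNQ]; exact toNQ_mem_coneOf hs
      · change mapNQ _ (toNQ _) ∈ coneOf T
        rw [mapNQ_toNQ]; simp
    · refine ⟨?_, ?_⟩
      · change mapNQ _ (toNQ _) ∈ coneOf S
        rw [mapNQ_toNQ]; simp
      · change mapNQ _ (toNQ _) ∈ coneOf T
        rw [mapNQ_toNQ]; exact toNQ_mem_coneOf ht

theorem map_equiv_injective (e : N ≃ₗ[ℤ] M) {σ τ : PointedCone ℚ (NQ N)}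
    (h : σ.map (mapNQ e.toLinearMap) = τ.map (mapNQ e.toLinearMap)) : σ = τ := by
  have h2 := congrArg (PointedCone.map (mapNQ e.symm.toLinearMap)) h
  have h3 : mapNQ e.symm.toLinearMap ∘ₗ mapNQ e.toLinearMap = LinearMap.id := by
    ext x
    simp
  rwa [PointedCone.map_map, PointedCone.map_map, h3, PointedCone.map_id,
    PointedCone.map_id] at h2

end BundleFacets

/-! ### From bundle facets to toric bundles. -/

section Bundle

variable {X Z F : ToricVariety.{u}} {𝓔 : Set (Finset F.N)} {𝓡 : Set (Finset Z.N)}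
  {j : F.N →ₗ[ℤ] X.N} {p : X.N →ₗ[ℤ] Z.N} {l : Z.N → X.N}

theorem bundle_map_le (hX : X.HasFacets (bundleFacets j l 𝓔 𝓡)) (hZ : Z.HasFacets 𝓡)
    (hpj : ∀ y, p (j y) = 0) (hl : ∀ R ∈ 𝓡, ∀ r ∈ R, p (l r) = r) :
    ∀ σ ∈ X.fan.cones, ∃ τ ∈ Z.fan.cones, σ.map (mapNQ p) ≤ τ := by
  classical
  intro σ hσ
  obtain ⟨_, ⟨E, hE, R, hR, rfl⟩, S, hS, rfl⟩ := (hX σ).1 hσ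
  refine ⟨_, hZ.mem_cones hR subset_rfl, ?_⟩
  rw [coneOf_map, coneOf_le_iff]
  rintro _ ⟨s, hs, rfl⟩
  rcases Finset.mem_union.1 (hS hs) with h | h <;> obtain ⟨y, hy, rfl⟩ := Finset.mem_image.1 h
  · rw [hpj]; simp
  · rw [hl R hR y hy]; exact toNQ_mem_coneOf hy

/-- Over a cone spanned by `T ⊆ R`, the splitting attached to `R` is a trivialization. A cone
mapping into that cone has all its lifted generators over elements of `T`, even if it comes from
another maximal cone `R'` of the base. -/
theorem isToricBundle_of_bundleFacets {a : Z.N → ℤ}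
    (hX : X.HasFacets (bundleFacets j l 𝓔 𝓡))
    (hF : F.HasFacets 𝓔) (hZ : Z.HasFacets 𝓡) (HR : IsFacetSystem 𝓡 a)
    (hj : Function.Injective j) (hex : ∀ x, p x = 0 ↔ ∃ y, j y = x)
    (hl : ∀ R ∈ 𝓡, ∀ r ∈ R, p (l r) = r) (P : ToricMorphism X Z) (hP : P.toLin = p) :
    IsToricBundle P F j := by
  classical
  subst hP
  have hpj : ∀ y, P.toLin (j y) = 0 := fun y => (hex _).2 ⟨y, rfl⟩
  intro τ hτ
  obtain ⟨R, hR, T, hT, rfl⟩ := (hZ τ).1 hτ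
  obtain ⟨e, he, hej, hel⟩ := exists_splitting hj hex (HR.basis R hR) (hl R hR)
  refine ⟨e, he, hej, fun σ => ⟨?_, ?_⟩⟩
  · rintro ⟨hσ, hle⟩
    obtain ⟨_, ⟨E, hE, R', hR', rfl⟩, S, hS, rfl⟩ := (hX σ).1 hσ
    rw [coneOf_map, coneOf_le_iff] at hle
    have hT' : R'.filter (fun r => l r ∈ S) ⊆ T := by
      intro r hr
      obtain ⟨hr, hrS⟩ := Finset.mem_filter.1 hr
      have := hle _ ⟨l r, hrS, rfl⟩
      rw [hl R' hR' r hr] at this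
      exact HR.mem_of_toNQ_mem hR' hR hT hr this
    refine ⟨_, hF.mem_cones hE (Finset.filter_subset (fun f => j f ∈ S) _), _,
      isFaceOf_coneOf (HR.basis R hR) hT hT', ?_⟩
    rw [prodCone_coneOf, coneOf_map]
    congr 1
    ext v
    constructor
    · rintro ⟨s, hs, rfl⟩
      rcases Finset.mem_union.1 (hS hs) with h | h <;>
        obtain ⟨y, hy, rfl⟩ := Finset.mem_image.1 h
      · exact Or.inl ⟨y, Finset.mem_filter.2 ⟨hy, hs⟩, by simp [hej]⟩
      · have hy' : y ∈ R'.filter (fun r => l r ∈ S) := Finset.mem_filter.2 ⟨hy, hs⟩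
        exact Or.inr ⟨y, hy', by simp [hel y (hT (hT' hy'))]⟩
    · rintro (⟨y, hy, rfl⟩ | ⟨y, hy, rfl⟩)
      · exact ⟨j y, (Finset.mem_filter.1 hy).2, by simp [hej]⟩
      · exact ⟨l y, (Finset.mem_filter.1 hy).2, by simp [hel y (hT (hT' hy))]⟩
  · rintro ⟨η, hη, τ', hτ', h⟩
    obtain ⟨E, hEm, S, hS, rfl⟩ := (hF η).1 hη
    obtain ⟨T', hT', rfl⟩ : ∃ T' : Finset Z.N, T' ⊆ T ∧ τ' = coneOf (T' : Set Z.N) :=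
      ⟨_, Finset.filter_subset _ _, face_coneOf (HR.basis R hR) hT hτ'⟩
    have hσ : σ = coneOf ((S.image j ∪ T'.image l : Finset X.N) : Set X.N) := by
      refine map_equiv_injective e (h.trans ?_)
      rw [prodCone_coneOf, coneOf_map]
      congr 1
      rw [Finset.coe_union, Set.image_union, Finset.coe_image, Finset.coe_image, Set.image_image,
        Set.image_image]
      congr 1
      · exact Set.image_congr fun y _ => by simp [hej]
      · exact Set.image_congr fun y hy => by simp [hel y (hT (hT' hy))]
    subst hσ
    refine ⟨hX.mem_cones ⟨E, hEm, R, hR, rfl⟩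
      (Finset.union_subset_union (Finset.image_subset_image hS)
        (Finset.image_subset_image (hT'.trans hT))), ?_⟩
    rw [coneOf_map, coneOf_le_iff]
    rintro _ ⟨s, hs, rfl⟩
    rcases Finset.mem_union.1 hs with h | h <;> obtain ⟨y, hy, rfl⟩ := Finset.mem_image.1 h
    · rw [hpj]; simp
    · rw [hl R hR y (hT (hT' hy))]; exact toNQ_mem_coneOf (hT' hy)

end Bundle

/-! ### Facet systems of products. -/

section PiFacets

variable {ι : Type} [Fintype ι] {M : ι → Type u} [∀ i, AddCommGroup (M i)]

open Classical in
/-- The facets of a product. -/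
def piFacets (𝓔 : ∀ i, Set (Finset (M i))) : Set (Finset (∀ i, M i)) :=
  {E | ∃ e : ∀ i, Finset (M i), (∀ i, e i ∈ 𝓔 i) ∧
    E = Finset.univ.biUnion fun i => (e i).image (LinearMap.single ℤ M i)}

open Classical in
theorem piCone_coneOf (S : ∀ i, Set (M i)) :
    piCone (fun i => coneOf (S i)) = coneOf (⋃ i, LinearMap.single ℤ M i '' S i) := by
  apply le_antisymm
  · intro v hv
    rw [mem_piCone] at hv
    rw [← sum_single_proj v]
    refine Submodule.sum_mem _ fun i _ => ?_
    refine coneOf_mono (Set.subset_iUnion _ i) ?_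
    rw [← coneOf_map]
    exact PointedCone.mem_map.2 ⟨_, hv i, rfl⟩
  · rw [coneOf_le_iff]
    intro s hs
    obtain ⟨i, y, hy, rfl⟩ := Set.mem_iUnion.1 hs
    rw [← mapNQ_toNQ]
    exact single_mem_piCone (τ := fun i => coneOf (S i)) (toNQ_mem_coneOf hy)

open Classical in
theorem pi_basis {e : ∀ i, Finset (M i)} (he : ∀ i, IsLatticeBasis (e i)) :
    IsLatticeBasis (Finset.univ.biUnion fun i => (e i).image (LinearMap.single ℤ M i)) ∧
    ∀ i, ∀ f ∈ e i, ∀ x, co (Finset.univ.biUnion fun i => (e i).image (LinearMap.single ℤ M i))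
      (LinearMap.single ℤ M i f) x = co (e i) f (x i) := by
  have hb : IsLatticeBasis
      (Finset.univ.biUnion fun i => (e i).image (LinearMap.single ℤ M i)) := by
    convert isLatticeBasis_image (Pi.basis fun i => latticeBasis (he i)) using 1
    ext x
    simp only [Finset.mem_biUnion, Finset.mem_univ, true_and, Finset.mem_image, Sigma.exists,
      Pi.basis_apply, latticeBasis_apply, Subtype.exists, LinearMap.coe_single, exists_prop]
  refine ⟨hb, fun i f hf x => LinearMap.congr_fun
    (co_eq_of_apply hb (m := co (e i) f ∘ₗ LinearMap.proj i) fun g hg => ?_) x⟩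
  simp only [Finset.mem_biUnion, Finset.mem_univ, true_and, Finset.mem_image] at hg
  obtain ⟨k, y, hy, rfl⟩ := hg
  by_cases hk : k = i
  · subst hk
    simp only [LinearMap.coe_single, LinearMap.coe_comp, LinearMap.coe_proj, Function.comp_apply,
      Function.eval, Pi.single_eq_same, co_apply (he k) f hy]
    simp [(Pi.single_injective k).eq_iff]
  · have : (LinearMap.single ℤ M i f : ∀ i, M i) ≠ LinearMap.single ℤ M k y := by
      intro h
      have := congrFun h i
      simp [Ne.symm hk] at this
      exact ne_zero_of_mem_basis (he i) hf this
    rw [if_neg this]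
    simp [Ne.symm hk]

theorem IsFacetSystem.pi {𝓔 : ∀ i, Set (Finset (M i))}
    (H : ∀ i, IsFacetSystem (𝓔 i) fun _ => 1) : IsFacetSystem (piFacets 𝓔) fun _ => 1 where
  finite := by
    classical
    refine ((Set.Finite.pi (fun i => (H i).finite)).image fun e =>
      Finset.univ.biUnion fun i => (e i).image (LinearMap.single ℤ M i)).subset ?_
    rintro _ ⟨e, he, rfl⟩
    exact ⟨e, fun i _ => he i, rfl⟩
  basis := by
    rintro _ ⟨e, he, rfl⟩
    exact (pi_basis fun i => (H i).basis _ (he i)).1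
  form := by
    classical
    rintro _ ⟨e, he, rfl⟩
    have key : ∀ i y, (∑ i, hgt (e i) ∘ₗ LinearMap.proj i : (∀ i, M i) →ₗ[ℤ] ℤ)
        (LinearMap.single ℤ M i y) = hgt (e i) y := by
      intro i y
      rw [LinearMap.sum_apply, Finset.sum_eq_single i]
      · simp
      · intro k _ hk; simp [hk]
      · simp
    refine ⟨∑ i, hgt (e i) ∘ₗ LinearMap.proj i, fun f hf => ?_, ?_⟩
    · simp only [Finset.mem_biUnion, Finset.mem_univ, true_and, Finset.mem_image] at hf
      obtain ⟨k, y, hy, rfl⟩ := hf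
      rw [key, hgt_of_mem ((H k).basis _ (he k)) hy]
    · rintro _ ⟨e', he', rfl⟩ x hx hn
      simp only [Finset.mem_biUnion, Finset.mem_univ, true_and, Finset.mem_image] at hx hn
      obtain ⟨k, y, hy, rfl⟩ := hx
      rw [key]
      exact (H k).hgt_lt (he k) (he' k) hy fun h => hn ⟨k, y, h, rfl⟩
  cover x := by
    classical
    choose e he hxe using fun i => (H i).cover (x i)
    refine ⟨_, ⟨e, he, rfl⟩, fun f hf => ?_⟩
    simp only [Finset.mem_biUnion, Finset.mem_univ, true_and, Finset.mem_image] at hf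
    obtain ⟨k, y, hy, rfl⟩ := hf
    rw [(pi_basis fun i => (H i).basis _ (he i)).2 k y hy]
    exact hxe k y hy

theorem mem_pi_cones_iff {F : ∀ i, Fan (M i)} {𝓔 : ∀ i, Set (Finset (M i))}
    (h : ∀ i σ, σ ∈ (F i).cones ↔ ∃ E ∈ 𝓔 i, ∃ S : Finset (M i), S ⊆ E ∧
      σ = coneOf (S : Set (M i))) (σ : PointedCone ℚ (NQ (∀ i, M i))) :
    σ ∈ (Fan.pi F).cones ↔ ∃ E ∈ piFacets 𝓔, ∃ S : Finset (∀ i, M i), S ⊆ E ∧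
      σ = coneOf (S : Set (∀ i, M i)) := by
  classical
  constructor
  · rintro ⟨τ, hτ, rfl⟩
    choose E hE S hS hτS using fun i => (h i (τ i)).1 (hτ i)
    refine ⟨_, ⟨E, hE, rfl⟩, Finset.univ.biUnion fun i => (S i).image (LinearMap.single ℤ M i),
      Finset.biUnion_mono fun i _ => Finset.image_subset_image (hS i), ?_⟩
    rw [show τ = fun i => coneOf (S i : Set (M i)) from funext hτS, piCone_coneOf]
    congr 1
    simp
  · rintro ⟨_, ⟨e, he, rfl⟩, S, hS, rfl⟩
    let T : ∀ i, Finset (M i) := fun i => (e i).filter fun y => LinearMap.single ℤ M i y ∈ S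
    refine ⟨fun i => coneOf (T i : Set (M i)),
      fun i => (h i _).2 ⟨e i, he i, T i, Finset.filter_subset _ _, rfl⟩, ?_⟩
    rw [piCone_coneOf]
    congr 1
    ext x
    simp only [Finset.mem_coe, Set.mem_iUnion, Set.mem_image, T, Finset.mem_filter]
    constructor
    · intro hx
      have := hS hx
      simp only [Finset.mem_biUnion, Finset.mem_univ, true_and, Finset.mem_image] at this
      obtain ⟨i, y, hy, rfl⟩ := this
      exact ⟨i, y, ⟨hy, hx⟩, rfl⟩
    · rintro ⟨i, y, ⟨_, hx⟩, rfl⟩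
      exact hx

theorem hasFacets_pi {F : ι → ToricVariety.{u}} {𝓔 : ∀ i, Set (Finset (F i).N)}
    (h : ∀ i, (F i).HasFacets (𝓔 i)) : (ToricVariety.pi F).HasFacets (piFacets 𝓔) :=
  mem_pi_cones_iff (M := fun i => (F i).N) h

end PiFacets

/-! ### Dimensions of simplicial cones. -/

section Dimension

variable {N : Type*} [AddCommGroup N] {F S : Finset N}

theorem linearIndependent_toNQ (h : IsLatticeBasis F) :
    LinearIndependent ℚ (fun f : F => toNQ (f : N)) := by
  rw [Fintype.linearIndependent_iff]
  intro g hg i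
  have := congrArg (extQ (co F i)) hg
  rw [map_sum, map_zero, Finset.sum_eq_single i] at this
  · rw [map_smul, extQ_toNQ, co_self h i.2] at this
    simpa using this
  · intro k _ hki
    rw [map_smul, extQ_toNQ, co_ne h k.2 (fun e => hki (Subtype.ext e.symm))]
    simp
  · simp

theorem finrank_span_toNQ (h : IsLatticeBasis F) (hS : S ⊆ F) :
    Module.finrank ℚ (Submodule.span ℚ (toNQ '' (S : Set N))) = S.card := by
  have h1 : LinearIndependent ℚ (fun f : S => toNQ (f : N)) :=
    (linearIndependent_toNQ h).comp (fun s : S => (⟨s, hS s.2⟩ : F))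
      fun s t e => Subtype.ext (congrArg (fun f : F => (f : N)) e)
  have h2 := finrank_span_eq_card h1
  rw [Fintype.card_coe] at h2
  rw [← h2]
  have : Set.range (fun f : S => toNQ (f : N)) = toNQ '' (S : Set N) := by
    ext x
    simp
  rw [this]

theorem span_coneOf (S : Set N) :
    Submodule.span ℚ (coneOf S : Set (NQ N)) = Submodule.span ℚ (toNQ '' S) := by
  apply le_antisymm
  · rw [Submodule.span_le]
    exact fun x hx => PointedCone.hull_le_span (R := ℚ) _ hx
  · exact Submodule.span_mono Submodule.subset_span

theorem coneDim_coneOf (h : IsLatticeBasis F) (hS : S ⊆ F) :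
    coneDim (coneOf (S : Set N)) = S.card := by
  rw [coneDim, span_coneOf, finrank_span_toNQ h hS]

end Dimension

/-! ### Isomorphisms in codimension 1 from equality of generators. -/

namespace ToricVariety

variable {X X' : ToricVariety.{u}} {𝓕 : Set (Finset X.N)} {𝓕' : Set (Finset X'.N)} {a : X.N → ℤ}
  {a' : X'.N → ℤ}

theorem HasFacets.map_mem_of_coneDim_le_one (hX : X.HasFacets 𝓕) (H : IsFacetSystem 𝓕 a)
    (hX' : X'.HasFacets 𝓕') (H' : IsFacetSystem 𝓕' a') (φ : X.N ≃ₗ[ℤ] X'.N)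
    (h : ∀ F ∈ 𝓕, ∀ x ∈ F, ∃ F' ∈ 𝓕', φ x ∈ F') {σ : PointedCone ℚ (NQ X.N)}
    (hσ : σ ∈ X.fan.cones) (hdim : coneDim σ ≤ 1) :
    σ.map (mapNQ φ.toLinearMap) ∈ X'.fan.cones := by
  obtain ⟨F, hF, S, hS, rfl⟩ := (hX σ).1 hσ
  rw [coneDim_coneOf (H.basis F hF) hS, Finset.card_le_one_iff_subset_singleton] at hdim
  obtain ⟨x, hx⟩ := hdim
  rw [coneOf_map]
  rcases Finset.subset_singleton_iff.1 hx with rfl | rfl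
  · obtain ⟨F', hF'⟩ := H'.nonempty
    simpa using hX'.mem_cones hF' (Finset.empty_subset _)
  · obtain ⟨F', hF', hxF'⟩ := h F hF x (hS (Finset.mem_singleton_self x))
    simpa using hX'.mem_cones (S := {φ x}) hF' (by simpa using hxF')

/-- The cones of dimension at most 1 are the zero cone and the rays through the generators, so a
bijection between the generators suffices. -/
theorem HasFacets.isIsoInCodimOne (hX : X.HasFacets 𝓕) (H : IsFacetSystem 𝓕 a)
    (hX' : X'.HasFacets 𝓕') (H' : IsFacetSystem 𝓕' a') (φ : ToricBirationalMap X X')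
    (h : ∀ F ∈ 𝓕, ∀ x ∈ F, ∃ F' ∈ 𝓕', φ x ∈ F')
    (h' : ∀ F' ∈ 𝓕', ∀ x ∈ F', ∃ F ∈ 𝓕, φ.symm x ∈ F) : φ.IsIsoInCodimOne := by
  intro σ hdim
  refine ⟨fun hσ => hX.map_mem_of_coneDim_le_one H hX' H' φ h hσ hdim, fun hσ => ?_⟩
  have hdim' : coneDim (σ.map (mapNQ φ.toLinearMap)) ≤ 1 := by
    refine le_trans ?_ hdim
    rw [coneDim, coneDim, PointedCone.coe_map, ← Submodule.map_span]
    exact Submodule.finrank_map_le _ _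
  have h1 := hX'.map_mem_of_coneDim_le_one H' hX H φ.symm h' hσ hdim'
  rw [PointedCone.map_map] at h1
  have h3 : mapNQ φ.symm.toLinearMap ∘ₗ mapNQ φ.toLinearMap = LinearMap.id := by
    ext x
    simp
  rwa [h3, PointedCone.map_id] at h1

end ToricVariety

/-! ### Convexity in Fano fans: heights, wall crossings and symmetric generators. -/

section FanoFacets

variable {N : Type*} [AddCommGroup N] {𝓕 : Set (Finset N)}

/-- The generators of a facet system. -/
def genSet (𝓕 : Set (Finset N)) : Set N := {x | ∃ F ∈ 𝓕, x ∈ F}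

/-- The centrally symmetric generators. -/
def symSet (𝓕 : Set (Finset N)) : Set N := {x | x ∈ genSet 𝓕 ∧ -x ∈ genSet 𝓕}

/-- The lattice vectors in the linear span of the centrally symmetric generators, described by the
integral linear forms vanishing on it. -/
def symHull (𝓕 : Set (Finset N)) : Set N :=
  {x | ∀ m : N →ₗ[ℤ] ℤ, (∀ s ∈ symSet 𝓕, m s = 0) → m x = 0}

/-- The generators in the span of the centrally symmetric ones which are not themselves centrally
symmetric. -/
def asymSet (𝓕 : Set (Finset N)) : Set N := {x | x ∈ genSet 𝓕 ∧ x ∈ symHull 𝓕 ∧ -x ∉ genSet 𝓕}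

theorem symSet_subset_symHull : symSet 𝓕 ⊆ symHull 𝓕 := fun s hs _ hm => hm s hs

theorem neg_mem_symSet {s : N} (hs : s ∈ symSet 𝓕) : -s ∈ symSet 𝓕 :=
  ⟨hs.2, by rw [neg_neg]; exact hs.1⟩

namespace IsFacetSystem

variable (H : IsFacetSystem 𝓕 fun _ => 1)
include H

/-- Integrality turns the ampleness bound `< 1` into `≤ 0`; this gap is the basic form in which the
Fano hypothesis is used. -/
theorem hgt_le_zero {F : Finset N} (hF : F ∈ 𝓕) {x : N} (hx : x ∈ genSet 𝓕) (hn : x ∉ F) :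
    hgt F x ≤ 0 := by
  obtain ⟨F', hF', hx⟩ := hx
  have := H.hgt_lt hF hF' hx hn
  omega

theorem hgt_le_one {F : Finset N} (hF : F ∈ 𝓕) {x : N} (hx : x ∈ genSet 𝓕) : hgt F x ≤ 1 := by
  by_cases h : x ∈ F
  · rw [hgt_of_mem (H.basis F hF) h]
  · linarith [H.hgt_le_zero hF hx h]

theorem mem_of_hgt {F : Finset N} (hF : F ∈ 𝓕) {x : N} (hx : x ∈ genSet 𝓕) (h : 1 ≤ hgt F x) :
    x ∈ F := by
  by_contra hn
  linarith [H.hgt_le_zero hF hx hn]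

theorem ne_zero_of_mem_genSet {x : N} (hx : x ∈ genSet 𝓕) : x ≠ 0 := by
  obtain ⟨F, hF, hx⟩ := hx
  exact ne_zero_of_mem_basis (H.basis F hF) hx

/-- A cone of the fan and a vector: there is a maximal cone containing the cone and, modulo the
span of the cone, the vector. -/
theorem exists_star {F₀ S : Finset N} (hF₀ : F₀ ∈ 𝓕) (hS : S ⊆ F₀) (v : N) :
    ∃ F ∈ 𝓕, S ⊆ F ∧ ∀ f ∈ F, f ∉ S → 0 ≤ co F f v := by
  classical
  obtain ⟨C, hC⟩ : ∃ C : ℤ, ∀ F ∈ 𝓕, hgt F v ≤ C := by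
    obtain ⟨C, hC⟩ := (H.finite.image fun F => hgt F v).bddAbove
    exact ⟨C, fun F hF => hC ⟨F, hF, rfl⟩⟩
  -- The vector `v` is pushed far into the cone of `S`. The cone `F` containing the result maximizes
  -- the height there, and missing one element of `S` would cost at least `t`, more than the
  -- contribution of `v` can compensate.
  set t : ℤ := max 0 (C - hgt F₀ v + 1) with ht
  obtain ⟨F, hF, hx⟩ := H.cover (t • ∑ s ∈ S, s + v)
  have ht1 : C - hgt F₀ v + 1 ≤ t := le_max_right _ _
  have ht0 : 0 ≤ t := le_max_left _ _
  have hb₀ := H.basis F₀ hF₀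
  have hb := H.basis F hF
  have hle : hgt F₀ (t • ∑ s ∈ S, s + v) ≤ hgt F (t • ∑ s ∈ S, s + v) := by
    rw [apply_eq_sum_co hb (hgt F₀), hgt_apply F]
    refine Finset.sum_le_sum fun f hf => ?_
    rw [smul_eq_mul]
    have := H.hgt_le_one hF₀ ⟨F, hF, hf⟩
    nlinarith [hx f hf]
  have hSF : S ⊆ F := by
    intro s hs
    by_contra hsF
    have h1 : hgt F₀ (∑ s ∈ S, s) = S.card := by
      rw [map_sum, Finset.sum_congr rfl fun s hs => hgt_of_mem hb₀ (hS hs)]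
      simp
    have h2 : hgt F (∑ s ∈ S, s) ≤ S.card - 1 := by
      rw [map_sum, ← Finset.add_sum_erase S _ hs]
      have h3 := H.hgt_le_zero hF ⟨F₀, hF₀, hS hs⟩ hsF
      have h4 : ∑ x ∈ S.erase s, hgt F x ≤ ∑ x ∈ S.erase s, 1 :=
        Finset.sum_le_sum fun x hx => H.hgt_le_one hF ⟨F₀, hF₀, hS (Finset.mem_of_mem_erase hx)⟩
      have h5 := Finset.card_erase_add_one hs
      simp only [Finset.sum_const, nsmul_eq_mul, mul_one] at h4
      push_cast [← h5]
      linarith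
    rw [map_add, map_add, map_smul, map_smul, h1, smul_eq_mul, smul_eq_mul] at hle
    have h6 := hC F hF
    nlinarith
  refine ⟨F, hF, hSF, fun f hf hfS => ?_⟩
  have := hx f hf
  rwa [map_add, map_smul, map_sum, Finset.sum_eq_zero (s := S), smul_zero, zero_add] at this
  intro s hs
  exact co_ne hb (hSF hs) (by rintro rfl; exact hfS hs)

theorem card_eq {F F' : Finset N} (hF : F ∈ 𝓕) (hF' : F' ∈ 𝓕) : F.card = F'.card := by
  rw [card_lattice_basis (H.basis F hF), card_lattice_basis (H.basis F' hF')]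

open Classical in
/-- The neighbour of a maximal cone `F` opposite to `e`, and its characterization. -/
theorem exists_neighbour {F : Finset N} (hF : F ∈ 𝓕) {e : N} (he : e ∈ F) :
    ∃ e', insert e' (F.erase e) ∈ 𝓕 ∧
      ∀ x ∈ genSet 𝓕, hgt F x = 0 → co F e x < 0 → x = e' ∧ co F e x = -1 := by
  have hb := H.basis F hF
  -- The neighbour is the maximal cone containing the wall and pointing in the direction `-e`.
  obtain ⟨F', hF', hS, h⟩ := H.exists_star hF (Finset.erase_subset e F) (-e)
  have heF' : e ∉ F' := by
    intro h'
    have := h e h' (Finset.notMem_erase e F)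
    rw [map_neg, co_self (H.basis F' hF') h'] at this
    omega
  have hc : (F' \ F.erase e).card = 1 := by
    rw [Finset.card_sdiff_of_subset hS, H.card_eq hF' hF, Finset.card_erase_of_mem he]
    have := Finset.card_pos.2 ⟨e, he⟩
    omega
  obtain ⟨e', he'⟩ := Finset.card_eq_one.1 hc
  have hF'eq : F' = insert e' (F.erase e) := by
    rw [← Finset.sdiff_union_of_subset hS, he', Finset.insert_eq]
  refine ⟨e', hF'eq ▸ hF', fun x hx h0 hneg => ?_⟩
  -- The two height functions agree on the wall, and `hgt F' e - 1 ≤ -1`. So at height 0 a negative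
  -- coordinate gives `hgt F' x ≥ 1`; equality is forced, the coordinate is -1, and `x` is a vertex
  -- of `F'`.
  have hform : hgt F' - hgt F = (hgt F' e - 1) • co F e := by
    refine linearMap_ext_of_basis hb fun f hf => ?_
    rw [LinearMap.sub_apply, hgt_of_mem hb hf, LinearMap.smul_apply, co_apply hb e hf]
    split_ifs with hfe
    · subst hfe; simp
    · rw [hgt_of_mem (H.basis F' hF') (hS (Finset.mem_erase.2 ⟨Ne.symm hfe, hf⟩))]; simp
  have h1 := LinearMap.congr_fun hform x
  rw [LinearMap.sub_apply, LinearMap.smul_apply, h0, smul_eq_mul] at h1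
  have h2 := H.hgt_le_zero hF' ⟨F, hF, he⟩ heF'
  have h3 := H.hgt_le_one hF' hx
  have h4 : co F e x = -1 := by nlinarith
  have h5 : 1 ≤ hgt F' x := by rw [h4] at h1; linarith
  have h6 := H.mem_of_hgt hF' hx h5
  rw [hF'eq, Finset.mem_insert] at h6
  refine ⟨h6.resolve_right fun h7 => ?_, h4⟩
  rw [hgt_of_mem hb (Finset.mem_of_mem_erase h7)] at h0
  exact one_ne_zero h0

open Classical in
theorem insert_erase_mem {F : Finset N} (hF : F ∈ 𝓕) {e x : N} (he : e ∈ F)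
    (hx : x ∈ genSet 𝓕) (h0 : hgt F x = 0) (hneg : co F e x < 0) :
    insert x (F.erase e) ∈ 𝓕 := by
  obtain ⟨e', h1, h2⟩ := H.exists_neighbour hF he
  rw [(h2 x hx h0 hneg).1]
  exact h1

theorem co_eq_neg_one {F : Finset N} (hF : F ∈ 𝓕) {e x : N} (he : e ∈ F)
    (hx : x ∈ genSet 𝓕) (h0 : hgt F x = 0) (hneg : co F e x < 0) : co F e x = -1 := by
  obtain ⟨e', h1, h2⟩ := H.exists_neighbour hF he
  exact (h2 x hx h0 hneg).2

theorem eq_of_co_neg {F : Finset N} (hF : F ∈ 𝓕) {e x y : N} (he : e ∈ F)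
    (hx : x ∈ genSet 𝓕) (hx0 : hgt F x = 0) (hxneg : co F e x < 0)
    (hy : y ∈ genSet 𝓕) (hy0 : hgt F y = 0) (hyneg : co F e y < 0) : x = y := by
  obtain ⟨e', h1, h2⟩ := H.exists_neighbour hF he
  rw [(h2 x hx hx0 hxneg).1, (h2 y hy hy0 hyneg).1]

/-- If neither `s` nor `-s` lies in `F`, both have height at most 0. -/
theorem sym_cases {F : Finset N} (hF : F ∈ 𝓕) {s : N} (hs : s ∈ symSet 𝓕) :
    s ∈ F ∨ -s ∈ F ∨ hgt F s = 0 := by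
  by_cases h1 : s ∈ F
  · exact Or.inl h1
  by_cases h2 : -s ∈ F
  · exact Or.inr (Or.inl h2)
  have h3 := H.hgt_le_zero hF hs.1 h1
  have h4 := H.hgt_le_zero hF hs.2 h2
  rw [map_neg] at h4
  exact Or.inr (Or.inr (by omega))

theorem sym_coord {F : Finset N} (hF : F ∈ 𝓕) {s : N} (hs : s ∈ symSet 𝓕) (h0 : hgt F s = 0)
    (e : N) : co F e s = -1 ∨ co F e s = 0 ∨ co F e s = 1 := by
  by_cases he : e ∈ F
  · rcases lt_trichotomy (co F e s) 0 with h | h | h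
    · exact Or.inl (H.co_eq_neg_one hF he hs.1 h0 h)
    · exact Or.inr (Or.inl h)
    · have := H.co_eq_neg_one hF he hs.2 (by rw [map_neg, h0, neg_zero])
        (by rw [map_neg]; omega)
      rw [map_neg] at this
      omega
  · rw [co_of_notMem he]; simp

/-- After changing signs both vectors are negative at `e`, so both are the new vertex behind the
wall opposite to `e`. -/
theorem sym_share {F : Finset N} (hF : F ∈ 𝓕) {s s' : N} (hs : s ∈ symSet 𝓕)
    (hs' : s' ∈ symSet 𝓕) (h0 : hgt F s = 0) (h0' : hgt F s' = 0) {e : N}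
    (he : co F e s ≠ 0) (he' : co F e s' ≠ 0) : s' = s ∨ s' = -s := by
  have heF : e ∈ F := by
    by_contra h
    rw [co_of_notMem h] at he; exact he rfl
  have n0 : hgt F (-s) = 0 := by rw [map_neg, h0, neg_zero]
  have n0' : hgt F (-s') = 0 := by rw [map_neg, h0', neg_zero]
  rcases lt_or_gt_of_ne he with h | h <;> rcases lt_or_gt_of_ne he' with h' | h'
  · exact Or.inl (H.eq_of_co_neg hF heF hs'.1 h0' h' hs.1 h0 h)
  · have := H.eq_of_co_neg hF heF hs'.2 n0' (by rw [map_neg]; omega) hs.1 h0 h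
    exact Or.inr (by rw [← this, neg_neg])
  · exact Or.inr (H.eq_of_co_neg hF heF hs'.1 h0' h' hs.2 n0 (by rw [map_neg]; omega))
  · have := H.eq_of_co_neg hF heF hs'.2 n0' (by rw [map_neg]; omega) hs.2 n0
      (by rw [map_neg]; omega)
    exact Or.inl (neg_injective this)

/-- In the maximal cone containing `x + y`, the sum has height at most 1 unless both vectors are
vertices. Nonnegative integral coordinates with sum at most 1 describe zero or a single vertex. -/
theorem pair_cases {x y : N} (hx : x ∈ genSet 𝓕) (hy : y ∈ genSet 𝓕) :
    (∃ F ∈ 𝓕, x ∈ F ∧ y ∈ F) ∨ x + y = 0 ∨ x + y ∈ genSet 𝓕 := by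
  classical
  obtain ⟨F, hF, h⟩ := H.cover (x + y)
  have hb := H.basis F hF
  by_cases hc : x ∈ F ∧ y ∈ F
  · exact Or.inl ⟨F, hF, hc⟩
  right
  have h1 : hgt F (x + y) ≤ 1 := by
    rw [map_add]
    by_cases hxF : x ∈ F
    · linarith [H.hgt_le_one hF hx, H.hgt_le_zero hF hy fun h => hc ⟨hxF, h⟩]
    · linarith [H.hgt_le_one hF hy, H.hgt_le_zero hF hx hxF]
  rw [hgt_apply] at h1
  by_cases hz : ∀ f ∈ F, co F f (x + y) = 0
  · exact Or.inl (eq_zero_of_co hb hz)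
  · push Not at hz
    obtain ⟨f, hf, hne⟩ := hz
    have hpos : 1 ≤ co F f (x + y) := by have := h f hf; omega
    rw [← Finset.add_sum_erase F _ hf] at h1
    have h2 : ∀ g ∈ F.erase f, 0 ≤ co F g (x + y) := fun g hg => h g (Finset.mem_of_mem_erase hg)
    have h3 := Finset.sum_nonneg h2
    have h4 := (Finset.sum_eq_zero_iff_of_nonneg h2).1 (by omega)
    refine Or.inr ⟨F, hF, ?_⟩
    rw [show x + y = f from eq_of_co hb fun g hg => ?_]
    · exact hf
    · by_cases hgf : g = f
      · subst hgf; rw [co_self hb hg]; omega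
      · rw [h4 g (Finset.mem_erase.2 ⟨hgf, hg⟩), co_ne hb hf hgf]

/-- By `pair_cases` two alternatives have to be excluded. If `2x + y = 0`, the height at a cone
containing `y` violates parity. If `2x + y` is a generator, then `y + (2x + y) = 2(x + y)` forces
both summands into every maximal cone containing `x + y`, against uniqueness of coordinates. -/
theorem exists_facet_left_add {x y : N} (hx : x ∈ genSet 𝓕) (hy : y ∈ genSet 𝓕)
    (hxy : x + y ∈ genSet 𝓕) : ∃ F ∈ 𝓕, x ∈ F ∧ x + y ∈ F := by
  have hx0 := H.ne_zero_of_mem_genSet hx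
  have hy0 := H.ne_zero_of_mem_genSet hy
  rcases H.pair_cases hx hxy with h | h | h
  · exact h
  · exfalso
    obtain ⟨F, hF, hyF⟩ := hy
    have h1 := congrArg (hgt F) h
    rw [map_add, map_add, hgt_of_mem (H.basis F hF) hyF, map_zero] at h1
    omega
  · exfalso
    obtain ⟨F, hF, hv⟩ := hxy
    have hb := H.basis F hF
    have e1 : hgt F y + hgt F (x + (x + y)) = 2 * hgt F (x + y) := by
      simp only [map_add]; ring
    rw [hgt_of_mem hb hv] at e1
    have l1 := H.hgt_le_one hF hy
    have l2 := H.hgt_le_one hF h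
    have m1 := H.mem_of_hgt hF hy (by omega)
    have m2 := H.mem_of_hgt hF h (by omega)
    have e2 : co F y y + co F y (x + (x + y)) = 2 * co F y (x + y) := by
      simp only [map_add]; ring
    rw [co_self hb m1, co_ne hb hv (by simpa using hx0)] at e2
    have := co_apply hb y m2
    split_ifs at this <;> omega

/-- Since `w` is in the span of the symmetric generators, its coordinate form is nonzero on one of
them, `z`, which has height 0 and is unique up to sign by `sym_share`. If another vertex `e` in the
support of `z` were not symmetric, the form `co F w - co F e z • co F e` would vanish on all
symmetric generators but not at `w`. -/
theorem exists_sym_of_asym {F : Finset N} (hF : F ∈ 𝓕) {w : N} (hwF : w ∈ F)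
    (hw : w ∈ asymSet 𝓕) : ∃ z ∈ symSet 𝓕, hgt F z = 0 ∧ co F w z = 1 ∧
      (∀ e ∈ F, e ≠ w → co F e z ≠ 0 → -e ∈ genSet 𝓕) ∧
      ∀ s ∈ symSet 𝓕, co F w s ≠ 0 → s = z ∨ s = -z := by
  have hb := H.basis F hF
  have nonF : ∀ s ∈ symSet 𝓕, co F w s ≠ 0 → hgt F s = 0 := by
    intro s hs h
    have hne : ∀ t ∈ symSet 𝓕, t ∈ F → co F w t = 0 := fun t ht htF =>
      co_ne hb htF (by rintro rfl; exact hw.2.2 ht.2)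
    rcases H.sym_cases hF hs with h1 | h1 | h1
    · exact absurd (hne s hs h1) h
    · have := hne _ (neg_mem_symSet hs) h1
      rw [map_neg, neg_eq_zero] at this
      exact absurd this h
    · exact h1
  obtain ⟨z, hz, hz1⟩ : ∃ z ∈ symSet 𝓕, co F w z = 1 := by
    by_contra! hn
    have := hw.2.1 (co F w) fun s hs => by
      by_contra h
      rcases H.sym_coord hF hs (nonF s hs h) w with h1 | h1 | h1
      · exact hn (-s) (neg_mem_symSet hs) (by rw [map_neg, h1]; rfl)
      · exact h h1
      · exact hn s hs h1
    rw [co_self hb hwF] at this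
    exact one_ne_zero this
  have hz0 := nonF z hz (by rw [hz1]; exact one_ne_zero)
  have share : ∀ s ∈ symSet 𝓕, co F w s ≠ 0 → s = z ∨ s = -z := fun s hs h =>
    H.sym_share hF hz hs hz0 (nonF s hs h) (by rw [hz1]; exact one_ne_zero) h
  refine ⟨z, hz, hz0, hz1, fun e he hew hez => ?_, share⟩
  by_contra hne
  have hsq : co F e z * co F e z = 1 := by
    rcases H.sym_coord hF hz hz0 e with h | h | h
    · rw [h]; rfl
    · exact absurd h hez
    · rw [h]; rfl
  have hneF : ∀ t ∈ symSet 𝓕, t ∈ F → co F w t = 0 ∧ co F e t = 0 := fun t ht htF =>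
    ⟨co_ne hb htF (by rintro rfl; exact hw.2.2 ht.2),
      co_ne hb htF (by rintro rfl; exact hne ht.2)⟩
  have := hw.2.1 (co F w - co F e z • co F e) fun s hs => by
    rw [LinearMap.sub_apply, LinearMap.smul_apply, smul_eq_mul]
    rcases H.sym_cases hF hs with h1 | h1 | h1
    · rw [(hneF s hs h1).1, (hneF s hs h1).2]; simp
    · have := hneF _ (neg_mem_symSet hs) h1
      rw [map_neg, map_neg, neg_eq_zero, neg_eq_zero] at this
      rw [this.1, this.2]; simp
    · by_cases h2 : co F w s = 0
      · by_cases h3 : co F e s = 0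
        · rw [h2, h3]; simp
        · rcases H.sym_share hF hz hs hz0 h1 hez h3 with rfl | rfl
          · omega
          · rw [map_neg] at h2; omega
      · rcases share s hs h2 with rfl | rfl
        · rw [hz1, hsq]; rfl
        · rw [map_neg, map_neg, hz1, mul_neg, hsq]; rfl
  rw [LinearMap.sub_apply, LinearMap.smul_apply, co_self hb hwF, co_ne hb hwF hew] at this
  simp at this

/-- If `w + w'` were a generator, a maximal cone would contain `w` and `w + w'`. There `w'` has
height 0 and coordinate -1 at `w`, as does `-z`, so `w' = -z` would be symmetric. -/
theorem exists_facet_of_asym {w w' : N} (hw : w ∈ asymSet 𝓕) (hw' : w' ∈ asymSet 𝓕) :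
    ∃ F ∈ 𝓕, w ∈ F ∧ w' ∈ F := by
  rcases H.pair_cases hw.1 hw'.1 with h | h | h
  · exact h
  · exact absurd (neg_eq_of_add_eq_zero_right h ▸ hw'.1 : -w ∈ genSet 𝓕) hw.2.2
  · exfalso
    obtain ⟨F, hF, hwF, hvF⟩ := H.exists_facet_left_add hw.1 hw'.1 h
    have hb := H.basis F hF
    obtain ⟨z, hz, hz0, hz1, -, -⟩ := H.exists_sym_of_asym hF hwF hw
    have h1 : hgt F w' = 0 := by
      have := hgt_of_mem hb hvF
      rw [map_add, hgt_of_mem hb hwF] at this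
      omega
    have h2 : co F w w' < 0 := by
      have := co_ne hb hvF (f := w) (by simpa using H.ne_zero_of_mem_genSet hw'.1)
      rw [map_add, co_self hb hwF] at this
      omega
    have h3 := H.eq_of_co_neg hF hwF hw'.1 h1 h2 hz.2 (by rw [map_neg, hz0, neg_zero])
      (by rw [map_neg, hz1]; omega)
    exact hw'.2.2 (by rw [h3, neg_neg]; exact hz.1)

/-- In a cone `F'` containing both vectors, let `z₁` and `z₂` be the symmetric generators attached
to `w` and `w'`. If `co F w` were nonzero at `w'`, then for each of the two it would be nonzero at
`zᵢ` or at a symmetric vertex in its support. Each time this vector is `±z`, so the two agree up to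
sign, which is excluded by comparing heights and by `sym_share`: `z₁` and `z₂` do not agree up to
sign, since otherwise `w` would be symmetric. -/
theorem co_asym_eq_zero {F : Finset N} (hF : F ∈ 𝓕) {w w' : N} (hwF : w ∈ F)
    (hw : w ∈ asymSet 𝓕) (hw' : w' ∈ asymSet 𝓕) (hne : w ≠ w') : co F w w' = 0 := by
  obtain ⟨z, hz, hz0, hz1, -, hshare⟩ := H.exists_sym_of_asym hF hwF hw
  obtain ⟨F', hF', hwF', hwF''⟩ := H.exists_facet_of_asym hw hw'
  have hb' := H.basis F' hF'
  obtain ⟨z₁, hz₁, hz₁0, hz₁1, hM₁, -⟩ := H.exists_sym_of_asym hF' hwF' hw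
  obtain ⟨z₂, hz₂, hz₂0, hz₂1, hM₂, -⟩ := H.exists_sym_of_asym hF' hwF'' hw'
  have key : ∀ y ζ : N, y ∈ F' → ζ ∈ symSet 𝓕 → co F' y ζ = 1 →
      (∀ e ∈ F', e ≠ y → co F' e ζ ≠ 0 → -e ∈ genSet 𝓕) → co F w y ≠ 0 →
      ∃ t, (t = ζ ∨ (t ∈ F' ∧ co F' t ζ ≠ 0)) ∧ (t = z ∨ t = -z) := by
    intro y ζ hy hζ h1 hM hne
    by_cases h2 : co F w ζ = 0
    · classical
      have h3 := apply_eq_sum_co hb' (co F w) ζ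
      rw [← Finset.add_sum_erase F' _ hy, h1, h2, one_smul] at h3
      obtain ⟨e, he, hne'⟩ : ∃ e ∈ F'.erase y, co F' e ζ • co F w e ≠ 0 := by
        by_contra! h4
        rw [Finset.sum_eq_zero h4, add_zero] at h3
        exact hne h3.symm
      obtain ⟨hey, heF⟩ := Finset.mem_erase.1 he
      have h5 := left_ne_zero_of_smul hne'
      have h6 := right_ne_zero_of_smul hne'
      exact ⟨e, Or.inr ⟨heF, h5⟩, hshare e ⟨⟨F', hF', heF⟩, hM e heF hey h5⟩ h6⟩
    · exact ⟨ζ, Or.inl rfl, hshare ζ hζ h2⟩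
  by_contra hcon
  obtain ⟨t₁, ht₁, e₁⟩ := key w z₁ hwF' hz₁ hz₁1 hM₁
    (by rw [co_self (H.basis F hF) hwF]; exact one_ne_zero)
  obtain ⟨t₂, ht₂, e₂⟩ := key w' z₂ hwF'' hz₂ hz₂1 hM₂ hcon
  have ht : t₂ = t₁ ∨ t₂ = -t₁ := by
    rcases e₁ with rfl | rfl <;> rcases e₂ with rfl | rfl <;> simp
  have hzz : ¬ (z₂ = z₁ ∨ z₂ = -z₁) := by
    intro h
    refine hw.2.2 (hM₂ w hwF' hne ?_)
    rcases h with rfl | rfl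
    · rw [hz₁1]; exact one_ne_zero
    · rw [map_neg, hz₁1]; exact neg_ne_zero.2 one_ne_zero
  rcases ht₁ with rfl | ⟨ht₁, hc₁⟩ <;> rcases ht₂ with rfl | ⟨ht₂, hc₂⟩
  · exact hzz ht
  · have h1 := hgt_of_mem hb' ht₂
    rcases ht with rfl | rfl
    · omega
    · rw [map_neg] at h1; omega
  · have h1 := hgt_of_mem hb' ht₁
    rcases ht with rfl | rfl
    · omega
    · rw [map_neg] at hz₂0; omega
  · have h1 := hgt_of_mem hb' ht₁
    have h2 := hgt_of_mem hb' ht₂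
    rcases ht with rfl | rfl
    · exact hzz (H.sym_share hF' hz₁ hz₂ hz₁0 hz₂0 hc₁ hc₂)
    · rw [map_neg] at h2; omega

/-- Take `F` with as many asymmetric vertices as possible. If `w` is missing, move in the direction
of `w` within their star: by maximality `w` is still not a vertex, yet all its coordinates are
nonnegative and its height is at most 0, so it would vanish. -/
theorem exists_facet_asym_subset : ∃ F ∈ 𝓕, ∀ w ∈ asymSet 𝓕, w ∈ F := by
  classical
  obtain ⟨F, hF, hmax⟩ := Set.exists_max_image 𝓕
    (fun F => (F.filter (· ∈ asymSet 𝓕)).card) H.finite H.nonempty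
  refine ⟨F, hF, fun w hw => ?_⟩
  by_contra hwF
  obtain ⟨F₁, hF₁, hS, h⟩ := H.exists_star hF (Finset.filter_subset (· ∈ asymSet 𝓕) F) w
  have hwF₁ : w ∉ F₁ := by
    intro hwF₁
    have := hmax F₁ hF₁
    refine absurd this (not_le.2 (Finset.card_lt_card ?_))
    refine (Finset.ssubset_iff_of_subset fun x hx =>
      Finset.mem_filter.2 ⟨hS hx, (Finset.mem_filter.1 hx).2⟩).2 ⟨w, ?_, ?_⟩
    · exact Finset.mem_filter.2 ⟨hwF₁, hw⟩
    · exact fun h => hwF (Finset.mem_filter.1 h).1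
  have hb := H.basis F₁ hF₁
  have hnn : ∀ f ∈ F₁, 0 ≤ co F₁ f w := by
    intro f hf
    by_cases hfS : f ∈ F.filter (· ∈ asymSet 𝓕)
    · rw [H.co_asym_eq_zero hF₁ hf (Finset.mem_filter.1 hfS).2 hw
        (by rintro rfl; exact hwF (Finset.mem_filter.1 hfS).1)]
    · exact h f hf hfS
  have h0 := H.hgt_le_zero hF₁ hw.1 hwF₁
  rw [hgt_apply] at h0
  exact H.ne_zero_of_mem_genSet hw.1 (eq_zero_of_co hb
    ((Finset.sum_eq_zero_iff_of_nonneg hnn).1 (le_antisymm h0 (Finset.sum_nonneg hnn))))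

end IsFacetSystem

end FanoFacets

/-! ### A maximal cone adapted to the span of the symmetric generators. -/

section AdaptedFacet

variable {N : Type*} [AddCommGroup N] {𝓕 : Set (Finset N)}

/-- A maximal cone with respect to which all generators in the span of the centrally symmetric
generators have a simple form. -/
structure IsAdapted (𝓕 : Set (Finset N)) (F : Finset N) : Prop where
  mem : F ∈ 𝓕
  cases : ∀ x ∈ genSet 𝓕, x ∈ symHull 𝓕 → x ∈ F ∨ -x ∈ F ∨ hgt F x = 0
  coord : ∀ x ∈ genSet 𝓕, x ∈ symHull 𝓕 → hgt F x = 0 → ∀ f,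
    co F f x = -1 ∨ co F f x = 0 ∨ co F f x = 1
  share : ∀ x ∈ genSet 𝓕, x ∈ symHull 𝓕 → hgt F x = 0 → ∀ y ∈ genSet 𝓕, y ∈ symHull 𝓕 →
    hgt F y = 0 → ∀ f, co F f x ≠ 0 → co F f y ≠ 0 → y = x ∨ y = -x
  asym : ∀ x ∈ asymSet 𝓕, hgt F x = 0 ∧ ∀ f, co F f x ≠ 0 → -f ∈ genSet 𝓕

/-- Start from a cone `F` containing all asymmetric generators `w`, keep its other vertices, and
move in the direction `-∑ w`. The new cone `F₀` contains `-z w` in place of `w`, where `z w` is the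
symmetric generator attached to `w`. Solving for `w` expresses it through `-z w` and symmetric
vertices of `F`, with height 0. -/
theorem IsFacetSystem.exists_isAdapted (H : IsFacetSystem 𝓕 fun _ => 1) :
    ∃ F, IsAdapted 𝓕 F := by
  classical
  obtain ⟨F, hF, hW⟩ := H.exists_facet_asym_subset
  have hb := H.basis F hF
  choose! z hz hz0 hz1 hzM hzs using fun w (hw : w ∈ asymSet 𝓕) =>
    H.exists_sym_of_asym hF (hW w hw) hw
  obtain ⟨F₀, hF₀, hS, hpos⟩ := H.exists_star hF
    (Finset.filter_subset (fun f => f ∉ asymSet 𝓕) F) (-∑ f ∈ F.filter (· ∈ asymSet 𝓕), f)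
  have hb₀ := H.basis F₀ hF₀
  have hsymS : ∀ f ∈ F, -f ∈ genSet 𝓕 → f ∈ F₀ := fun f hf hs =>
    hS (Finset.mem_filter.2 ⟨hf, fun h => h.2.2 hs⟩)
  have hwF₀ : ∀ w ∈ asymSet 𝓕, w ∉ F₀ := by
    intro w hw hwF₀
    have h1 := hpos w hwF₀ fun h => (Finset.mem_filter.1 h).2 hw
    have hmem : w ∈ F.filter (· ∈ asymSet 𝓕) := Finset.mem_filter.2 ⟨hW w hw, hw⟩
    rw [map_neg, map_sum, ← Finset.add_sum_erase _ _ hmem, co_self hb₀ hwF₀,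
      Finset.sum_eq_zero] at h1
    · omega
    · intro w' hw'
      obtain ⟨hne, hw'⟩ := Finset.mem_erase.1 hw'
      exact H.co_asym_eq_zero hF₀ hwF₀ hw (Finset.mem_filter.1 hw').2 hne.symm
  have hzexp : ∀ w ∈ asymSet 𝓕, w = z w - ∑ f ∈ F.erase w, co F f (z w) • f := by
    intro w hw
    have h1 := sum_co hb (z w)
    rw [← Finset.add_sum_erase F _ (hW w hw), hz1 w hw, one_smul] at h1
    rw [eq_sub_iff_add_eq]
    exact h1
  -- The support of `z w` other than `w` consists of symmetric vertices, which survive in `F₀`; as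
  -- `z w` has height 0 in `F`, they contribute -1.
  have hzz : ∀ w ∈ asymSet 𝓕, hgt F₀ (z w) = hgt F₀ w - 1 := by
    intro w hw
    have h1 := congrArg (hgt F₀) (hzexp w hw)
    have h2 : ∑ f ∈ F.erase w, co F f (z w) = -1 := by
      have := hz0 w hw
      rw [hgt_apply, ← Finset.add_sum_erase F _ (hW w hw), hz1 w hw] at this
      linarith
    have h3 : hgt F₀ (∑ f ∈ F.erase w, co F f (z w) • f) = -1 := by
      rw [← h2, map_sum]
      refine Finset.sum_congr rfl fun f hf => ?_
      obtain ⟨hne, hf⟩ := Finset.mem_erase.1 hf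
      rw [map_smul, smul_eq_mul]
      by_cases hc : co F f (z w) = 0
      · rw [hc, zero_mul]
      · rw [hgt_of_mem hb₀ (hsymS f hf (hzM w hw f hf hne hc)), mul_one]
    rw [map_sub, h3] at h1
    linarith
  -- Since `-z w` is a generator, its height `1 - hgt F₀ w` is at most 1, and `hgt F₀ w ≤ 0` because
  -- `w` is not a vertex.
  have hw0 : ∀ w ∈ asymSet 𝓕, hgt F₀ w = 0 := by
    intro w hw
    have h1 := H.hgt_le_zero hF₀ hw.1 (hwF₀ w hw)
    have h2 := H.hgt_le_one hF₀ (hz w hw).2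
    rw [map_neg, hzz w hw] at h2
    omega
  have hzF₀ : ∀ w ∈ asymSet 𝓕, -z w ∈ F₀ := fun w hw =>
    H.mem_of_hgt hF₀ (hz w hw).2 (by rw [map_neg, hzz w hw, hw0 w hw]; rfl)
  have hzF : ∀ w ∈ asymSet 𝓕, -z w ∉ F := fun w hw h => by
    have := hgt_of_mem hb h
    rw [map_neg, hz0 w hw] at this
    omega
  have hwco : ∀ w ∈ asymSet 𝓕, ∀ f ∈ F₀, co F₀ f w =
      (if f = -z w then -1 else 0) - if f ∈ F ∧ f ≠ w then co F f (z w) else 0 := by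
    intro w hw f hf
    have h1 := congrArg (co F₀ f) (hzexp w hw)
    rw [h1, map_sub]
    congr 1
    · have := co_apply hb₀ f (hzF₀ w hw)
      rw [map_neg] at this
      split_ifs at this ⊢ <;> omega
    · rw [map_sum]
      have : ∀ g ∈ F.erase w, co F₀ f (co F g (z w) • g) = if f = g then co F g (z w) else 0 := by
        intro g hg
        obtain ⟨hne, hg⟩ := Finset.mem_erase.1 hg
        rw [map_smul, smul_eq_mul]
        by_cases hc : co F g (z w) = 0
        · simp [hc]
        · rw [co_apply hb₀ f (hsymS g hg (hzM w hw g hg hne hc))]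
          simp
      rw [Finset.sum_congr rfl this, Finset.sum_ite_eq]
      simp only [Finset.mem_erase, and_comm, ne_eq]
  have hdich : ∀ w ∈ asymSet 𝓕, ∀ f, co F₀ f w ≠ 0 →
      f ∈ F₀ ∧ (f = -z w ∨ (f ∈ F ∧ f ≠ w ∧ co F f (z w) ≠ 0)) := by
    intro w hw f hne
    have hf : f ∈ F₀ := by
      by_contra h
      rw [co_of_notMem h] at hne; exact hne rfl
    refine ⟨hf, ?_⟩
    rw [hwco w hw f hf] at hne
    by_cases h1 : f = -z w
    · exact Or.inl h1
    · rw [if_neg h1] at hne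
      by_cases h2 : f ∈ F ∧ f ≠ w
      · rw [if_pos h2] at hne
        exact Or.inr ⟨h2.1, h2.2, fun h => hne (by rw [h]; rfl)⟩
      · rw [if_neg h2] at hne
        exact absurd rfl hne
  have hzne : ∀ w ∈ asymSet 𝓕, ∀ w' ∈ asymSet 𝓕, z w' = z w ∨ z w' = -z w → w' = w := by
    intro w hw w' hw' h
    by_contra hne
    refine hw.2.2 (hzM w' hw' w (hW w hw) (Ne.symm hne) ?_)
    rcases h with h | h
    · rw [h, hz1 w hw]; exact one_ne_zero
    · rw [h, map_neg, hz1 w hw]; exact neg_ne_zero.2 one_ne_zero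
  -- A symmetric `s` of height 0 is none of the `±z w'`, whose heights are ∓1. Hence it has no
  -- coordinate at any `w'` in `F`, and sharing `f` with `w` would mean sharing it with `z w` in
  -- `F`.
  have hsymw : ∀ s ∈ symSet 𝓕, hgt F₀ s = 0 → ∀ w ∈ asymSet 𝓕, ∀ f, co F₀ f s ≠ 0 →
      co F₀ f w = 0 := by
    intro s hs hs0 w hw f hfs
    by_contra hfw
    have hnz : ∀ w' ∈ asymSet 𝓕, ¬ (s = z w' ∨ s = -z w') := by
      rintro w' hw' (h | h)
      · rw [h, hzz w' hw', hw0 w' hw'] at hs0; omega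
      · rw [h, map_neg, hzz w' hw', hw0 w' hw'] at hs0; omega
    have hsF : hgt F s = 0 := by
      rcases H.sym_cases hF hs with h | h | h
      · rw [hgt_of_mem hb₀ (hsymS s h hs.2)] at hs0; omega
      · have := hgt_of_mem hb₀ (hsymS (-s) h (by rw [neg_neg]; exact hs.1))
        rw [map_neg] at this; omega
      · exact h
    have hcow : ∀ w' ∈ asymSet 𝓕, co F w' s = 0 := fun w' hw' => by
      by_contra h
      exact hnz w' hw' (hzs w' hw' s hs h)
    have hcof : co F f s ≠ 0 := by
      intro h
      apply hfs
      rw [apply_eq_sum_co hb (co F₀ f) s]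
      refine Finset.sum_eq_zero fun g hg => ?_
      by_cases hgw : g ∈ asymSet 𝓕
      · rw [hcow g hgw, zero_smul]
      · rw [co_apply hb₀ f (hS (Finset.mem_filter.2 ⟨hg, hgw⟩))]
        split_ifs with e
        · subst e; rw [h, zero_smul]
        · rw [smul_zero]
    obtain ⟨-, h1 | ⟨h1, -, h2⟩⟩ := hdich w hw f hfw
    · apply hcof
      rw [co_of_notMem]
      · rfl
      · rw [h1]; exact hzF w hw
    · exact hnz w hw (H.sym_share hF (hz w hw) hs (hz0 w hw) hsF h2 hcof)
  have hor : ∀ x ∈ genSet 𝓕, x ∈ symHull 𝓕 → x ∈ symSet 𝓕 ∨ x ∈ asymSet 𝓕 := by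
    intro x hx hh
    by_cases h : -x ∈ genSet 𝓕
    · exact Or.inl ⟨hx, h⟩
    · exact Or.inr ⟨hx, hh, h⟩
  refine ⟨F₀, hF₀, ?_, ?_, ?_, ?_⟩
  · intro x hx hh
    rcases hor x hx hh with h | h
    · exact H.sym_cases hF₀ h
    · exact Or.inr (Or.inr (hw0 x h))
  · intro x hx hh h0 f
    rcases hor x hx hh with h | h
    · exact H.sym_coord hF₀ h h0 f
    · by_cases hf : f ∈ F₀
      · rw [hwco x h f hf]
        by_cases h1 : f = -z x
        · rw [if_pos h1, if_neg (fun h2 => hzF x h (h1 ▸ h2.1))]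
          simp
        · rw [if_neg h1]
          split_ifs with h2
          · have := H.sym_coord hF (hz x h) (hz0 x h) f
            omega
          · simp
      · rw [co_of_notMem hf]; simp
  · intro x hx hxh hx0 y hy hyh hy0 f hfx hfy
    rcases hor x hx hxh with hx' | hx' <;> rcases hor y hy hyh with hy' | hy'
    · exact H.sym_share hF₀ hx' hy' hx0 hy0 hfx hfy
    · exact absurd (hsymw x hx' hx0 y hy' f hfx) hfy
    · exact absurd (hsymw y hy' hy0 x hx' f hfy) hfx
    · left
      refine hzne x hx' y hy' ?_
      obtain ⟨-, h1 | ⟨h1, -, h2⟩⟩ := hdich x hx' f hfx <;>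
        obtain ⟨-, h3 | ⟨h3, -, h4⟩⟩ := hdich y hy' f hfy
      · left; exact neg_injective (h3.symm.trans h1)
      · exact absurd (h1 ▸ h3) (hzF x hx')
      · exact absurd (h3 ▸ h1) (hzF y hy')
      · exact H.sym_share hF (hz x hx') (hz y hy') (hz0 x hx') (hz0 y hy') h2 h4
  · intro w hw
    refine ⟨hw0 w hw, fun f hf => ?_⟩
    obtain ⟨-, h1 | ⟨h1, h2, h3⟩⟩ := hdich w hw f hf
    · rw [h1, neg_neg]; exact (hz w hw).1
    · exact hzM w hw f h1 h2 h3

end AdaptedFacet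

/-! ### Sign patterns and their change by wall crossings. -/

section Blocks

variable {ι N L : Type*} [Fintype ι] [AddCommGroup N] [AddCommGroup L]

open Classical in
/-- The vector `x g` or its opposite, according to the sign pattern `P`. -/
noncomputable def signedVec (x : ι → N) (P : Finset ι) (g : ι) : N := if g ∈ P then x g else -x g

open Classical in
/-- The set of the vectors `x g` for `g ∈ P` and `-x g` for `g ∉ P`. -/
noncomputable def signedSet (x : ι → N) (P : Finset ι) : Finset N :=
  Finset.univ.image (signedVec x P)

open Classical in
/-- The maximal cones of a Del Pezzo variety (if `c` holds) or of a pseudo Del Pezzo variety (if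
not) with generators `±x g`, `-∑ x g` and, if `c` holds, `∑ x g`. -/
def blockFacets (c : Prop) (x : ι → N) : Set (Finset N) :=
  {E | ∃ P : Finset ι,
    ((2 * P.card = Fintype.card ι ∨ (¬ c ∧ Fintype.card ι ≤ 2 * P.card)) ∧ E = signedSet x P) ∨
    (2 * P.card = Fintype.card ι ∧ ∃ a ∈ P,
      E = insert (-∑ g, x g) ((signedSet x P).erase (x a))) ∨
    (c ∧ 2 * P.card = Fintype.card ι ∧ ∃ a ∉ P,
      E = insert (∑ g, x g) ((signedSet x P).erase (-x a)))}

variable {x : ι → N} {P Q : Finset ι}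

theorem mem_signedSet {y : N} : y ∈ signedSet x P ↔ ∃ g, signedVec x P g = y := by
  simp [signedSet]

theorem signedVec_mem (g : ι) : signedVec x P g ∈ signedSet x P := mem_signedSet.2 ⟨g, rfl⟩

omit [Fintype ι] in
theorem signedVec_of_mem {g : ι} (h : g ∈ P) : signedVec x P g = x g := if_pos h

omit [Fintype ι] in
theorem signedVec_of_notMem {g : ι} (h : g ∉ P) : signedVec x P g = -x g := if_neg h

omit [Fintype ι] in
theorem map_signedVec (v : N →ₗ[ℤ] L) (g : ι) :
    v (signedVec x P g) = signedVec (fun g => v (x g)) P g := by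
  unfold signedVec; split_ifs <;> simp

open Classical in
theorem image_signedSet (v : N →ₗ[ℤ] L) :
    (signedSet x P).image v = signedSet (fun g => v (x g)) P := by
  ext y
  simp only [Finset.mem_image, mem_signedSet]
  constructor
  · rintro ⟨_, ⟨g, rfl⟩, rfl⟩; exact ⟨g, (map_signedVec v g).symm⟩
  · rintro ⟨g, rfl⟩; exact ⟨_, ⟨g, rfl⟩, map_signedVec v g⟩

open Classical in
theorem image_mem_blockFacets {c : Prop} {v : N →ₗ[ℤ] L} (hv : Function.Injective v)
    {E : Finset N} (hE : E ∈ blockFacets c x) : E.image v ∈ blockFacets c fun g => v (x g) := by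
  obtain ⟨P, ⟨h, rfl⟩ | ⟨h, a, ha, rfl⟩ | ⟨h, h', a, ha, rfl⟩⟩ := hE
  · exact ⟨P, Or.inl ⟨h, image_signedSet v⟩⟩
  · refine ⟨P, Or.inr (Or.inl ⟨h, a, ha, ?_⟩)⟩
    rw [Finset.image_insert, Finset.image_erase hv, image_signedSet]
    simp
  · refine ⟨P, Or.inr (Or.inr ⟨h, h', a, ha, ?_⟩)⟩
    rw [Finset.image_insert, Finset.image_erase hv, image_signedSet]
    simp

open Classical in
theorem sum_sign (P : Finset ι) :
    ∑ g, (if g ∈ P then 1 else -1 : ℤ) = 2 * P.card - Fintype.card ι := by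
  have h1 : ∀ g, (if g ∈ P then 1 else -1 : ℤ) = 2 * (if g ∈ P then 1 else 0) - 1 := fun g => by
    split_ifs <;> rfl
  rw [Finset.sum_congr rfl fun g _ => h1 g, Finset.sum_sub_distrib, ← Finset.mul_sum]
  simp

/-- The vectors `x g` are distinct up to sign. -/
def SignDistinct (x : ι → N) : Prop := ∀ g h, g ≠ h → x g ≠ x h ∧ x g ≠ -x h

omit [Fintype ι] in
theorem SignDistinct.signedVec_ne (hx : SignDistinct x) {g h : ι} (hgh : g ≠ h) :
    signedVec x P g ≠ signedVec x P h := by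
  have h1 := hx g h hgh
  unfold signedVec
  split_ifs
  · exact h1.1
  · exact h1.2
  · exact fun e => h1.2 (by rw [← e, neg_neg])
  · exact fun e => h1.1 (neg_injective e)

variable {𝓕 : Set (Finset N)}

namespace IsFacetSystem

variable (H : IsFacetSystem 𝓕 fun _ => 1)
include H

omit [Fintype ι] in
open Classical in
theorem hgt_of_signedVec_mem {F : Finset N} (hF : F ∈ 𝓕) {g : ι} (h : signedVec x P g ∈ F) :
    hgt F (x g) = if g ∈ P then 1 else -1 := by
  have h1 := hgt_of_mem (H.basis F hF) h
  unfold signedVec at h1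
  split_ifs at h1 ⊢
  · exact h1
  · rw [map_neg] at h1; omega

omit [Fintype ι] in
theorem co_of_signedVec_mem {F : Finset N} (hF : F ∈ 𝓕) {g : ι} {y : N}
    (h : signedVec x P g ∈ F) (hne : y ≠ signedVec x P g) : co F y (x g) = 0 := by
  have h1 := co_ne (H.basis F hF) h hne
  unfold signedVec at h1
  split_ifs at h1
  · exact h1
  · rw [map_neg] at h1; omega

open Classical in
-- For a balanced pattern `-∑ x g` has height 0 and coordinate -1 at every `x a` with `a ∈ P`, so it
-- is the vertex behind each of these walls.
theorem insert_neg_sum_mem (hx : SignDistinct x) (hw : -∑ g, x g ∈ genSet 𝓕) {F : Finset N}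
    (hF : F ∈ 𝓕) (hP : signedSet x P ⊆ F) (hbal : 2 * P.card = Fintype.card ι) {a : ι}
    (ha : a ∈ P) : insert (-∑ g, x g) (F.erase (x a)) ∈ 𝓕 := by
  have hmem : ∀ g, signedVec x P g ∈ F := fun g => hP (signedVec_mem g)
  have haF : x a ∈ F := by have := hmem a; rwa [signedVec_of_mem ha] at this
  refine H.insert_erase_mem hF haF hw ?_ ?_
  · rw [map_neg, map_sum, Finset.sum_congr rfl fun g _ => H.hgt_of_signedVec_mem hF (hmem g),
      sum_sign]
    omega
  · rw [map_neg, map_sum, Finset.sum_eq_single a]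
    · rw [co_self (H.basis F hF) haF]; omega
    · intro g _ hga
      refine H.co_of_signedVec_mem hF (hmem g) ?_
      rw [← signedVec_of_mem (x := x) ha]
      exact hx.signedVec_ne hga.symm
    · simp

open Classical in
theorem insert_sum_mem (hx : SignDistinct x) (hw : ∑ g, x g ∈ genSet 𝓕) {F : Finset N}
    (hF : F ∈ 𝓕) (hP : signedSet x P ⊆ F) (hbal : 2 * P.card = Fintype.card ι) {a : ι}
    (ha : a ∉ P) : insert (∑ g, x g) (F.erase (-x a)) ∈ 𝓕 := by
  have hmem : ∀ g, signedVec x P g ∈ F := fun g => hP (signedVec_mem g)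
  have haF : -x a ∈ F := by have := hmem a; rwa [signedVec_of_notMem ha] at this
  refine H.insert_erase_mem hF haF hw ?_ ?_
  · rw [map_sum, Finset.sum_congr rfl fun g _ => H.hgt_of_signedVec_mem hF (hmem g),
      sum_sign]
    omega
  · rw [map_sum, Finset.sum_eq_single a]
    · have := co_self (H.basis F hF) haF
      rw [map_neg] at this; omega
    · intro g _ hga
      refine H.co_of_signedVec_mem hF (hmem g) ?_
      rw [← signedVec_of_notMem (x := x) ha]
      exact hx.signedVec_ne hga.symm
    · simp

open Classical in
/-- Exchanging the signs of two vectors of opposite signs in a balanced sign pattern. -/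
theorem exists_swap (hx : SignDistinct x) (hs : ∀ g, x g ∈ symSet 𝓕)
    (hw : -∑ g, x g ∈ genSet 𝓕) {F : Finset N}
    (hF : F ∈ 𝓕) (hP : signedSet x P ⊆ F) (hbal : 2 * P.card = Fintype.card ι) {a b : ι}
    (ha : a ∈ P) (hb : b ∉ P) :
    ∃ F' ∈ 𝓕, signedSet x (insert b (P.erase a)) ⊆ F' ∧ F \ signedSet x P ⊆ F' := by
  set w := -∑ g, x g with hwdef
  have hab : a ≠ b := by rintro rfl; exact hb ha
  have hmem : ∀ g, signedVec x P g ∈ F := fun g => hP (signedVec_mem g)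
  have hne : ∀ {g h}, g ≠ h → signedVec x P g ≠ signedVec x P h := fun h => hx.signedVec_ne h
  have eqa := signedVec_of_mem (x := x) ha
  have eqb := signedVec_of_notMem (x := x) hb
  -- The exchange takes three wall crossings: `w` replaces `x a`, then `-x a` replaces `-x b`, then
  -- `x b` replaces `w`. The heights and coordinates follow each time from the relation `w + ∑ x g =
  -- 0`.
  have hF₁ := H.insert_neg_sum_mem hx hw hF hP hbal ha
  rw [← hwdef] at hF₁
  set F₁ := insert w (F.erase (x a)) with hF₁def
  have hw0 : hgt F w = 0 := by
    rw [hwdef, map_neg, map_sum, Finset.sum_congr rfl fun g _ =>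
      H.hgt_of_signedVec_mem hF (hmem g), sum_sign]
    omega
  have hwF : ∀ y ∈ F, y ≠ w := by
    rintro y hy rfl
    rw [hgt_of_mem (H.basis F hF) hy] at hw0
    exact one_ne_zero hw0
  have hsum : ∀ m : N →ₗ[ℤ] ℤ, m w + ∑ g, m (x g) = 0 := fun m => by
    rw [hwdef, map_neg, map_sum, neg_add_cancel]
  have hsg : ∑ g, (if g ∈ P then 1 else -1 : ℤ) = 0 := by rw [sum_sign]; omega
  have split : ∀ f : ι → ℤ, ∑ g, f g = f a + (f b + ∑ g ∈ (Finset.univ.erase a).erase b, f g) :=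
    fun f => by
      rw [← Finset.add_sum_erase _ f (Finset.mem_univ a), ← Finset.add_sum_erase _ f
        (Finset.mem_erase.2 ⟨hab.symm, Finset.mem_univ b⟩)]
  have hsg' : ∑ g ∈ (Finset.univ.erase a).erase b, (if g ∈ P then 1 else -1 : ℤ) = 0 := by
    rw [split, if_pos ha, if_neg hb] at hsg
    omega
  have mem₁ : ∀ g, g ≠ a → signedVec x P g ∈ F₁ := fun g hg =>
    Finset.mem_insert_of_mem (Finset.mem_erase.2 ⟨by rw [← eqa]; exact hne hg, hmem g⟩)
  have hwF₁ : w ∈ F₁ := Finset.mem_insert_self _ _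
  have hbF₁ : -x b ∈ F₁ := by rw [← eqb]; exact mem₁ b hab.symm
  have hF₂ : insert (-x a) (F₁.erase (-x b)) ∈ 𝓕 := by
    refine H.insert_erase_mem hF₁ hbF₁ (hs a).2 ?_ ?_
    · have h1 := hsum (hgt F₁)
      rw [split, hgt_of_mem (H.basis _ hF₁) hwF₁, H.hgt_of_signedVec_mem hF₁ (mem₁ b hab.symm),
        Finset.sum_congr rfl fun g hg => H.hgt_of_signedVec_mem hF₁
          (mem₁ g (Finset.mem_erase.1 (Finset.mem_of_mem_erase hg)).1), hsg', if_neg hb] at h1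
      rw [map_neg]; omega
    · have h1 := hsum (co F₁ (-x b))
      have h2 := co_self (H.basis _ hF₁) hbF₁
      rw [map_neg] at h2
      rw [split, co_ne (H.basis _ hF₁) hwF₁ (hwF _ (eqb ▸ hmem b)),
        Finset.sum_eq_zero (s := (Finset.univ.erase a).erase b)] at h1
      · rw [map_neg]; omega
      · intro g hg
        obtain ⟨hgb, hg⟩ := Finset.mem_erase.1 hg
        exact H.co_of_signedVec_mem hF₁ (mem₁ g (Finset.mem_erase.1 hg).1)
          (by rw [← eqb]; exact hne hgb.symm)
  set F₂ := insert (-x a) (F₁.erase (-x b)) with hF₂def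
  have mem₂ : ∀ g, g ≠ a → g ≠ b → signedVec x P g ∈ F₂ := fun g hga hgb =>
    Finset.mem_insert_of_mem (Finset.mem_erase.2 ⟨by rw [← eqb]; exact hne hgb, mem₁ g hga⟩)
  have hwF₂ : w ∈ F₂ :=
    Finset.mem_insert_of_mem (Finset.mem_erase.2 ⟨(hwF _ (eqb ▸ hmem b)).symm, hwF₁⟩)
  have haF₂ : -x a ∈ F₂ := Finset.mem_insert_self _ _
  have hwa : w ≠ -x a := by
    intro h
    have h1 := hgt_of_mem (H.basis F hF) (eqa ▸ hmem a)
    rw [h, map_neg, h1] at hw0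
    omega
  have hF₃ : insert (x b) (F₂.erase w) ∈ 𝓕 := by
    refine H.insert_erase_mem hF₂ hwF₂ (hs b).1 ?_ ?_
    · have h1 := hsum (hgt F₂)
      have h2 := hgt_of_mem (H.basis _ hF₂) haF₂
      rw [map_neg] at h2
      rw [split, hgt_of_mem (H.basis _ hF₂) hwF₂,
        Finset.sum_congr rfl fun g hg => H.hgt_of_signedVec_mem hF₂
          (mem₂ g (Finset.mem_erase.1 (Finset.mem_of_mem_erase hg)).1
            (Finset.mem_erase.1 hg).1), hsg'] at h1
      omega
    · have h1 := hsum (co F₂ w)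
      have h2 := co_ne (H.basis _ hF₂) haF₂ hwa
      rw [map_neg] at h2
      rw [split, co_self (H.basis _ hF₂) hwF₂,
        Finset.sum_eq_zero (s := (Finset.univ.erase a).erase b)] at h1
      · omega
      · intro g hg
        obtain ⟨hgb, hg⟩ := Finset.mem_erase.1 hg
        exact H.co_of_signedVec_mem hF₂ (mem₂ g (Finset.mem_erase.1 hg).1 hgb)
          (hwF _ (hmem g)).symm
  refine ⟨_, hF₃, ?_, ?_⟩
  · intro y hy
    obtain ⟨g, rfl⟩ := mem_signedSet.1 hy
    by_cases hgb : g = b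
    · rw [hgb, signedVec_of_mem (Finset.mem_insert_self _ _)]
      exact Finset.mem_insert_self _ _
    refine Finset.mem_insert_of_mem ?_
    by_cases hga : g = a
    · rw [hga, signedVec_of_notMem (by simp [hab])]
      exact Finset.mem_erase.2 ⟨hwa.symm, haF₂⟩
    · have : signedVec x (insert b (P.erase a)) g = signedVec x P g := by
        simp [signedVec, hgb, hga]
      rw [this]
      exact Finset.mem_erase.2 ⟨hwF _ (hmem g), mem₂ g hga hgb⟩
  · intro r hr
    obtain ⟨hr, hrP⟩ := Finset.mem_sdiff.1 hr
    refine Finset.mem_insert_of_mem (Finset.mem_erase.2 ⟨hwF r hr, ?_⟩)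
    refine Finset.mem_insert_of_mem (Finset.mem_erase.2 ⟨?_, ?_⟩)
    · rintro rfl; exact hrP (eqb ▸ signedVec_mem b)
    · refine Finset.mem_insert_of_mem (Finset.mem_erase.2 ⟨?_, hr⟩)
      rintro rfl; exact hrP (eqa ▸ signedVec_mem a)

open Classical in
-- Two balanced patterns have the same cardinality, so they differ by exchanges of opposite signs;
-- the induction is on the number of these.
theorem exists_change_pattern (hx : SignDistinct x) (hs : ∀ g, x g ∈ symSet 𝓕)
    (hw : -∑ g, x g ∈ genSet 𝓕) {F : Finset N}
    (hF : F ∈ 𝓕) (hP : signedSet x P ⊆ F) (hbal : 2 * P.card = Fintype.card ι)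
    (hQ : 2 * Q.card = Fintype.card ι) :
    ∃ F' ∈ 𝓕, signedSet x Q ⊆ F' ∧ F \ signedSet x P ⊆ F' := by
  induction hn : (P \ Q).card generalizing P F with
  | zero =>
    have h1 : P ⊆ Q := by rwa [Finset.card_eq_zero, Finset.sdiff_eq_empty_iff_subset] at hn
    have h2 : P = Q := Finset.eq_of_subset_of_card_le h1 (by omega)
    subst h2
    exact ⟨F, hF, hP, Finset.sdiff_subset⟩
  | succ n ih =>
    have h1 : (Q \ P).card = n + 1 := by
      rw [← hn, Finset.card_sdiff_comm (by omega)]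
    obtain ⟨a, ha⟩ := Finset.card_pos.1 (by omega : 0 < (P \ Q).card)
    obtain ⟨b, hb⟩ := Finset.card_pos.1 (by omega : 0 < (Q \ P).card)
    rw [Finset.mem_sdiff] at ha hb
    obtain ⟨F₁, hF₁, h2, h3⟩ := H.exists_swap hx hs hw hF hP hbal ha.1 hb.2
    have hbP : b ∉ P.erase a := fun h => hb.2 (Finset.mem_of_mem_erase h)
    have hPpos : 0 < P.card := Finset.card_pos.2 ⟨a, ha.1⟩
    obtain ⟨F₂, hF₂, h4, h5⟩ := ih hF₁ h2
      (by rw [Finset.card_insert_of_notMem hbP, Finset.card_erase_of_mem ha.1]; omega)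
      (by
        have : insert b (P.erase a) \ Q = (P \ Q).erase a := by
          rw [Finset.insert_sdiff_of_mem _ hb.1, Finset.erase_sdiff_comm]
        rw [this, Finset.card_erase_of_mem (Finset.mem_sdiff.2 ha), hn]; rfl)
    -- A vertex of `F` outside the old pattern is not in the new one either: it would be the
    -- opposite of a vertex of `F`.
    refine ⟨F₂, hF₂, h4, fun r hr => h5 (Finset.mem_sdiff.2 ⟨h3 hr, fun hr' => ?_⟩)⟩
    obtain ⟨hrF, hrP⟩ := Finset.mem_sdiff.1 hr
    obtain ⟨g, rfl⟩ := mem_signedSet.1 hr'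
    have h6 := hP (signedVec_mem g)
    have h7 : signedVec x (insert b (P.erase a)) g ≠ signedVec x P g :=
      fun e => hrP (e ▸ signedVec_mem g)
    refine neg_notMem_basis (H.basis F hF) h6 ?_
    have : -signedVec x P g = signedVec x (insert b (P.erase a)) g := by
      unfold signedVec at h7 ⊢
      split_ifs at h7 ⊢ <;> simp at h7 ⊢
    rw [this]
    exact hrF

open Classical in
/-- Replacing a balanced sign pattern in a maximal cone by any other maximal cone of the block, in
the symmetric case, or by another balanced sign pattern. -/
theorem exists_change_block {c : Prop} (hx : SignDistinct x) (hs : ∀ g, x g ∈ symSet 𝓕)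
    (hw : -∑ g, x g ∈ genSet 𝓕) (hw' : c → ∑ g, x g ∈ genSet 𝓕) (hc : c) {F : Finset N}
    (hF : F ∈ 𝓕) (hP : signedSet x P ⊆ F) (hbal : 2 * P.card = Fintype.card ι)
    {E : Finset N} (hE : E ∈ blockFacets c x) :
    ∃ F' ∈ 𝓕, E ⊆ F' ∧ F \ signedSet x P ⊆ F' := by
  have key : ∀ Q : Finset ι, 2 * Q.card = Fintype.card ι → ∃ F' ∈ 𝓕, signedSet x Q ⊆ F' ∧
      F \ signedSet x P ⊆ F' ∧ ∀ r ∈ F, r ∉ signedSet x P → r ∉ signedSet x Q := by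
    intro Q hQ
    obtain ⟨F', hF', h1, h2⟩ := H.exists_change_pattern hx hs hw hF hP hbal hQ
    refine ⟨F', hF', h1, h2, fun r hr hrP hrQ => ?_⟩
    obtain ⟨g, rfl⟩ := mem_signedSet.1 hrQ
    have h3 : signedVec x P g ∈ F := hP (signedVec_mem g)
    by_cases e : signedVec x Q g = signedVec x P g
    · exact hrP (e ▸ signedVec_mem g)
    · refine neg_notMem_basis (H.basis F hF) h3 ?_
      have : -signedVec x P g = signedVec x Q g := by
        unfold signedVec at e ⊢
        split_ifs at e ⊢ <;> simp at e ⊢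
      rw [this]
      exact hr
  obtain ⟨Q, ⟨h, rfl⟩ | ⟨h, a, ha, rfl⟩ | ⟨h, h', a, ha, rfl⟩⟩ := hE
  · obtain ⟨F', hF', h1, h2, -⟩ := key Q (h.resolve_right fun h => h.1 hc)
    exact ⟨F', hF', h1, h2⟩
  · obtain ⟨F', hF', h1, h2, h3⟩ := key Q h
    refine ⟨_, H.insert_neg_sum_mem hx hw hF' h1 h ha,
      Finset.insert_subset_insert _ (Finset.erase_subset_erase _ h1), fun r hr => ?_⟩
    refine Finset.mem_insert_of_mem (Finset.mem_erase.2 ⟨?_, h2 hr⟩)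
    rintro rfl
    obtain ⟨h4, h5⟩ := Finset.mem_sdiff.1 hr
    exact h3 _ h4 h5 (signedVec_of_mem (x := x) ha ▸ signedVec_mem a)
  · obtain ⟨F', hF', h1, h2, h3⟩ := key Q h'
    refine ⟨_, H.insert_sum_mem hx (hw' hc) hF' h1 h' ha,
      Finset.insert_subset_insert _ (Finset.erase_subset_erase _ h1), fun r hr => ?_⟩
    refine Finset.mem_insert_of_mem (Finset.mem_erase.2 ⟨?_, h2 hr⟩)
    rintro rfl
    obtain ⟨h4, h5⟩ := Finset.mem_sdiff.1 hr
    exact h3 _ h4 h5 (signedVec_of_notMem (x := x) ha ▸ signedVec_mem a)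

end IsFacetSystem

end Blocks

/-! ### The fans of the Del Pezzo and pseudo Del Pezzo varieties. -/

section BlockSystem

variable {N : Type*} [AddCommGroup N]

open Classical in
-- A unimodular pivot: a coordinate -1 at `e` allows solving for `e` over the integers.
theorem exchange_basis {F : Finset N} (hb : IsLatticeBasis F) {e x : N} (he : e ∈ F)
    (hx : co F e x = -1) :
    IsLatticeBasis (insert x (F.erase e)) ∧
      (∀ y, co (insert x (F.erase e)) x y = -co F e y) ∧
      ∀ f ∈ F.erase e, ∀ y, co (insert x (F.erase e)) f y = co F f y + co F f x * co F e y := by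
  have hxF : x ∉ F.erase e := fun h => by
    obtain ⟨h1, h2⟩ := Finset.mem_erase.1 h
    rw [co_ne hb h2 h1.symm] at hx
    omega
  let c : N → N →ₗ[ℤ] ℤ := fun f => if f = x then -co F e else co F f + co F f x • co F e
  have hc : ∀ f ∈ insert x (F.erase e), ∀ g ∈ insert x (F.erase e),
      c f g = if f = g then 1 else 0 := by
    intro f hf g hg
    rcases Finset.mem_insert.1 hf with rfl | hf' <;> rcases Finset.mem_insert.1 hg with rfl | hg'
    · simp [c, hx]
    · have hgx : f ≠ g := fun h => hxF (h ▸ hg')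
      obtain ⟨h1, h2⟩ := Finset.mem_erase.1 hg'
      simp [c, hgx, co_ne hb h2 h1.symm]
    · have hgx : f ≠ g := fun h => hxF (h ▸ hf')
      simp [c, hgx, hx]
    · have hfx : f ≠ x := fun h => hxF (h ▸ hf')
      obtain ⟨h1, h2⟩ := Finset.mem_erase.1 hg'
      simp [c, hfx, co_ne hb h2 h1.symm, co_apply hb f h2]
  have hbas : IsLatticeBasis (insert x (F.erase e)) := by
    refine ⟨c, hc, fun y => ?_⟩
    have hne : ∀ f ∈ F.erase e, c f y • f = co F f y • f + co F e y • (co F f x • f) := by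
      intro f hf
      have hfx : f ≠ x := fun h => hxF (h ▸ hf)
      simp only [c, if_neg hfx, LinearMap.add_apply, LinearMap.smul_apply, smul_eq_mul, add_smul,
        smul_smul, mul_comm]
    have h1 := sum_co hb y
    have h2 := sum_co hb x
    rw [← Finset.add_sum_erase F _ he] at h1 h2
    rw [Finset.sum_insert hxF, Finset.sum_congr rfl hne, Finset.sum_add_distrib,
      ← Finset.smul_sum]
    rw [hx] at h2
    have h3 : ∑ f ∈ F.erase e, co F f x • f = x + e := by
      rw [neg_smul, one_smul, neg_add_eq_iff_eq_add] at h2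
      rw [h2, add_comm]
    have h4 : ∑ f ∈ F.erase e, co F f y • f = y - co F e y • e := by
      rw [eq_sub_iff_add_eq, add_comm]; exact h1
    rw [h3, h4]
    simp only [c, if_true, LinearMap.neg_apply, neg_smul, smul_add]
    abel
  refine ⟨hbas, fun y => ?_, fun f hf y => ?_⟩
  · rw [co_eq_of_apply hbas (hc x (Finset.mem_insert_self _ _))]
    simp [c]
  · rw [co_eq_of_apply hbas (hc f (Finset.mem_insert_of_mem hf))]
    have hfx : f ≠ x := fun h => hxF (h ▸ hf)
    simp [c, hfx]

theorem exists_top_subset {ι : Type*} [Fintype ι] (a : ι → ℤ) {k : ℕ}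
    (hk : k ≤ Fintype.card ι) : ∃ P : Finset ι, P.card = k ∧ ∀ p ∈ P, ∀ q ∉ P, a q ≤ a p := by
  classical
  induction k with
  | zero => exact ⟨∅, rfl, by simp⟩
  | succ k ih =>
    obtain ⟨P, hP, h⟩ := ih (by omega)
    have hne : (Finset.univ \ P).Nonempty := by
      rw [← Finset.card_pos, Finset.card_sdiff_of_subset (Finset.subset_univ _), Finset.card_univ]
      omega
    obtain ⟨m, hm, hmax⟩ := Finset.exists_max_image _ a hne
    have hmP : m ∉ P := (Finset.mem_sdiff.1 hm).2
    refine ⟨insert m P, by rw [Finset.card_insert_of_notMem hmP, hP], fun p hp q hq => ?_⟩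
    rw [Finset.mem_insert, not_or] at hq
    rcases Finset.mem_insert.1 hp with rfl | hp
    · exact hmax q (Finset.mem_sdiff.2 ⟨Finset.mem_univ _, hq.2⟩)
    · exact h p hp q hq.2

variable {ι : Type*} [Fintype ι] (b : Module.Basis ι ℤ N) (P : Finset ι)

omit [Fintype ι] in
theorem signDistinct_basis : SignDistinct b := by
  intro g h hgh
  classical
  refine ⟨fun e => hgh (b.injective e), fun e => ?_⟩
  have h1 := congrArg (fun y => b.repr y g) e
  simp [hgh.symm] at h1

open Classical in
theorem signedSet_basis : IsLatticeBasis (signedSet b P) := by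
  have := isLatticeBasis_image (b.isUnitSMul (w := fun g => if g ∈ P then (1 : ℤ) else -1)
    fun g => by split_ifs <;> simp)
  convert this using 1
  unfold signedSet
  congr 1
  ext g
  simp only [signedVec, Module.Basis.isUnitSMul_apply]
  split_ifs <;> simp

open Classical in
theorem co_signedSet (g : ι) (y : N) :
    co (signedSet b P) (signedVec b P g) y = (if g ∈ P then 1 else -1) * b.repr y g := by
  have hb := signedSet_basis b P
  rw [co_eq_of_apply hb (m := (if g ∈ P then (1 : ℤ) else -1) • b.coord g) fun f hf => ?_]
  · split_ifs <;> simp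
  · obtain ⟨h, rfl⟩ := mem_signedSet.1 hf
    by_cases hgh : g = h
    · subst hgh
      unfold signedVec
      split_ifs <;> simp_all
    · rw [if_neg ((signDistinct_basis b).signedVec_ne hgh)]
      unfold signedVec
      split_ifs <;> simp [Ne.symm hgh]

theorem repr_sum (g : ι) : b.repr (∑ h, b h) g = 1 := by
  classical
  rw [map_sum, Finsupp.finsetSum_apply, Finset.sum_eq_single g]
  · simp
  · intro h _ hne; simp [hne]
  · simp

variable {P}

open Classical in
theorem co_insert_neg_sum {a : ι} (ha : a ∈ P) :
    IsLatticeBasis (insert (-∑ g, b g) ((signedSet b P).erase (b a))) ∧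
    (∀ y, co (insert (-∑ g, b g) ((signedSet b P).erase (b a))) (-∑ g, b g) y = -b.repr y a) ∧
    ∀ g, g ≠ a → ∀ y, co (insert (-∑ g, b g) ((signedSet b P).erase (b a))) (signedVec b P g) y
      = (if g ∈ P then 1 else -1) * (b.repr y g - b.repr y a) := by
  have e := signedVec_of_mem (x := b) ha
  have hea := signedVec_mem (x := b) (P := P) a
  have hco := co_signedSet b P a
  rw [e] at hea hco
  have hx : co (signedSet b P) (b a) (-∑ g, b g) = -1 := by
    rw [hco, map_neg, Finsupp.neg_apply, repr_sum, if_pos ha]; rfl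
  obtain ⟨h1, h2, h3⟩ := exchange_basis (signedSet_basis b P) hea hx
  refine ⟨h1, fun y => by rw [h2, hco, if_pos ha, one_mul], fun g hg y => ?_⟩
  rw [h3 _ (Finset.mem_erase.2 ⟨by rw [← e]; exact (signDistinct_basis b).signedVec_ne hg,
    signedVec_mem g⟩), hco, co_signedSet, co_signedSet, map_neg, Finsupp.neg_apply, repr_sum,
    if_pos ha]
  ring

open Classical in
theorem co_insert_sum {a : ι} (ha : a ∉ P) :
    IsLatticeBasis (insert (∑ g, b g) ((signedSet b P).erase (-b a))) ∧
    (∀ y, co (insert (∑ g, b g) ((signedSet b P).erase (-b a))) (∑ g, b g) y = b.repr y a) ∧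
    ∀ g, g ≠ a → ∀ y, co (insert (∑ g, b g) ((signedSet b P).erase (-b a))) (signedVec b P g) y
      = (if g ∈ P then 1 else -1) * (b.repr y g - b.repr y a) := by
  have e := signedVec_of_notMem (x := b) ha
  have hea := signedVec_mem (x := b) (P := P) a
  have hco := co_signedSet b P a
  rw [e] at hea hco
  have hx : co (signedSet b P) (-b a) (∑ g, b g) = -1 := by
    rw [hco, repr_sum, if_neg ha]; rfl
  obtain ⟨h1, h2, h3⟩ := exchange_basis (signedSet_basis b P) hea hx
  refine ⟨h1, fun y => by rw [h2, hco, if_neg ha]; ring, fun g hg y => ?_⟩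
  rw [h3 _ (Finset.mem_erase.2 ⟨by rw [← e]; exact (signDistinct_basis b).signedVec_ne hg,
    signedVec_mem g⟩), hco, co_signedSet, co_signedSet, repr_sum, if_neg ha]
  ring

theorem mem_erase_signedSet {a : ι} {y z : N} (hz : signedVec b P a = z) [DecidableEq N]
    (h : y ∈ (signedSet b P).erase z) : ∃ g, g ≠ a ∧ signedVec b P g = y := by
  obtain ⟨h1, h2⟩ := Finset.mem_erase.1 h
  obtain ⟨g, rfl⟩ := mem_signedSet.1 h2
  exact ⟨g, by rintro rfl; exact h1 hz, rfl⟩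

/-- The generators of a Del Pezzo or pseudo Del Pezzo variety. -/
def blockGens (c : Prop) (x : ι → N) : Set N :=
  {y | (∃ g, y = x g) ∨ (∃ g, y = -x g) ∨ y = -∑ g, x g ∨ (c ∧ y = ∑ g, x g)}

theorem blockFacets_subset {c : Prop} {x : ι → N} {E : Finset N} (hE : E ∈ blockFacets c x)
    {y : N} (hy : y ∈ E) : y ∈ blockGens c x := by
  classical
  have key : ∀ P : Finset ι, ∀ y ∈ signedSet x P, y ∈ blockGens c x := by
    intro P y hy
    obtain ⟨g, rfl⟩ := mem_signedSet.1 hy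
    unfold signedVec
    split_ifs
    · exact Or.inl ⟨g, rfl⟩
    · exact Or.inr (Or.inl ⟨g, rfl⟩)
  obtain ⟨P, ⟨h, rfl⟩ | ⟨h, a, ha, rfl⟩ | ⟨h, h', a, ha, rfl⟩⟩ := hE
  · exact key P y hy
  · rcases Finset.mem_insert.1 hy with rfl | hy
    · exact Or.inr (Or.inr (Or.inl rfl))
    · exact key P y (Finset.mem_of_mem_erase hy)
  · rcases Finset.mem_insert.1 hy with rfl | hy
    · exact Or.inr (Or.inr (Or.inr ⟨h, rfl⟩))
    · exact key P y (Finset.mem_of_mem_erase hy)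

theorem blockFacets_basis {c : Prop} {E : Finset N} (hE : E ∈ blockFacets c b) :
    IsLatticeBasis E := by
  obtain ⟨P, ⟨h, rfl⟩ | ⟨h, a, ha, rfl⟩ | ⟨h, h', a, ha, rfl⟩⟩ := hE
  · exact signedSet_basis b P
  · exact (co_insert_neg_sum b ha).1
  · exact (co_insert_sum b ha).1

open Classical in
-- On a pure pattern the height of `∑ b g` is `2 |P| - n`. It is 0 if `P` is balanced and
-- nonnegative for the larger patterns, which occur only when `∑ b g` is not a generator. On the
-- other facets the vector `b a` left out has height 0.
theorem blockFacets_form {c : Prop} {E : Finset N} (hE : E ∈ blockFacets c b) {y : N}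
    (hy : y ∈ blockGens c b) (hn : y ∉ E) : hgt E y < 1 := by
  have hbas := blockFacets_basis b hE
  have hsum : ∀ m : N →ₗ[ℤ] ℤ, m (∑ g, b g) = ∑ g, m (b g) := fun m => map_sum _ _ _
  have vals : ∀ (m : N →ₗ[ℤ] ℤ) (Q : Finset ι) (g : ι), m (signedVec b Q g) = 1 →
      m (b g) = if g ∈ Q then 1 else -1 := by
    intro m Q g hm
    unfold signedVec at hm
    split_ifs at hm ⊢
    · exact hm
    · rw [map_neg] at hm; omega
  have small : ∀ (Q : Finset ι) (g : ι), signedVec b Q g ∈ E → (y = b g ∨ y = -b g) →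
      hgt E y < 1 := by
    intro Q g hg hyg
    have h1 := hgt_of_mem hbas hg
    unfold signedVec at hg h1
    split_ifs at hg h1 <;> rcases hyg with rfl | rfl
    · exact absurd hg hn
    · rw [map_neg]; omega
    · rw [map_neg] at h1; omega
    · exact absurd hg hn
  obtain ⟨P, ⟨h, hEeq⟩ | ⟨h, a, ha, hEeq⟩ | ⟨h, h', a, ha, hEeq⟩⟩ := hE
  · have hmem : ∀ g, signedVec b P g ∈ E := fun g => hEeq ▸ signedVec_mem g
    have hv := fun g => vals (hgt E) P g (hgt_of_mem hbas (hmem g))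
    have hs := hsum (hgt E)
    rw [Finset.sum_congr rfl fun g _ => hv g, sum_sign] at hs
    rcases hy with ⟨g, rfl⟩ | ⟨g, rfl⟩ | rfl | ⟨hc, rfl⟩
    · exact small P g (hmem g) (Or.inl rfl)
    · exact small P g (hmem g) (Or.inr rfl)
    · rw [map_neg, hs]; omega
    · rw [hs]; have := h.resolve_right fun h => h.1 hc; omega
  · have e := signedVec_of_mem (x := b) ha
    have hmem : ∀ g, g ≠ a → signedVec b P g ∈ E := fun g hg => by
      rw [hEeq, ← e]
      exact Finset.mem_insert_of_mem (Finset.mem_erase.2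
        ⟨(signDistinct_basis b).signedVec_ne hg, signedVec_mem g⟩)
    have hw : -∑ g, b g ∈ E := by rw [hEeq]; exact Finset.mem_insert_self _ _
    have hs := (hsum (hgt E)).trans
      (Finset.add_sum_erase _ (fun g => hgt E (b g)) (Finset.mem_univ a)).symm
    have hw1 := hgt_of_mem hbas hw
    rw [map_neg] at hw1
    have hsg := sum_sign P
    rw [← Finset.add_sum_erase _ _ (Finset.mem_univ a)] at hsg
    rw [Finset.sum_congr rfl fun g hg => vals (hgt E) P g
      (hgt_of_mem hbas (hmem g (Finset.mem_erase.1 hg).1))] at hs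
    rw [if_pos ha] at hsg
    rcases hy with ⟨g, rfl⟩ | ⟨g, rfl⟩ | rfl | ⟨hc, rfl⟩
    · by_cases hg : g = a
      · subst hg; omega
      · exact small P g (hmem g hg) (Or.inl rfl)
    · by_cases hg : g = a
      · subst hg; rw [map_neg]; omega
      · exact small P g (hmem g hg) (Or.inr rfl)
    · exact absurd hw hn
    · omega
  · have e := signedVec_of_notMem (x := b) ha
    have hmem : ∀ g, g ≠ a → signedVec b P g ∈ E := fun g hg => by
      rw [hEeq, ← e]
      exact Finset.mem_insert_of_mem (Finset.mem_erase.2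
        ⟨(signDistinct_basis b).signedVec_ne hg, signedVec_mem g⟩)
    have hw : ∑ g, b g ∈ E := by rw [hEeq]; exact Finset.mem_insert_self _ _
    have hs := (hsum (hgt E)).trans
      (Finset.add_sum_erase _ (fun g => hgt E (b g)) (Finset.mem_univ a)).symm
    have hw1 := hgt_of_mem hbas hw
    have hsg := sum_sign P
    rw [← Finset.add_sum_erase _ _ (Finset.mem_univ a)] at hsg
    rw [Finset.sum_congr rfl fun g hg => vals (hgt E) P g
      (hgt_of_mem hbas (hmem g (Finset.mem_erase.1 hg).1))] at hs
    rw [if_neg ha] at hsg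
    rcases hy with ⟨g, rfl⟩ | ⟨g, rfl⟩ | rfl | ⟨hc, rfl⟩
    · by_cases hg : g = a
      · subst hg; omega
      · exact small P g (hmem g hg) (Or.inl rfl)
    · by_cases hg : g = a
      · subst hg; rw [map_neg]; omega
      · exact small P g (hmem g hg) (Or.inr rfl)
    · rw [map_neg]; omega
    · exact absurd hw hn

/-- Let `P` be the half of the indices with the largest coordinates. A negative coordinate in `P`
calls for `-∑ b g`, replacing the smallest one in `P`; if `c` holds, a positive one outside `P`
calls for `∑ b g`, replacing the largest there. Otherwise `y` lies in the cone of a sign pattern: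
`P` itself if `c` holds, and else the set of nonnegative coordinates, which contains `P` and so is
large enough. -/
theorem blockFacets_cover (c : Prop) (hcard : Even (Fintype.card ι)) (y : N) :
    ∃ E ∈ blockFacets c b, ∀ f ∈ E, 0 ≤ co E f y := by
  classical
  obtain ⟨k, hk⟩ := hcard
  obtain ⟨P, hP, htop⟩ := exists_top_subset (fun g => b.repr y g) (k := k) (by omega)
  have hbal : 2 * P.card = Fintype.card ι := by omega
  by_cases h1 : ∃ p ∈ P, b.repr y p < 0
  · obtain ⟨p, hp, hneg⟩ := h1
    obtain ⟨a, ha, hmin⟩ := Finset.exists_min_image P (fun g => b.repr y g) ⟨p, hp⟩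
    refine ⟨_, ⟨P, Or.inr (Or.inl ⟨hbal, a, ha, rfl⟩)⟩, fun f hf => ?_⟩
    obtain ⟨-, h2, h3⟩ := co_insert_neg_sum b ha
    rcases Finset.mem_insert.1 hf with rfl | hf
    · rw [h2]; have := hmin p hp; omega
    · obtain ⟨g, hg, rfl⟩ := mem_erase_signedSet b (signedVec_of_mem ha) hf
      rw [h3 g hg]
      split_ifs with hgP
      · have := hmin g hgP; omega
      · have := htop a ha g hgP; omega
  · push Not at h1
    by_cases h2 : c ∧ ∃ q ∉ P, 0 < b.repr y q
    · obtain ⟨hc, q, hq, hpos⟩ := h2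
      obtain ⟨a, ha, hmax⟩ := Finset.exists_max_image (Finset.univ \ P) (fun g => b.repr y g)
        ⟨q, by simpa using hq⟩
      have ha : a ∉ P := (Finset.mem_sdiff.1 ha).2
      refine ⟨_, ⟨P, Or.inr (Or.inr ⟨hc, hbal, a, ha, rfl⟩)⟩, fun f hf => ?_⟩
      obtain ⟨-, h2, h3⟩ := co_insert_sum b ha
      rcases Finset.mem_insert.1 hf with rfl | hf
      · rw [h2]; have := hmax q (by simpa using hq); omega
      · obtain ⟨g, hg, rfl⟩ := mem_erase_signedSet b (signedVec_of_notMem ha) hf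
        rw [h3 g hg]
        split_ifs with hgP
        · have := htop g hgP a ha; omega
        · have := hmax g (by simpa using hgP); omega
    · by_cases hc : c
      · push Not at h2
        refine ⟨_, ⟨P, Or.inl ⟨Or.inl hbal, rfl⟩⟩, fun f hf => ?_⟩
        obtain ⟨g, rfl⟩ := mem_signedSet.1 hf
        rw [co_signedSet]
        split_ifs with hgP
        · have := h1 g hgP; omega
        · have := h2 hc g hgP; omega
      · let Q : Finset ι := Finset.univ.filter fun g => 0 ≤ b.repr y g
        have hQ : P ⊆ Q := fun g hg => by simpa [Q] using h1 g hg
        have := Finset.card_le_card hQ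
        refine ⟨_, ⟨Q, Or.inl ⟨Or.inr ⟨hc, by omega⟩, rfl⟩⟩, fun f hf => ?_⟩
        obtain ⟨g, rfl⟩ := mem_signedSet.1 hf
        rw [co_signedSet]
        split_ifs with hgQ
        · have : 0 ≤ b.repr y g := by simpa [Q] using hgQ
          omega
        · have : ¬ 0 ≤ b.repr y g := by simpa [Q] using hgQ
          omega

theorem blockFacets_isFacetSystem (c : Prop) (hcard : Even (Fintype.card ι)) :
    IsFacetSystem (blockFacets c b) fun _ => 1 where
  finite := by
    classical
    have hfin : (blockGens c b).Finite := by
      refine (((Set.finite_range b).union (Set.finite_range fun g => -b g)).union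
        (Set.toFinite {-∑ g, b g, ∑ g, b g})).subset ?_
      rintro y (⟨g, rfl⟩ | ⟨g, rfl⟩ | rfl | ⟨hc, rfl⟩)
      · exact Or.inl (Or.inl ⟨g, rfl⟩)
      · exact Or.inl (Or.inr ⟨g, rfl⟩)
      · exact Or.inr (Or.inl rfl)
      · exact Or.inr (Or.inr rfl)
    refine (hfin.toFinset.powerset : Finset (Finset N)).finite_toSet.subset fun E hE => ?_
    simp only [Finset.mem_coe, Finset.mem_powerset]
    exact fun y hy => hfin.mem_toFinset.2 (blockFacets_subset hE hy)
  basis E hE := blockFacets_basis b hE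
  form E hE := ⟨hgt E, fun f hf => hgt_of_mem (blockFacets_basis b hE) hf,
    fun E' hE' x hx hn => blockFacets_form b hE (blockFacets_subset hE' hx) hn⟩
  cover y := blockFacets_cover b c hcard y

/-- Evenness and positivity of the number of indices provide, for each index, balanced patterns
containing it and avoiding it. -/
theorem genSet_blockFacets {c : Prop} {x : ι → N} (hcard : Even (Fintype.card ι))
    (hpos : 0 < Fintype.card ι) : genSet (blockFacets c x) = blockGens c x := by
  classical
  obtain ⟨k, hk⟩ := hcard
  have hP : ∀ g : ι, ∃ P : Finset ι, g ∈ P ∧ P.card = k := fun g => by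
    obtain ⟨P, h1, -, h2⟩ := Finset.exists_subsuperset_card_eq (Finset.subset_univ {g}) (n := k)
      (by simp; omega) (by simp; omega)
    exact ⟨P, by simpa using h1, h2⟩
  have hPc : ∀ g : ι, ∃ P : Finset ι, g ∉ P ∧ P.card = k := fun g => by
    obtain ⟨P, h1, h2⟩ := hP g
    exact ⟨Pᶜ, by simpa using h1, by rw [Finset.card_compl]; omega⟩
  obtain ⟨g₀⟩ := Fintype.card_pos_iff.1 hpos
  refine Set.Subset.antisymm (fun y ⟨E, hE, hy⟩ => blockFacets_subset hE hy) ?_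
  rintro y (⟨g, rfl⟩ | ⟨g, rfl⟩ | rfl | ⟨hc, rfl⟩)
  · obtain ⟨P, h1, h2⟩ := hP g
    exact ⟨_, ⟨P, Or.inl ⟨Or.inl (by omega), rfl⟩⟩, by
      rw [← signedVec_of_mem (x := x) h1]; exact signedVec_mem g⟩
  · obtain ⟨P, h1, h2⟩ := hPc g
    exact ⟨_, ⟨P, Or.inl ⟨Or.inl (by omega), rfl⟩⟩, by
      rw [← signedVec_of_notMem (x := x) h1]; exact signedVec_mem g⟩
  · obtain ⟨P, h1, h2⟩ := hP g₀
    exact ⟨_, ⟨P, Or.inr (Or.inl ⟨by omega, g₀, h1, rfl⟩)⟩, Finset.mem_insert_self _ _⟩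
  · obtain ⟨P, h1, h2⟩ := hPc g₀
    exact ⟨_, ⟨P, Or.inr (Or.inr ⟨hc, by omega, g₀, h1, rfl⟩)⟩, Finset.mem_insert_self _ _⟩

end BlockSystem

/-! ### Stars of reversible cones are again Fano. -/

section Star

variable {N M : Type*} [AddCommGroup N] [AddCommGroup M] {𝓕 : Set (Finset N)} {S : Finset N}

open Classical in
/-- The facets of the star of the cone spanned by `S`, in the quotient lattice. -/
def starFacets (𝓕 : Set (Finset N)) (S : Finset N) (p : N →ₗ[ℤ] M) : Set (Finset M) :=
  {R | ∃ F ∈ 𝓕, S ⊆ F ∧ R = (F \ S).image p}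

/-- The lattice homomorphism `p` is a split surjection with kernel spanned by `S`. -/
structure IsQuotientBy (S : Finset N) (p : N →ₗ[ℤ] M) : Prop where
  exists_section : ∃ s : M →ₗ[ℤ] N, ∀ z, p (s z) = z
  ker : ∀ x, p x = 0 ↔ x ∈ Submodule.span ℤ (S : Set N)

namespace IsQuotientBy

variable {p : N →ₗ[ℤ] M} (hp : IsQuotientBy S p)
include hp

theorem map_eq_zero {s : N} (hs : s ∈ S) : p s = 0 := (hp.ker s).2 (Submodule.subset_span hs)

theorem co_eq_zero {F : Finset N} (hF : IsLatticeBasis F) (hS : S ⊆ F) {f : N} (hf : f ∉ S) {x : N}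
    (hx : p x = 0) : co F f x = 0 := by
  rw [hp.ker] at hx
  have : Submodule.span ℤ (S : Set N) ≤ LinearMap.ker (co F f) := by
    rw [Submodule.span_le]
    intro s hs
    exact co_ne hF (hS hs) (by rintro rfl; exact hf hs)
  exact this hx

theorem eq_zero {F : Finset N} (hF : IsLatticeBasis F) {x : N}
    (h : ∀ f ∈ F, f ∉ S → co F f x = 0) : p x = 0 := by
  rw [apply_eq_sum_co hF p x]
  refine Finset.sum_eq_zero fun f hf => ?_
  by_cases hfS : f ∈ S
  · rw [hp.map_eq_zero hfS, smul_zero]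
  · rw [h f hf hfS, zero_smul]

open Classical in
theorem basis {F : Finset N} (hF : IsLatticeBasis F) (hS : S ⊆ F) :
    IsLatticeBasis ((F \ S).image p) ∧ Set.InjOn p (F \ S : Finset N) ∧
      ∀ f ∈ F \ S, ∀ x, co ((F \ S).image p) (p f) (p x) = co F f x := by
  obtain ⟨s, hs⟩ := hp.exists_section
  have hsp : ∀ f ∉ S, ∀ x, co F f (s (p x)) = co F f x := fun f hf x => by
    rw [← sub_eq_zero, ← map_sub]
    exact hp.co_eq_zero hF hS hf (by rw [map_sub, hs, sub_self])
  have hinj : Set.InjOn p (F \ S : Finset N) := by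
    intro f hf g hg e
    rw [Finset.mem_coe, Finset.mem_sdiff] at hf hg
    have h1 := hsp f hf.2 f
    rw [e, hsp f hf.2, co_self hF hf.1, co_apply hF f hg.1] at h1
    by_contra hne
    rw [if_neg hne] at h1
    exact zero_ne_one h1
  have hdual : ∀ f ∈ F \ S, ∀ g ∈ (F \ S).image p,
      (co F f ∘ₗ s) g = if p f = g then 1 else 0 := by
    intro f hf g hg
    obtain ⟨y, hy, rfl⟩ := Finset.mem_image.1 hg
    rw [LinearMap.comp_apply, hsp f (Finset.mem_sdiff.1 hf).2,
      co_apply hF f (Finset.mem_sdiff.1 hy).1]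
    exact if_congr (hinj.eq_iff hf hy).symm rfl rfl
  have hb : IsLatticeBasis ((F \ S).image p) := by
    refine ⟨fun r => if h : ∃ f ∈ F \ S, p f = r then co F h.choose ∘ₗ s else 0, ?_, ?_⟩
    · intro r hr g hg
      have h : ∃ f ∈ F \ S, p f = r := Finset.mem_image.1 hr
      beta_reduce
      rw [dif_pos h, hdual _ h.choose_spec.1 g hg, h.choose_spec.2]
    · intro z
      rw [Finset.sum_image hinj]
      have h1 : ∀ f ∈ F \ S, (if h : ∃ g ∈ F \ S, p g = p f then co F h.choose ∘ₗ s else 0) z • p f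
          = co F f (s z) • p f := by
        intro f hf
        have h : ∃ g ∈ F \ S, p g = p f := ⟨f, hf, rfl⟩
        rw [dif_pos h, hinj h.choose_spec.1 hf h.choose_spec.2]
        rfl
      rw [Finset.sum_congr rfl h1]
      conv_rhs => rw [← hs z, apply_eq_sum_co hF p (s z)]
      refine Finset.sum_subset Finset.sdiff_subset fun f hf hfS => ?_
      have : f ∈ S := by
        by_contra h; exact hfS (Finset.mem_sdiff.2 ⟨hf, h⟩)
      rw [hp.map_eq_zero this, smul_zero]
  refine ⟨hb, hinj, fun f hf x => ?_⟩
  rw [co_eq_of_apply hb (hdual f hf)]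
  exact hsp f (Finset.mem_sdiff.1 hf).2 x

end IsQuotientBy

/-- Every maximal cone containing `S` has a counterpart in which the elements of `S` are replaced
by their opposites. -/
def IsReversible (𝓕 : Set (Finset N)) (S : Finset N) : Prop :=
  ∀ F ∈ 𝓕, S ⊆ F → ∃ F' ∈ 𝓕, (∀ f ∈ F, f ∉ S → f ∈ F') ∧ ∀ s ∈ S, -s ∈ F'

namespace IsFacetSystem

variable (H : IsFacetSystem 𝓕 fun _ => 1) {p : N →ₗ[ℤ] M} (hp : IsQuotientBy S p)
  (hrev : IsReversible 𝓕 S)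
include H hp hrev

open Classical in
-- In `hgt F + hgt F'` the contributions of `S` cancel, so the sum is twice the height of the star.
-- At `x` it is at most `0 + 1`, and half of that is at most 0 by integrality.
theorem hgt_star_le {F : Finset N} (hF : F ∈ 𝓕) (hS : S ⊆ F) {x : N} (hx : x ∈ genSet 𝓕)
    (hxF : x ∉ F) : hgt ((F \ S).image p) (p x) ≤ 0 := by
  obtain ⟨F', hF', h1, h2⟩ := hrev F hF hS
  obtain ⟨hb, hinj, hco⟩ := hp.basis (H.basis F hF) hS
  have e : (2 : ℤ) • (hgt ((F \ S).image p) ∘ₗ p) = hgt F + hgt F' := by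
    refine linearMap_ext_of_basis (H.basis F hF) fun f hf => ?_
    rw [LinearMap.smul_apply, LinearMap.comp_apply, LinearMap.add_apply,
      hgt_of_mem (H.basis F hF) hf]
    by_cases hfS : f ∈ S
    · have h3 := hgt_of_mem (H.basis F' hF') (h2 f hfS)
      rw [map_neg] at h3
      rw [hp.map_eq_zero hfS, map_zero, smul_zero]
      omega
    · rw [hgt_of_mem (H.basis F' hF') (h1 f hf hfS),
        hgt_of_mem hb (Finset.mem_image_of_mem _ (Finset.mem_sdiff.2 ⟨hf, hfS⟩))]
      rfl
  have e1 := LinearMap.congr_fun e x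
  rw [LinearMap.smul_apply, LinearMap.comp_apply, LinearMap.add_apply, smul_eq_mul] at e1
  have := H.hgt_le_zero hF hx hxF
  have := H.hgt_le_one hF' hx
  omega

open Classical in
/-- A generator outside of the span of `S` spans a cone together with `S`. -/
theorem exists_mem_star {F₀ : Finset N} (hF₀ : F₀ ∈ 𝓕) (hS₀ : S ⊆ F₀) {x y : N}
    (hx : x ∈ genSet 𝓕) (hy : y ∈ genSet 𝓕) (hxy : p x = p y) (h0 : p x ≠ 0) :
    ∃ F ∈ 𝓕, S ⊆ F ∧ x ∈ F ∧ y ∈ F := by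
  obtain ⟨F, hF, hS, hpos⟩ := H.exists_star hF₀ hS₀ x
  obtain ⟨hb, hinj, hco⟩ := hp.basis (H.basis F hF) hS
  -- The image of `x` is a nonzero vector in this cone of the star, so its height is positive; by
  -- `hgt_star_le` only vertices of `F` can have such an image.
  have h1 : 0 < hgt ((F \ S).image p) (p x) := by
    rw [hgt_apply, Finset.sum_image hinj, Finset.sum_congr rfl fun f hf => hco f hf x]
    have h2 : ∀ f ∈ F \ S, 0 ≤ co F f x := fun f hf =>
      hpos f (Finset.mem_sdiff.1 hf).1 (Finset.mem_sdiff.1 hf).2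
    refine lt_of_le_of_ne (Finset.sum_nonneg h2) fun h => h0 ?_
    have h3 := (Finset.sum_eq_zero_iff_of_nonneg h2).1 h.symm
    exact hp.eq_zero (H.basis F hF) fun f hf hfS => h3 f (Finset.mem_sdiff.2 ⟨hf, hfS⟩)
  refine ⟨F, hF, hS, ?_, ?_⟩
  · by_contra h
    exact absurd (H.hgt_star_le hp hrev hF hS hx h) (not_le.2 h1)
  · by_contra h
    exact absurd (H.hgt_star_le hp hrev hF hS hy h) (not_le.2 (hxy ▸ h1))

theorem injOn_star {F₀ : Finset N} (hF₀ : F₀ ∈ 𝓕) (hS₀ : S ⊆ F₀) {x y : N}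
    (hx : x ∈ genSet 𝓕) (hy : y ∈ genSet 𝓕) (hxy : p x = p y) (h0 : p x ≠ 0) : x = y := by
  classical
  obtain ⟨F, hF, hS, hxF, hyF⟩ := H.exists_mem_star hp hrev hF₀ hS₀ hx hy hxy h0
  refine (hp.basis (H.basis F hF) hS).2.1 (Finset.mem_sdiff.2 ⟨hxF, fun h => ?_⟩)
    (Finset.mem_sdiff.2 ⟨hyF, fun h => ?_⟩) hxy
  · exact h0 (hp.map_eq_zero h)
  · exact h0 (hxy ▸ hp.map_eq_zero h)

theorem star {F₀ : Finset N} (hF₀ : F₀ ∈ 𝓕) (hS₀ : S ⊆ F₀) :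
    IsFacetSystem (starFacets 𝓕 S p) fun _ => 1 where
  finite := by
    classical
    refine (H.finite.image fun F => (F \ S).image p).subset ?_
    rintro _ ⟨F, hF, -, rfl⟩
    exact ⟨F, hF, rfl⟩
  basis := by
    rintro _ ⟨F, hF, hS, rfl⟩
    exact (hp.basis (H.basis F hF) hS).1
  form := by
    classical
    rintro _ ⟨F, hF, hS, rfl⟩
    refine ⟨hgt ((F \ S).image p), fun f hf => hgt_of_mem (hp.basis (H.basis F hF) hS).1 hf, ?_⟩
    rintro _ ⟨F', hF', hS', rfl⟩ r hr hn
    obtain ⟨x, hx, rfl⟩ := Finset.mem_image.1 hr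
    rw [Finset.mem_sdiff] at hx
    have := H.hgt_star_le hp hrev hF hS ⟨F', hF', hx.1⟩ fun h =>
      hn (Finset.mem_image_of_mem _ (Finset.mem_sdiff.2 ⟨h, hx.2⟩))
    omega
  cover z := by
    classical
    obtain ⟨s, hs⟩ := hp.exists_section
    obtain ⟨F, hF, hS, hpos⟩ := H.exists_star hF₀ hS₀ (s z)
    refine ⟨_, ⟨F, hF, hS, rfl⟩, fun r hr => ?_⟩
    obtain ⟨f, hf, rfl⟩ := Finset.mem_image.1 hr
    rw [← hs z, (hp.basis (H.basis F hF) hS).2.2 f hf]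
    exact hpos f (Finset.mem_sdiff.1 hf).1 (Finset.mem_sdiff.1 hf).2

end IsFacetSystem

open Classical in
/-- A lift to the generators of the generators of the star. -/
noncomputable def starLift (𝓕 : Set (Finset N)) (p : N →ₗ[ℤ] M) (r : M) : N :=
  if h : ∃ x ∈ genSet 𝓕, p x = r then h.choose else 0

theorem starLift_spec {p : N →ₗ[ℤ] M} {x : N} (hx : x ∈ genSet 𝓕) :
    starLift 𝓕 p (p x) ∈ genSet 𝓕 ∧ p (starLift 𝓕 p (p x)) = p x := by
  have h : ∃ y ∈ genSet 𝓕, p y = p x := ⟨x, hx, rfl⟩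
  rw [starLift, dif_pos h]
  exact h.choose_spec

theorem starLift_spec_of_mem {p : N →ₗ[ℤ] M} {R : Finset M} (hR : R ∈ starFacets 𝓕 S p) {r : M}
    (hr : r ∈ R) : starLift 𝓕 p r ∈ genSet 𝓕 ∧ p (starLift 𝓕 p r) = r := by
  classical
  obtain ⟨F, hF, -, rfl⟩ := hR
  obtain ⟨x, hx, rfl⟩ := Finset.mem_image.1 hr
  exact starLift_spec ⟨F, hF, (Finset.mem_sdiff.1 hx).1⟩

theorem starLift_apply (H : IsFacetSystem 𝓕 fun _ => 1) {p : N →ₗ[ℤ] M} (hp : IsQuotientBy S p)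
    (hrev : IsReversible 𝓕 S) {F₀ : Finset N} (hF₀ : F₀ ∈ 𝓕) (hS₀ : S ⊆ F₀) {x : N}
    (hx : x ∈ genSet 𝓕) (h0 : p x ≠ 0) : starLift 𝓕 p (p x) = x := by
  obtain ⟨h1, h2⟩ := starLift_spec (p := p) hx
  exact H.injOn_star hp hrev hF₀ hS₀ h1 hx h2 (by rwa [h2])

open Classical in
theorem image_starLift (H : IsFacetSystem 𝓕 fun _ => 1) {p : N →ₗ[ℤ] M} (hp : IsQuotientBy S p)
    (hrev : IsReversible 𝓕 S) {F : Finset N} (hF : F ∈ 𝓕) (hS : S ⊆ F) :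
    ((F \ S).image p).image (starLift 𝓕 p) = F \ S := by
  rw [Finset.image_image]
  refine (Finset.image_congr fun f hf => ?_).trans Finset.image_id
  rw [Finset.mem_coe] at hf
  obtain ⟨hb, -⟩ := hp.basis (H.basis F hF) hS
  exact starLift_apply H hp hrev hF hS ⟨F, hF, (Finset.mem_sdiff.1 hf).1⟩
    (ne_zero_of_mem_basis hb (Finset.mem_image_of_mem _ hf))

end Star

/-! ### Coordinate projections as quotients by a cone. -/

section Projection

variable {N : Type*} [AddCommGroup N]

/-- The projection of the lattice to the coordinates in `T`. -/
noncomputable def coordProj (F T : Finset N) : N →ₗ[ℤ] (T → ℤ) := LinearMap.pi fun f => co F f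

theorem coordProj_apply (F T : Finset N) (x : N) (f : T) : coordProj F T x f = co F f x := rfl

theorem isQuotientBy_coordProj [DecidableEq N] {F : Finset N} (hF : IsLatticeBasis F)
    {S : Finset N} (hS : S ⊆ F) : IsQuotientBy S (coordProj F (F \ S)) where
  exists_section := by
    refine ⟨∑ f : (F \ S : Finset N), (LinearMap.proj f).smulRight (f : N), fun z => ?_⟩
    ext f
    have hf := Finset.mem_sdiff.1 f.2
    rw [coordProj_apply, LinearMap.sum_apply, map_sum, Finset.sum_eq_single f]
    · rw [LinearMap.smulRight_apply, map_smul, co_self hF hf.1]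
      simp
    · intro g _ hgf
      rw [LinearMap.smulRight_apply, map_smul, co_ne hF (Finset.mem_sdiff.1 g.2).1
        fun e => hgf (Subtype.ext e.symm), smul_zero]
    · simp
  ker x := by
    constructor
    · intro h
      rw [← sum_co hF x]
      refine Submodule.sum_mem _ fun f hf => ?_
      by_cases hfS : f ∈ S
      · exact Submodule.smul_mem _ _ (Submodule.subset_span hfS)
      · have := congrFun h ⟨f, Finset.mem_sdiff.2 ⟨hf, hfS⟩⟩
        rw [coordProj_apply] at this
        rw [show co F f x = 0 from this, zero_smul]
        exact zero_mem _
    · have : Submodule.span ℤ (S : Set N) ≤ LinearMap.ker (coordProj F (F \ S)) := by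
        rw [Submodule.span_le]
        intro s hs
        ext f
        rw [coordProj_apply, co_ne hF (hS hs)]
        · rfl
        · rintro e
          exact (Finset.mem_sdiff.1 f.2).2 (e ▸ hs)
      exact fun h => this h

end Projection

/-! ### Independent replacement of disjoint parts of a maximal cone. -/

section Replace

variable {N σ : Type*} {𝓕 : Set (Finset N)}

/-- Replacing one after the other the parts `C s` of a maximal cone by `E s`. -/
theorem exists_replace {C E : σ → Finset N} (T : Finset σ)
    (hswap : ∀ s ∈ T, ∀ F ∈ 𝓕, C s ⊆ F → ∃ F' ∈ 𝓕, E s ⊆ F' ∧ ∀ x ∈ F, x ∉ C s → x ∈ F')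
    (hC : ∀ s t, s ≠ t → ∀ x ∈ C s, x ∉ C t) (hE : ∀ s t, s ≠ t → ∀ x ∈ E s, x ∉ C t)
    {F : Finset N} (hF : F ∈ 𝓕) (hCF : ∀ s ∈ T, C s ⊆ F) :
    ∃ F' ∈ 𝓕, (∀ s ∈ T, E s ⊆ F') ∧ ∀ x ∈ F, (∀ s ∈ T, x ∉ C s) → x ∈ F' := by
  classical
  induction T using Finset.induction_on generalizing F with
  | empty => exact ⟨F, hF, by simp, fun x hx _ => hx⟩
  | insert s T hs ih =>
    obtain ⟨F₁, hF₁, h1, h2⟩ := hswap s (Finset.mem_insert_self _ _) F hF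
      (hCF s (Finset.mem_insert_self _ _))
    have hne : ∀ t ∈ T, t ≠ s := fun t ht e => hs (e ▸ ht)
    obtain ⟨F₂, hF₂, h3, h4⟩ := ih (fun t ht => hswap t (Finset.mem_insert_of_mem ht)) hF₁
      fun t ht x hx => h2 x (hCF t (Finset.mem_insert_of_mem ht) hx) (hC t s (hne t ht) x hx)
    refine ⟨F₂, hF₂, fun t ht => ?_, fun x hx hn => ?_⟩
    · rcases Finset.mem_insert.1 ht with rfl | ht
      · exact fun x hx => h4 x (h1 hx) fun t' ht' => hE t t' (hne t' ht').symm x hx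
      · exact h3 t ht
    · exact h4 x (h2 x hx (hn s (Finset.mem_insert_self _ _)))
        fun t ht => hn t (Finset.mem_insert_of_mem ht)

end Replace

/-! ### Extraction of the blocks from an adapted cone. -/

section SymmetricBlocks

variable {N : Type*} [AddCommGroup N] {𝓕 : Set (Finset N)}

/-- A set of representatives of a centrally symmetric set up to sign. -/
theorem exists_half {B : Set N} (hfin : B.Finite) (hneg : ∀ x ∈ B, -x ∈ B)
    (hne : ∀ x ∈ B, x ≠ -x) :
    ∃ R : Finset N, (∀ x ∈ R, x ∈ B) ∧ (∀ x ∈ B, x ∈ R ∨ -x ∈ R) ∧ ∀ x ∈ R, -x ∉ R := by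
  classical
  -- An arbitrary well-order selects one vector from each pair.
  refine ⟨hfin.toFinset.filter fun x => WellOrderingRel x (-x), ?_, ?_, ?_⟩
  · intro x hx
    exact hfin.mem_toFinset.1 (Finset.mem_filter.1 hx).1
  · intro x hx
    simp only [Finset.mem_filter, Set.Finite.mem_toFinset, hx, hneg x hx, true_and, neg_neg]
    rcases trichotomous_of WellOrderingRel x (-x) with h | h | h
    · exact Or.inl h
    · exact absurd h (hne x hx)
    · exact Or.inr h
  · intro x hx hx'
    have h1 := (Finset.mem_filter.1 hx).2
    have h2 := (Finset.mem_filter.1 hx').2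
    rw [neg_neg] at h2
    exact asymm_of WellOrderingRel h1 h2

/-- A maximal cone `F` and generators `ω s` which, together with their supports with respect to `F`
and with the set `T`, describe all the generators in the span of the centrally symmetric ones. The
generator `ω s` is centrally symmetric if and only if `c s` holds. -/
structure IsBlockSystem {σ : Type*} (𝓕 : Set (Finset N)) (F : Finset N) (c : σ → Prop) (ω : σ → N)
    (T : Finset N) : Prop where
  mem : F ∈ 𝓕
  gen : ∀ s, ω s ∈ genSet 𝓕
  neg : ∀ s, -ω s ∈ genSet 𝓕 ↔ c s
  hgt_eq : ∀ s, hgt F (ω s) = 0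
  coord : ∀ s f, co F f (ω s) = -1 ∨ co F f (ω s) = 0 ∨ co F f (ω s) = 1
  disj : ∀ s t, s ≠ t → ∀ f, co F f (ω s) ≠ 0 → co F f (ω t) = 0
  sym : ∀ s f, co F f (ω s) ≠ 0 → f ∈ symSet 𝓕
  rest_sym : ∀ t ∈ T, t ∈ symSet 𝓕
  rest_neg : ∀ t ∈ T, -t ∉ T
  rest_indep : LinearIndependent ℚ fun t : T => toNQ (t : N)
  rest_co : ∀ t ∈ T, ∀ s f, co F f (ω s) ≠ 0 → co F f t = 0
  classify : ∀ x ∈ genSet 𝓕, x ∈ symHull 𝓕 →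
    (∃ s, x = ω s ∨ (c s ∧ x = -ω s) ∨ co F x (ω s) ≠ 0 ∨ co F (-x) (ω s) ≠ 0) ∨ x ∈ T ∨ -x ∈ T

theorem IsFacetSystem.finite_genSet {a : N → ℤ} (H : IsFacetSystem 𝓕 a) : (genSet 𝓕).Finite := by
  refine (H.finite.biUnion fun F _ => F.finite_toSet).subset ?_
  rintro x ⟨F, hF, hx⟩
  exact Set.mem_biUnion hF hx

theorem ne_neg_of_ne_zero {F : Finset N} (hF : IsLatticeBasis F) {x : N} (hx : x ≠ 0) :
    x ≠ -x := by
  intro e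
  refine hx (eq_zero_of_co hF fun f _ => ?_)
  have := congrArg (co F f) e
  rw [map_neg] at this
  omega

/-- The symmetric generators of height 0 split, up to sign, into those supported on symmetric
vertices (`RA`, the Del Pezzo blocks) and the others (`RK`). The asymmetric generators (`RB`) give
the pseudo Del Pezzo blocks. `RK` and the symmetric vertices of `F` outside all block supports make
up `T`. -/
theorem IsFacetSystem.exists_isBlockSystem (H : IsFacetSystem 𝓕 fun _ => 1) :
    ∃ (F : Finset N) (a b : ℕ) (ω : Fin a ⊕ Fin b → N) (T : Finset N),
      IsBlockSystem 𝓕 F (fun s : Fin a ⊕ Fin b => s.isLeft = true) ω T := by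
  classical
  obtain ⟨F, hA⟩ := H.exists_isAdapted
  have hb := H.basis F hA.mem
  have hfin := H.finite_genSet
  have hne : ∀ x ∈ genSet 𝓕, x ≠ -x := fun x hx =>
    ne_neg_of_ne_zero hb (H.ne_zero_of_mem_genSet hx)
  have mem_of_co : ∀ f x, co F f x ≠ 0 → f ∈ F := fun f x h => by
    by_contra hf
    rw [co_of_notMem hf] at h
    exact h rfl
  obtain ⟨RA, hRA, hRA', hRAn⟩ := exists_half
    (B := {x | x ∈ symSet 𝓕 ∧ hgt F x = 0 ∧ ∀ f, co F f x ≠ 0 → -f ∈ genSet 𝓕})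
    (hfin.subset fun x hx => hx.1.1)
    (fun x hx => ⟨neg_mem_symSet hx.1, by rw [map_neg, hx.2.1, neg_zero], fun f hf =>
      hx.2.2 f fun h => hf (by rw [map_neg, h, neg_zero])⟩) fun x hx => hne x hx.1.1
  obtain ⟨RK, hRK, hRK', hRKn⟩ := exists_half
    (B := {x | x ∈ symSet 𝓕 ∧ hgt F x = 0 ∧ ∃ f, co F f x ≠ 0 ∧ -f ∉ genSet 𝓕})
    (hfin.subset fun x hx => hx.1.1)
    (fun x hx => ⟨neg_mem_symSet hx.1, by rw [map_neg, hx.2.1, neg_zero], by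
      obtain ⟨f, hf, hf'⟩ := hx.2.2
      exact ⟨f, by rw [map_neg]; exact neg_ne_zero.2 hf, hf'⟩⟩) fun x hx => hne x hx.1.1
  have hfinB : (asymSet 𝓕).Finite := hfin.subset fun x hx => hx.1
  let RB := hfinB.toFinset
  have hRB : ∀ x, x ∈ RB ↔ x ∈ asymSet 𝓕 := fun x => hfinB.mem_toFinset
  let ω : Fin RA.card ⊕ Fin RB.card → N :=
    Sum.elim (fun i => RA.equivFin.symm i) fun k => RB.equivFin.symm k
  have hωl : ∀ i, ω (Sum.inl i) ∈ RA := fun i => (RA.equivFin.symm i).2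
  have hωr : ∀ k, ω (Sum.inr k) ∈ asymSet 𝓕 := fun k => (hRB _).1 (RB.equivFin.symm k).2
  have hsurl : ∀ x ∈ RA, ∃ i, ω (Sum.inl i) = x := fun x hx =>
    ⟨RA.equivFin ⟨x, hx⟩, by simp [ω]⟩
  have hsurr : ∀ x ∈ asymSet 𝓕, ∃ k, ω (Sum.inr k) = x := fun x hx =>
    ⟨RB.equivFin ⟨x, (hRB x).2 hx⟩, by simp [ω]⟩
  have hgen : ∀ s, ω s ∈ genSet 𝓕 := by
    rintro (i | k)
    · exact (hRA _ (hωl i)).1.1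
    · exact (hωr k).1
  have hhull : ∀ s, ω s ∈ symHull 𝓕 := by
    rintro (i | k)
    · exact symSet_subset_symHull (hRA _ (hωl i)).1
    · exact (hωr k).2.1
  have hneg : ∀ s, -ω s ∈ genSet 𝓕 ↔ s.isLeft = true := by
    rintro (i | k)
    · simpa using (hRA _ (hωl i)).1.2
    · simpa using (hωr k).2.2
  have hhgt : ∀ s, hgt F (ω s) = 0 := by
    rintro (i | k)
    · exact (hRA _ (hωl i)).2.1
    · exact (hA.asym _ (hωr k)).1
  have hsupp : ∀ s f, co F f (ω s) ≠ 0 → -f ∈ genSet 𝓕 := by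
    rintro (i | k)
    · exact (hRA _ (hωl i)).2.2
    · exact (hA.asym _ (hωr k)).2
  have hinj : Function.Injective ω := by
    rintro (i | k) (i' | k') e
    · exact congrArg _ (RA.equivFin.symm.injective (Subtype.ext e))
    · exact absurd (hRA _ (hωl i)).1.2 (e ▸ (hωr k').2.2)
    · exact absurd (hRA _ (hωl i')).1.2 (e ▸ (hωr k).2.2)
    · exact congrArg _ (RB.equivFin.symm.injective (Subtype.ext e))
  have hinjneg : ∀ s t, ω s ≠ -ω t := by
    rintro (i | k) (i' | k') e
    · exact hRAn _ (hωl i') (e ▸ hωl i)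
    · exact (hωr k').2.2 (e ▸ (hRA _ (hωl i)).1.1)
    · exact (hωr k).2.2 (by rw [e, neg_neg]; exact (hRA _ (hωl i')).1.1)
    · exact (hωr k').2.2 (e ▸ (hωr k).1)
  let T : Finset N := (F.filter fun f => -f ∈ genSet 𝓕 ∧ ∀ s, co F f (ω s) = 0) ∪ RK
  have hTF : ∀ t ∈ T, (t ∈ F ∧ -t ∈ genSet 𝓕 ∧ ∀ s, co F t (ω s) = 0) ∨ t ∈ RK := fun t ht => by
    rcases Finset.mem_union.1 ht with h | h
    · exact Or.inl (Finset.mem_filter.1 h)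
    · exact Or.inr h
  have hsymneg : ∀ x, x ∈ symSet 𝓕 → x ∈ genSet 𝓕 ∧ x ∈ symHull 𝓕 := fun x hx =>
    ⟨hx.1, symSet_subset_symHull hx⟩
  refine ⟨F, RA.card, RB.card, ω, T, hA.mem, hgen, hneg, hhgt, ?_, ?_, ?_, ?_, ?_, ?_, ?_, ?_⟩
  · exact fun s => hA.coord _ (hgen s) (hhull s) (hhgt s)
  · intro s t hst f hf
    by_contra hft
    rcases hA.share _ (hgen s) (hhull s) (hhgt s) _ (hgen t) (hhull t) (hhgt t) f hf hft with e | e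
    · exact hst (hinj e.symm)
    · exact hinjneg _ _ e
  · exact fun s f hf => ⟨⟨F, hA.mem, mem_of_co _ _ hf⟩, hsupp s f hf⟩
  · intro t ht
    rcases hTF t ht with h | h
    · exact ⟨⟨F, hA.mem, h.1⟩, h.2.1⟩
    · exact (hRK t h).1
  · intro t ht ht'
    rcases hTF t ht with h | h <;> rcases hTF _ ht' with h' | h'
    · exact neg_notMem_basis hb h.1 h'.1
    · have h1 := (hRK _ h').2.1
      rw [map_neg, hgt_of_mem hb h.1] at h1
      omega
    · have h1 := (hRK _ h).2.1
      have h2 := hgt_of_mem hb h'.1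
      rw [map_neg, h1] at h2
      omega
    · exact hRKn t h h'
  · rw [Fintype.linearIndependent_iff]
    intro g hg
    have key : ∀ f, ∑ t : T, g t * (co F f (t : N) : ℚ) = 0 := fun f => by
      have := congrArg (extQ (co F f)) hg
      rw [map_sum, map_zero] at this
      rw [← this]
      exact Finset.sum_congr rfl fun t _ => by rw [map_smul, extQ_toNQ, smul_eq_mul]
    -- A vector of `RK` has a coordinate at a nonsymmetric vertex. No other vector of `T` does: a
    -- vertex in `T` is symmetric, and a second vector of `RK` sharing it would agree with the first
    -- up to sign.
    have hK : ∀ t : T, (t : N) ∈ RK → g t = 0 := by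
      intro t ht
      obtain ⟨h1, h2, f, hf, hf'⟩ := hRK _ ht
      have h3 := key f
      rw [Finset.sum_eq_single t] at h3
      · exact (mul_eq_zero.1 h3).resolve_right (by exact_mod_cast hf)
      · intro t' _ hne'
        rcases hTF t' t'.2 with h | h
        · rw [co_ne hb h.1 (by rintro rfl; exact hf' h.2.1)]; simp
        · by_cases hz : co F f (t' : N) = 0
          · rw [hz]; simp
          · exfalso
            obtain ⟨h4, h5, -⟩ := hRK _ h
            rcases hA.share _ h1.1 (hsymneg _ h1).2 h2 _ h4.1 (hsymneg _ h4).2 h5 f hf hz with e | e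
            · exact hne' (Subtype.ext e)
            · exact hRKn _ ht (e ▸ h)
      · simp
    intro t
    rcases hTF t t.2 with h | h
    · have h3 := key t
      rw [Finset.sum_eq_single t] at h3
      · rw [co_self hb h.1] at h3; simpa using h3
      · intro t' _ hne'
        rcases hTF t' t'.2 with h' | h'
        · rw [co_ne hb h'.1 fun e => hne' (Subtype.ext e.symm)]; simp
        · rw [hK t' h', zero_mul]
      · simp
    · exact hK t h
  · intro t ht s f hf
    rcases hTF t ht with h | h
    · refine co_ne hb h.1 ?_
      rintro rfl
      exact hf (h.2.2 s)
    · by_contra hft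
      obtain ⟨h1, h2, g, hg, hg'⟩ := hRK _ h
      rcases hA.share _ (hgen s) (hhull s) (hhgt s) _ h1.1 (hsymneg _ h1).2 h2 f hf hft with e | e
      · exact hg' (hsupp s g (e ▸ hg))
      · refine hg' (hsupp s g fun h3 => hg ?_)
        rw [e, map_neg, h3, neg_zero]
  · intro x hx hh
    have hFcase : ∀ y ∈ F, -y ∈ genSet 𝓕 → (∃ s, co F y (ω s) ≠ 0) ∨ y ∈ T := by
      intro y hy hyn
      by_cases h : ∃ s, co F y (ω s) ≠ 0
      · exact Or.inl h
      · push Not at h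
        exact Or.inr (Finset.mem_union_left _ (Finset.mem_filter.2 ⟨hy, hyn, h⟩))
    rcases hA.cases x hx hh with h | h | h
    · have hxn : -x ∈ genSet 𝓕 := by
        by_contra hxn
        have := (hA.asym x ⟨hx, hh, hxn⟩).1
        rw [hgt_of_mem hb h] at this
        exact one_ne_zero this
      rcases hFcase x h hxn with ⟨s, h'⟩ | h'
      · exact Or.inl ⟨s, Or.inr (Or.inr (Or.inl h'))⟩
      · exact Or.inr (Or.inl h')
    · rcases hFcase _ h (by rwa [neg_neg]) with ⟨s, h'⟩ | h'
      · exact Or.inl ⟨s, Or.inr (Or.inr (Or.inr h'))⟩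
      · exact Or.inr (Or.inr h')
    · by_cases hxn : -x ∈ genSet 𝓕
      · by_cases hf : ∀ f, co F f x ≠ 0 → -f ∈ genSet 𝓕
        · rcases hRA' x ⟨⟨hx, hxn⟩, h, hf⟩ with h' | h'
          · obtain ⟨i, hi⟩ := hsurl _ h'
            exact Or.inl ⟨_, Or.inl hi.symm⟩
          · obtain ⟨i, hi⟩ := hsurl _ h'
            exact Or.inl ⟨Sum.inl i, Or.inr (Or.inl ⟨rfl, by rw [hi, neg_neg]⟩)⟩
        · push Not at hf
          rcases hRK' x ⟨⟨hx, hxn⟩, h, hf⟩ with h' | h'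
          · exact Or.inr (Or.inl (Finset.mem_union_right _ h'))
          · exact Or.inr (Or.inr (Finset.mem_union_right _ h'))
      · obtain ⟨k, hk⟩ := hsurr x ⟨hx, hh, hxn⟩
        exact Or.inl ⟨_, Or.inl hk.symm⟩

end SymmetricBlocks

/-! ### A block in the coordinates of its support. -/

section BlockVec

variable {N : Type u} [AddCommGroup N] {𝓕 : Set (Finset N)} {F : Finset N} {w : N}

open Classical in
/-- The elements of `F` occurring in `w`. -/
noncomputable def blockSupp (F : Finset N) (w : N) : Finset N := F.filter fun f => co F f w ≠ 0

/-- The summands of `-w` with respect to the lattice basis `F`. -/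
noncomputable def blockVec (F : Finset N) (w : N) (t : blockSupp F w) : N := -(co F t w • (t : N))

open Classical in
/-- The positions of the elements of `F` in the family `blockVec F w`. -/
noncomputable def blockPattern (F : Finset N) (w : N) : Finset (blockSupp F w) :=
  Finset.univ.filter fun t => co F t w = -1

theorem mem_blockSupp {f : N} : f ∈ blockSupp F w ↔ co F f w ≠ 0 := by
  classical
  rw [blockSupp, Finset.mem_filter, and_iff_right_iff_imp]
  intro h
  by_contra hf
  rw [co_of_notMem hf] at h
  exact h rfl

theorem blockSupp_subset : blockSupp F w ⊆ F := by
  classical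
  exact Finset.filter_subset _ _

theorem neg_sum_blockVec (hF : IsLatticeBasis F) : -∑ t, blockVec F w t = w := by
  classical
  simp only [blockVec, Finset.sum_neg_distrib, neg_neg]
  rw [Finset.sum_coe_sort (blockSupp F w) fun t => co F t w • t]
  conv_rhs => rw [← sum_co hF w]
  refine Finset.sum_subset blockSupp_subset fun f _ hf => ?_
  rw [mem_blockSupp, not_not] at hf
  rw [hf, zero_smul]

variable (hF : IsLatticeBasis F) (hw : ∀ f, co F f w = -1 ∨ co F f w = 0 ∨ co F f w = 1)

include hw in
theorem blockVec_cases (t : blockSupp F w) :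
    (co F t w = -1 ∧ blockVec F w t = t) ∨ (co F t w = 1 ∧ blockVec F w t = -(t : N)) := by
  rcases hw t with h | h | h
  · exact Or.inl ⟨h, by simp [blockVec, h]⟩
  · exact absurd h (mem_blockSupp.1 t.2)
  · exact Or.inr ⟨h, by simp [blockVec, h]⟩

include hw in
theorem signedVec_blockPattern (t : blockSupp F w) :
    signedVec (blockVec F w) (blockPattern F w) t = t := by
  classical
  rcases blockVec_cases hw t with ⟨h1, h2⟩ | ⟨h1, h2⟩
  · rw [signedVec_of_mem (by simp [blockPattern, h1]), h2]
  · rw [signedVec_of_notMem (by simp [blockPattern, h1]), h2, neg_neg]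

include hw in
theorem signedSet_blockPattern :
    signedSet (blockVec F w) (blockPattern F w) = blockSupp F w := by
  ext y
  rw [mem_signedSet]
  constructor
  · rintro ⟨t, rfl⟩
    rw [signedVec_blockPattern hw]
    exact t.2
  · exact fun hy => ⟨⟨y, hy⟩, signedVec_blockPattern hw _⟩

open Classical in
include hw in
theorem neg_mem_signedSet_compl {t : N} (ht : t ∈ blockSupp F w) :
    -t ∈ signedSet (blockVec F w) (blockPattern F w)ᶜ := by
  rw [mem_signedSet]
  refine ⟨⟨t, ht⟩, ?_⟩
  have h := signedVec_blockPattern hw ⟨t, ht⟩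
  unfold signedVec at h ⊢
  simp only [Finset.mem_compl]
  split_ifs at h ⊢
  · exact congrArg Neg.neg h
  · exact (neg_neg _).symm.trans (congrArg Neg.neg h)

include hw in
-- Height 0 means that the coordinates +1 and -1 occur equally often. This is where the even
-- dimension of the blocks comes from.
theorem two_mul_card_blockPattern (h0 : hgt F w = 0) :
    2 * (blockPattern F w).card = Fintype.card (blockSupp F w) := by
  classical
  have h1 := (sum_sign (blockPattern F w)).symm.trans
    (Finset.sum_congr rfl (g := fun t : blockSupp F w => -co F (t : N) w) fun t _ => by
      rcases blockVec_cases hw t with ⟨h1, -⟩ | ⟨h1, -⟩ <;> simp [blockPattern, h1])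
  have h3 : ∑ t : blockSupp F w, co F t w = 0 := by
    rw [Finset.sum_coe_sort (blockSupp F w) fun t => co F t w, ← h0, hgt_apply]
    exact Finset.sum_subset blockSupp_subset fun f _ hf => by rwa [mem_blockSupp, not_not] at hf
  rw [Finset.sum_neg_distrib, h3] at h1
  omega

include hF hw in
theorem signDistinct_blockVec : SignDistinct (blockVec F w) := by
  intro s t hst
  have hne : (s : N) ≠ t := fun e => hst (Subtype.ext e)
  have hs := blockSupp_subset s.2
  have ht := blockSupp_subset t.2
  have h1 : (s : N) ≠ -(t : N) := fun e => neg_notMem_basis hF ht (e ▸ hs)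
  have h2 : -(s : N) ≠ (t : N) := fun e => neg_notMem_basis hF hs (e ▸ ht)
  rcases blockVec_cases hw s with ⟨-, e⟩ | ⟨-, e⟩ <;>
    rcases blockVec_cases hw t with ⟨-, e'⟩ | ⟨-, e'⟩ <;> rw [e, e']
  · exact ⟨hne, h1⟩
  · exact ⟨h1, by rwa [neg_neg]⟩
  · exact ⟨h2, fun h => hne (neg_injective h)⟩
  · exact ⟨fun h => hne (neg_injective h), by rwa [neg_neg]⟩

include hF hw in
theorem mem_blockGens_blockVec {c : Prop} {y : N} : y ∈ blockGens c (blockVec F w) ↔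
    y = w ∨ (c ∧ y = -w) ∨ y ∈ blockSupp F w ∨ -y ∈ blockSupp F w := by
  have hsum := neg_sum_blockVec (w := w) hF
  have hsum' : ∑ t, blockVec F w t = -w := by rw [← hsum, neg_neg, hsum]
  constructor
  · rintro (⟨t, rfl⟩ | ⟨t, rfl⟩ | rfl | ⟨hc, rfl⟩)
    · rcases blockVec_cases hw t with ⟨-, e⟩ | ⟨-, e⟩ <;> simp only [e, neg_neg]
      · exact Or.inr (Or.inr (Or.inl t.2))
      · exact Or.inr (Or.inr (Or.inr t.2))
    · rcases blockVec_cases hw t with ⟨-, e⟩ | ⟨-, e⟩ <;> simp only [e, neg_neg]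
      · exact Or.inr (Or.inr (Or.inr t.2))
      · exact Or.inr (Or.inr (Or.inl t.2))
    · exact Or.inl hsum
    · exact Or.inr (Or.inl ⟨hc, hsum'⟩)
  · have key : ∀ t ∈ blockSupp F w, t ∈ blockGens c (blockVec F w) ∧
        -t ∈ blockGens c (blockVec F w) := by
      intro t ht
      rcases blockVec_cases hw ⟨t, ht⟩ with ⟨-, e⟩ | ⟨-, e⟩
      · exact ⟨Or.inl ⟨_, e.symm⟩, Or.inr (Or.inl ⟨⟨t, ht⟩, by rw [e]⟩)⟩
      · exact ⟨Or.inr (Or.inl ⟨⟨t, ht⟩, by rw [e, neg_neg]⟩), Or.inl ⟨_, e.symm⟩⟩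
    rintro (rfl | ⟨hc, rfl⟩ | h | h)
    · exact Or.inr (Or.inr (Or.inl hsum.symm))
    · exact Or.inr (Or.inr (Or.inr ⟨hc, hsum'.symm⟩))
    · exact (key y h).1
    · have := (key _ h).2
      rwa [neg_neg] at this

/-- The inclusion of the lattice with basis `blockVec F w`. -/
noncomputable def blockMap (F : Finset N) (w : N) : (blockSupp F w → ℤ) →ₗ[ℤ] N :=
  Fintype.linearCombination ℤ (blockVec F w)

theorem blockMap_basisFun (t : blockSupp F w) :
    blockMap F w (Pi.basisFun ℤ _ t) = blockVec F w t := by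
  classical
  rw [blockMap, Pi.basisFun_apply, Fintype.linearCombination_apply_single, one_smul]

include hF in
theorem co_blockMap (z : blockSupp F w → ℤ) (t : blockSupp F w) :
    co F t (blockMap F w z) = -(co F t w * z t) := by
  rw [blockMap, Fintype.linearCombination_apply, map_sum, Finset.sum_eq_single t]
  · simp only [blockVec, map_smul, map_neg, co_self hF (blockSupp_subset t.2), smul_eq_mul]
    ring
  · intro s _ hst
    simp only [blockVec, map_smul, map_neg,
      co_ne hF (blockSupp_subset s.2) fun e => hst (Subtype.ext e.symm), smul_zero, neg_zero]
  · simp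

include hF in
theorem co_blockMap_of_notMem (z : blockSupp F w → ℤ) {f : N} (hf : f ∉ blockSupp F w) :
    co F f (blockMap F w z) = 0 := by
  rw [blockMap, Fintype.linearCombination_apply, map_sum]
  refine Finset.sum_eq_zero fun s _ => ?_
  have hne : f ≠ s := by
    rintro rfl
    exact hf s.2
  simp only [blockVec, map_smul, map_neg, co_ne hF (blockSupp_subset s.2) hne, smul_zero, neg_zero]

include hF in
theorem blockMap_injective : Function.Injective (blockMap F w) := by
  rw [← LinearMap.ker_eq_bot, LinearMap.ker_eq_bot']
  intro z hz
  funext t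
  have h1 := co_blockMap hF z t
  rw [hz, map_zero] at h1
  exact (mul_eq_zero.1 (neg_eq_zero.1 h1.symm)).resolve_left (mem_blockSupp.1 t.2)

include hF hw in
theorem mem_range_blockMap {x : N} :
    x ∈ LinearMap.range (blockMap F w) ↔ ∀ f, f ∉ blockSupp F w → co F f x = 0 := by
  classical
  constructor
  · rintro ⟨z, rfl⟩ f hf
    exact co_blockMap_of_notMem hF z hf
  · intro h
    rw [← sum_co hF x]
    refine Submodule.sum_mem _ fun f _ => ?_
    by_cases hfS : f ∈ blockSupp F w
    · refine Submodule.smul_mem _ _ ?_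
      have h1 : blockVec F w ⟨f, hfS⟩ ∈ LinearMap.range (blockMap F w) :=
        ⟨_, blockMap_basisFun ⟨f, hfS⟩⟩
      rcases blockVec_cases hw ⟨f, hfS⟩ with ⟨-, e⟩ | ⟨-, e⟩
      · rwa [e] at h1
      · rw [e] at h1
        simpa using Submodule.neg_mem _ h1
    · rw [h f hfS, zero_smul]
      exact zero_mem _

open Classical in
theorem image_blockMap_mem {c : Prop} {E : Finset (blockSupp F w → ℤ)} (hF : IsLatticeBasis F)
    (hE : E ∈ blockFacets c (Pi.basisFun ℤ (blockSupp F w))) :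
    E.image (blockMap F w) ∈ blockFacets c (blockVec F w) := by
  have := image_mem_blockFacets (blockMap_injective hF) hE
  simpa only [blockMap_basisFun] using this

end BlockVec

/-! ### Sums of embeddings with disjoint coordinate supports. -/

section Families

variable {σ : Type} [Fintype σ] {V : σ → ToricVariety.{u}} {N M : Type u} [AddCommGroup N]
  [AddCommGroup M] {v : ∀ s, (V s).N →ₗ[ℤ] N}

theorem sumMap_apply (z : (ToricVariety.pi V).N) : sumMap V v z = ∑ s, v s (z s) :=
  LinearMap.sum_apply (M := ∀ s, (V s).N) Finset.univ
    (fun s => (v s).comp (LinearMap.proj (φ := fun s => (V s).N) s)) z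

theorem sumMap_single [DecidableEq σ] (s : σ) (y : (V s).N) :
    sumMap V v (LinearMap.single ℤ (fun s => (V s).N) s y) = v s y := by
  refine (sumMap_apply _).trans ?_
  rw [Finset.sum_eq_single s]
  · simp
  · intro t _ hts
    simp [hts]
  · simp

open Classical in
theorem image_sumMap (e : ∀ s, Finset (V s).N) (E : Finset (ToricVariety.pi V).N)
    (hE : E = Finset.univ.biUnion fun s => (e s).image (LinearMap.single ℤ (fun s => (V s).N) s)) :
    E.image (sumMap V v) = Finset.univ.biUnion fun s => (e s).image (v s) := by
  have key : ∀ x : ∀ s, (V s).N,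
      (x ∈ Finset.univ.biUnion fun s => (e s).image (LinearMap.single ℤ (fun s => (V s).N) s)) ↔
        ∃ s, ∃ y ∈ e s, LinearMap.single ℤ (fun s => (V s).N) s y = x := fun x => by
    simp only [Finset.mem_biUnion, Finset.mem_univ, true_and, Finset.mem_image]
  have hmem : ∀ x : (ToricVariety.pi V).N, x ∈ E ↔
      ∃ s, ∃ y ∈ e s, LinearMap.single ℤ (fun s => (V s).N) s y = x := fun x => by
    rw [hE]
    exact key x
  ext x
  simp only [Finset.mem_biUnion, Finset.mem_univ, true_and, Finset.mem_image]
  constructor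
  · rintro ⟨_, hx, rfl⟩
    obtain ⟨s, y, hy, rfl⟩ := (hmem _).1 hx
    exact ⟨s, y, hy, (sumMap_single s y).symm⟩
  · rintro ⟨s, y, hy, rfl⟩
    exact ⟨_, (hmem _).2 ⟨s, y, hy, rfl⟩, sumMap_single s y⟩

open Classical in
omit [AddCommGroup M] in
theorem mem_bundleFacets_sumMap {l : M → N} {𝓔 : ∀ s, Set (Finset (V s).N)}
    {𝓡 : Set (Finset M)} {F : Finset N} :
    F ∈ bundleFacets (sumMap V v) l (piFacets 𝓔) 𝓡 ↔ ∃ e : ∀ s, Finset (V s).N,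
      (∀ s, e s ∈ 𝓔 s) ∧ ∃ R ∈ 𝓡,
        F = (Finset.univ.biUnion fun s => (e s).image (v s)) ∪ R.image l := by
  constructor
  · rintro ⟨_, ⟨e, he, rfl⟩, R, hR, rfl⟩
    exact ⟨e, he, R, hR, by rw [← image_sumMap e _ rfl]⟩
  · rintro ⟨e, he, R, hR, rfl⟩
    exact ⟨_, ⟨e, he, rfl⟩, R, hR, by rw [← image_sumMap e _ rfl]⟩

variable {F : Finset N} (hF : IsLatticeBasis F) {C : σ → Finset N}
  (hC : ∀ s t, s ≠ t → ∀ f ∈ C s, f ∉ C t)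
  (hv : ∀ s x, x ∈ LinearMap.range (v s) ↔ ∀ f, f ∉ C s → co F f x = 0)

include hC hv in
theorem co_sumMap (z : (ToricVariety.pi V).N) {s : σ} {f : N} (hf : f ∈ C s) :
    co F f (sumMap V v z) = co F f (v s (z s)) := by
  rw [sumMap_apply, map_sum, Finset.sum_eq_single s]
  · intro t _ hts
    exact (hv t _).1 ⟨z t, rfl⟩ f (hC s t hts.symm f hf)
  · simp

include hF hC hv in
theorem sumMap_injective (hinj : ∀ s, Function.Injective (v s)) :
    Function.Injective (sumMap V v) := by
  rw [← LinearMap.ker_eq_bot, LinearMap.ker_eq_bot']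
  intro z hz
  funext s
  refine hinj s ?_
  refine Eq.trans ?_ (map_zero (v s)).symm
  refine eq_zero_of_co hF fun f _ => ?_
  by_cases hf : f ∈ C s
  · rw [← co_sumMap hC hv z hf, hz, map_zero]
  · exact (hv s _).1 ⟨z s, rfl⟩ f hf

include hF hv in
theorem exists_sumMap_eq_iff (hC : ∀ s t, s ≠ t → ∀ f ∈ C s, f ∉ C t) (x : N) :
    (∃ z : (ToricVariety.pi V).N, sumMap V v z = x) ↔ ∀ f, (∀ s, f ∉ C s) → co F f x = 0 := by
  classical
  constructor
  · rintro ⟨z, rfl⟩ f hf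
    rw [sumMap_apply, map_sum]
    exact Finset.sum_eq_zero fun s _ => (hv s _).1 ⟨z s, rfl⟩ f (hf s)
  · intro h
    have h1 : ∀ s, ∃ y, v s y = ∑ f ∈ F.filter (· ∈ C s), co F f x • f := by
      intro s
      refine (hv s _).2 fun f hf => ?_
      rw [map_sum]
      refine Finset.sum_eq_zero fun g hg => ?_
      obtain ⟨hg, hgC⟩ := Finset.mem_filter.1 hg
      rw [map_smul, co_ne hF hg (by rintro rfl; exact hf hgC), smul_zero]
    choose z hz using h1
    refine ⟨z, (sumMap_apply _).trans ?_⟩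
    refine eq_of_co hF fun f hf => ?_
    rw [map_sum]
    by_cases hfC : ∃ s, f ∈ C s
    · obtain ⟨s, hs⟩ := hfC
      rw [Finset.sum_eq_single s, hz, map_sum, Finset.sum_eq_single f]
      · rw [map_smul, co_self hF hf, smul_eq_mul, mul_one]
      · intro g hg hgf
        rw [map_smul, co_ne hF (Finset.mem_filter.1 hg).1 hgf.symm, smul_zero]
      · exact fun h => absurd (Finset.mem_filter.2 ⟨hf, hs⟩) h
      · intro t _ hts
        exact (hv t _).1 ⟨_, rfl⟩ f (hC s t hts.symm f hs)
      · simp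
    · push Not at hfC
      rw [h f hfC]
      exact Finset.sum_eq_zero fun s _ => (hv s _).1 ⟨z s, rfl⟩ f (hfC s)

end Families

/-! ### The Del Pezzo or pseudo Del Pezzo variety of a block. -/

section BlockVariety

variable {N : Type u} [AddCommGroup N]

open Classical in
/-- The toric variety `V`, with set of facets `𝓔`, is the Del Pezzo variety (if `c` holds) or the
pseudo Del Pezzo variety (if not) whose generators are the members of `blockGens c (blockVec F w)`,
in the lattice embedded by `v`. -/
structure IsBlockVariety (F : Finset N) (c : Prop) (w : N) (V : ToricVariety.{u})
    (v : V.N →ₗ[ℤ] N) (𝓔 : Set (Finset V.N)) : Prop where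
  hasFacets : V.HasFacets 𝓔
  system : IsFacetSystem 𝓔 fun _ => 1
  injective : Function.Injective v
  mem_range : ∀ x, x ∈ LinearMap.range v ↔ ∀ f, f ∉ blockSupp F w → co F f x = 0
  image_mem : ∀ E ∈ 𝓔, E.image v ∈ blockFacets c (blockVec F w)
  gens : ∀ y, (∃ E ∈ 𝓔, ∃ e ∈ E, v e = y) ↔ y ∈ blockGens c (blockVec F w)
  isDelPezzo : c → IsDelPezzo (blockSupp F w).card V
  isPseudoDelPezzo : ¬ c → IsPseudoDelPezzo (blockSupp F w).card V

theorem gens_variety {ι L : Type u} [Fintype ι] [AddCommGroup L] [Module.Free ℤ L]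
    [Module.Finite ℤ L] (b : Module.Basis ι ℤ L) (c : Prop) (hcard : Even (Fintype.card ι))
    (hpos : 0 < Fintype.card ι) :
    (blockFacets_isFacetSystem b c hcard).variety.gens = blockGens c b := by
  ext y
  have H := blockFacets_isFacetSystem b c hcard
  rw [← genSet_blockFacets hcard hpos]
  exact H.hasFacets_variety.mem_gens_iff H

theorem exists_isBlockVariety {F : Finset N} {w : N} (hF : IsLatticeBasis F)
    (hw : ∀ f, co F f w = -1 ∨ co F f w = 0 ∨ co F f w = 1) (h0 : hgt F w = 0) (hne : w ≠ 0)
    (c : Prop) : ∃ (V : ToricVariety.{u}) (v : V.N →ₗ[ℤ] N) (𝓔 : Set (Finset V.N)),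
      IsBlockVariety F c w V v 𝓔 := by
  classical
  have hcard := two_mul_card_blockPattern hw h0
  have heven : Even (Fintype.card (blockSupp F w)) := ⟨(blockPattern F w).card, by omega⟩
  have hpos : 0 < Fintype.card (blockSupp F w) := by
    rw [Fintype.card_coe, Finset.card_pos]
    by_contra hn
    rw [Finset.not_nonempty_iff_eq_empty] at hn
    refine hne (eq_zero_of_co hF fun f _ => ?_)
    by_contra h
    have := mem_blockSupp.2 h
    rw [hn] at this
    exact Finset.notMem_empty _ this
  let b := Pi.basisFun ℤ (blockSupp F w)
  have H := blockFacets_isFacetSystem b c heven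
  have hgens := gens_variety b c heven hpos
  have hE : (fun g => blockMap F w (b g)) = blockVec F w := funext blockMap_basisFun
  let ε : blockSupp F w ≃ Fin (blockSupp F w).card := (blockSupp F w).equivFin
  have hbas : ∀ i, b.reindex ε i = b (ε.symm i) := fun i => b.reindex_apply ε i
  have hsum : ∑ i, b.reindex ε i = ∑ g, b g := by
    rw [Finset.sum_congr rfl fun i _ => hbas i]
    exact Equiv.sum_comp ε.symm fun g => b g
  have r1 : ∀ y, (∃ g, y = b g) ↔ y ∈ Set.range fun i => b.reindex ε i := fun y => by
    rw [Set.mem_range, ← ε.exists_congr_right]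
    simp [hbas, eq_comm]
  have r2 : ∀ y, (∃ g, y = -b g) ↔ y ∈ Set.range fun i => -b.reindex ε i := fun y => by
    rw [Set.mem_range, ← ε.exists_congr_right]
    simp [hbas, eq_comm]
  refine ⟨H.variety, blockMap F w, blockFacets c b, H.hasFacets_variety, H,
    blockMap_injective hF, fun x => mem_range_blockMap hF hw, fun E hE => image_blockMap_mem hF hE,
    fun y => ?_, fun hc => ?_, fun hc => ?_⟩
  · constructor
    · rintro ⟨E, hE, e, he, rfl⟩
      exact blockFacets_subset (image_blockMap_mem hF hE) (Finset.mem_image_of_mem _ he)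
    · intro hy
      have key : ∀ z ∈ blockGens c b, ∃ E ∈ blockFacets c b, ∃ e ∈ E,
          blockMap F w e = blockMap F w z := fun z hz => by
        rw [← genSet_blockFacets heven hpos] at hz
        obtain ⟨E, hE, hz⟩ := hz
        exact ⟨E, hE, z, hz, rfl⟩
      have hs : blockMap F w (∑ g, b g) = ∑ g, blockVec F w g := by
        rw [map_sum]
        exact Finset.sum_congr rfl fun g _ => blockMap_basisFun g
      rcases hy with ⟨g, rfl⟩ | ⟨g, rfl⟩ | rfl | ⟨hc, rfl⟩
      · rw [← blockMap_basisFun]; exact key _ (Or.inl ⟨g, rfl⟩)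
      · rw [← blockMap_basisFun, ← map_neg]; exact key _ (Or.inr (Or.inl ⟨g, rfl⟩))
      · rw [← hs, ← map_neg]; exact key _ (Or.inr (Or.inr (Or.inl rfl)))
      · rw [← hs]; exact key _ (Or.inr (Or.inr (Or.inr ⟨hc, rfl⟩)))
  · rw [Fintype.card_coe] at hpos heven
    refine ⟨H.hasFacets_variety.isSmooth H, H.hasFacets_variety.isFano H, hpos, heven,
      b.reindex ε, hgens.trans ?_⟩
    refine Eq.trans (b := (Set.range fun i => b.reindex ε i) ∪ (Set.range fun i => -b.reindex ε i) ∪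
      {-∑ i, b.reindex ε i, ∑ i, b.reindex ε i}) ?_ rfl
    rw [hsum]
    ext y
    simp only [blockGens, Set.mem_ofPred_eq, Set.mem_union, r1, r2, hc, true_and,
      Set.mem_insert_iff, Set.mem_singleton_iff, or_assoc]
  · rw [Fintype.card_coe] at hpos heven
    refine ⟨H.hasFacets_variety.isSmooth H, H.hasFacets_variety.isFano H, hpos, heven,
      b.reindex ε, hgens.trans ?_⟩
    refine Eq.trans (b := (Set.range fun i => b.reindex ε i) ∪ (Set.range fun i => -b.reindex ε i) ∪
      {-∑ i, b.reindex ε i}) ?_ rfl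
    rw [hsum]
    ext y
    simp only [blockGens, Set.mem_ofPred_eq, Set.mem_union, r1, r2, hc, false_and, or_false,
      Set.mem_singleton_iff, or_assoc]

end BlockVariety

/-! ### Spans of parts of a lattice basis. -/

section CoordinateSubspaces

variable {N : Type u} [AddCommGroup N] {F S : Finset N}

theorem mem_span_toNQ_iff (hF : IsLatticeBasis F) (hS : S ⊆ F) {x : NQ N} :
    x ∈ Submodule.span ℚ (toNQ '' (S : Set N)) ↔ ∀ f, f ∉ S → extQ (co F f) x = 0 := by
  constructor
  · intro hx f hf
    have : Submodule.span ℚ (toNQ '' (S : Set N)) ≤ LinearMap.ker (extQ (co F f)) := by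
      rw [Submodule.span_le]
      rintro _ ⟨s, hs, rfl⟩
      rw [SetLike.mem_coe, LinearMap.mem_ker, extQ_toNQ, co_ne hF (hS hs)]
      · rfl
      · rintro rfl; exact hf hs
    exact this hx
  · intro h
    rw [← sum_extQ_co hF x]
    refine Submodule.sum_mem _ fun f _ => ?_
    by_cases hf : f ∈ S
    · exact Submodule.smul_mem _ _ (Submodule.subset_span ⟨f, hf, rfl⟩)
    · rw [h f hf, zero_smul]
      exact zero_mem _

theorem toNQ_mem_span_iff (hF : IsLatticeBasis F) (hS : S ⊆ F) {x : N} :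
    toNQ x ∈ Submodule.span ℚ (toNQ '' (S : Set N)) ↔ ∀ f, f ∉ S → co F f x = 0 := by
  rw [mem_span_toNQ_iff hF hS]
  refine forall_congr' fun f => imp_congr_right fun _ => ?_
  rw [extQ_toNQ, Int.cast_eq_zero]

theorem iSupIndep_of_coordinates {κ : Type*} (hF : IsLatticeBasis F) (P : κ → Set N)
    (hP : ∀ i j, i ≠ j → ∀ f ∈ P i, f ∉ P j) (A : κ → Submodule ℚ (NQ N))
    (hA : ∀ i, ∀ x ∈ A i, ∀ f, f ∉ P i → extQ (co F f) x = 0) : iSupIndep A := by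
  intro i
  rw [Submodule.disjoint_def]
  intro x hx hx'
  have h1 : (⨆ j, ⨆ (_ : j ≠ i), A j) ≤ ⨅ f : P i, LinearMap.ker (extQ (co F (f : N))) := by
    refine iSup₂_le fun j hj y hy => ?_
    rw [Submodule.mem_iInf]
    exact fun f => hA j y hy f (hP i j hj.symm f f.2)
  have h2 := h1 hx'
  rw [Submodule.mem_iInf] at h2
  refine eq_of_extQ_co hF fun f _ => ?_
  rw [map_zero]
  by_cases hf : f ∈ P i
  · exact h2 ⟨f, hf⟩
  · exact hA i x hx f hf

end CoordinateSubspaces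

/-! ### Replacements in, and generators of, a block system. -/

section BlockSystemFacts

variable {N : Type u} [AddCommGroup N] {𝓕 : Set (Finset N)} {F T : Finset N} {σ : Type*}
  {c : σ → Prop} {ω : σ → N}

namespace IsBlockSystem

variable (HB : IsBlockSystem 𝓕 F c ω T) (H : IsFacetSystem 𝓕 fun _ => 1)

include HB in
theorem notMem_blockSupp {s t : σ} (hst : s ≠ t) {f : N} (hf : f ∈ blockSupp F (ω s)) :
    f ∉ blockSupp F (ω t) := by
  rw [mem_blockSupp] at hf ⊢
  rw [not_not]
  exact HB.disj s t hst f hf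

include HB H in
theorem basis : IsLatticeBasis F := H.basis F HB.mem

include HB H in
theorem mem_blockGens {s : σ} {y : N} : y ∈ blockGens (c s) (blockVec F (ω s)) ↔
    y = ω s ∨ (c s ∧ y = -ω s) ∨ y ∈ blockSupp F (ω s) ∨ -y ∈ blockSupp F (ω s) :=
  mem_blockGens_blockVec (HB.basis H) (HB.coord s)

include HB H in
theorem blockGens_subset {s : σ} {y : N} (hy : y ∈ blockGens (c s) (blockVec F (ω s))) :
    y ∈ genSet 𝓕 := by
  rcases (HB.mem_blockGens H).1 hy with rfl | ⟨hc, rfl⟩ | h | h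
  · exact HB.gen s
  · exact (HB.neg s).2 hc
  · exact (HB.sym s y (mem_blockSupp.1 h)).1
  · have := (HB.sym s _ (mem_blockSupp.1 h)).2
    rwa [neg_neg] at this

include HB in
theorem blockVec_mem_symSet (s : σ) (t : blockSupp F (ω s)) : blockVec F (ω s) t ∈ symSet 𝓕 := by
  have h := HB.sym s t (mem_blockSupp.1 t.2)
  rcases blockVec_cases (HB.coord s) t with ⟨-, e⟩ | ⟨-, e⟩ <;> rw [e]
  · exact h
  · exact neg_mem_symSet h

include HB H in
theorem co_blockGens {s : σ} {y : N} (hy : y ∈ blockGens (c s) (blockVec F (ω s))) {f : N}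
    (hf : f ∉ blockSupp F (ω s)) : co F f y = 0 := by
  have h0 : co F f (ω s) = 0 := by rwa [mem_blockSupp, not_not] at hf
  rcases (HB.mem_blockGens H).1 hy with rfl | ⟨hc, rfl⟩ | h | h
  · exact h0
  · rw [map_neg, h0, neg_zero]
  · exact co_ne (HB.basis H) (blockSupp_subset h) (by rintro rfl; exact hf h)
  · rw [← neg_neg y, map_neg, co_ne (HB.basis H) (blockSupp_subset h) (by rintro rfl; exact hf h),
      neg_zero]

include HB H in
theorem blockGens_notMem_blockSupp {s t : σ} (hst : s ≠ t) {y : N}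
    (hy : y ∈ blockGens (c s) (blockVec F (ω s))) : y ∉ blockSupp F (ω t) := by
  intro h
  have h1 := HB.co_blockGens H hy (HB.notMem_blockSupp hst.symm h)
  rw [co_self (HB.basis H) (blockSupp_subset h)] at h1
  exact one_ne_zero h1

include HB H in
-- The support of a block is a balanced pattern, so the complementary pattern, its opposite, is
-- balanced too and reached by `exists_change_pattern`, one block at a time.
theorem isReversible (B : Finset σ) {S : Finset N}
    (hSB : ∀ x, x ∈ S ↔ ∃ s ∈ B, x ∈ blockSupp F (ω s)) : IsReversible 𝓕 S := by
  classical
  intro F₁ hF₁ hS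
  obtain ⟨F₂, hF₂, h1, h2⟩ := exists_replace (𝓕 := 𝓕) (C := fun s => blockSupp F (ω s))
    (E := fun s => signedSet (blockVec F (ω s)) (blockPattern F (ω s))ᶜ) B
    (fun s _ F₁ hF₁ hC => by
      have hcard := two_mul_card_blockPattern (HB.coord s) (HB.hgt_eq s)
      obtain ⟨F₂, hF₂, h1, h2⟩ := H.exists_change_pattern
        (Q := (blockPattern F (ω s))ᶜ) (signDistinct_blockVec (HB.basis H) (HB.coord s))
        (HB.blockVec_mem_symSet s) (by rw [neg_sum_blockVec (HB.basis H)]; exact HB.gen s)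
        hF₁ (by rwa [signedSet_blockPattern (HB.coord s)]) hcard
        (by rw [Finset.card_compl]; omega)
      refine ⟨F₂, hF₂, h1, fun x hx hn => h2 (Finset.mem_sdiff.2 ⟨hx, ?_⟩)⟩
      rwa [signedSet_blockPattern (HB.coord s)])
    (fun s t hst x hx => HB.notMem_blockSupp hst hx)
    (fun s t hst x hx => by
      refine HB.blockGens_notMem_blockSupp H hst ((HB.mem_blockGens H).2 (Or.inr (Or.inr ?_)))
      obtain ⟨t, rfl⟩ := mem_signedSet.1 hx
      unfold signedVec
      rcases blockVec_cases (HB.coord s) t with ⟨-, e⟩ | ⟨-, e⟩ <;> split_ifs <;>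
        simp only [e, neg_neg, t.2, true_or, or_true])
    hF₁ fun s hs x hx => hS ((hSB x).2 ⟨s, hs, hx⟩)
  refine ⟨F₂, hF₂, fun f hf hn => h2 f hf fun s hs h => hn ((hSB f).2 ⟨s, hs, h⟩),
    fun x hx => ?_⟩
  obtain ⟨s, hs, hx⟩ := (hSB x).1 hx
  exact h1 s hs (neg_mem_signedSet_compl (HB.coord s) hx)

open Classical in
include HB H in
-- Restricted to Del Pezzo blocks: all their facets are reached from balanced patterns, whereas a
-- pseudo Del Pezzo block also has unbalanced ones.
theorem exists_replace_blocks (B : Finset σ) (hB : ∀ s ∈ B, c s) {E : σ → Finset N}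
    (hE : ∀ s, E s ∈ blockFacets (c s) (blockVec F (ω s))) {F₁ : Finset N} (hF₁ : F₁ ∈ 𝓕)
    (hS : ∀ s ∈ B, blockSupp F (ω s) ⊆ F₁) :
    ∃ F₂ ∈ 𝓕, (∀ s ∈ B, E s ⊆ F₂) ∧ ∀ x ∈ F₁, (∀ s ∈ B, x ∉ blockSupp F (ω s)) → x ∈ F₂ :=
  exists_replace B
    (fun s hs F₁ hF₁ hC => by
      have hsum := neg_sum_blockVec (w := ω s) (HB.basis H)
      obtain ⟨F₂, hF₂, h1, h2⟩ := H.exists_change_block (c := c s)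
        (signDistinct_blockVec (HB.basis H) (HB.coord s))
        (HB.blockVec_mem_symSet s) (by rw [hsum]; exact HB.gen s)
        (fun hc => by
          rw [show ∑ g, blockVec F (ω s) g = -ω s from neg_eq_iff_eq_neg.1 hsum]
          exact (HB.neg s).2 hc)
        (hB s hs) hF₁ (by rwa [signedSet_blockPattern (HB.coord s)])
        (two_mul_card_blockPattern (HB.coord s) (HB.hgt_eq s)) (hE s)
      refine ⟨F₂, hF₂, h1, fun x hx hn => h2 (Finset.mem_sdiff.2 ⟨hx, ?_⟩)⟩
      rwa [signedSet_blockPattern (HB.coord s)])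
    (fun s t hst x hx => HB.notMem_blockSupp hst hx)
    (fun s t hst x hx => HB.blockGens_notMem_blockSupp H hst (blockFacets_subset (hE s) hx))
    hF₁ hS

include HB H in
theorem rest_ne_zero {t : N} (ht : t ∈ T) : ∃ f, (∀ s, f ∉ blockSupp F (ω s)) ∧ co F f t ≠ 0 := by
  by_contra! hn
  refine H.ne_zero_of_mem_genSet (HB.rest_sym t ht).1 (eq_zero_of_co (HB.basis H) fun f _ => ?_)
  by_cases h : ∃ s, f ∈ blockSupp F (ω s)
  · obtain ⟨s, hs⟩ := h
    exact HB.rest_co t ht s f (mem_blockSupp.1 hs)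
  · push Not at h
    exact hn f h

include HB H in
theorem classify_blockGens {x : N} (hx : x ∈ genSet 𝓕) (hh : x ∈ symHull 𝓕) :
    (∃ s, x ∈ blockGens (c s) (blockVec F (ω s))) ∨ x ∈ T ∨ -x ∈ T := by
  rcases HB.classify x hx hh with ⟨s, h⟩ | h
  · refine Or.inl ⟨s, (HB.mem_blockGens H).2 ?_⟩
    simpa only [mem_blockSupp] using h
  · exact Or.inr h

include HB H in
/-- The generators in the span of the supports of the blocks. -/
theorem exists_mem_blockGens {x : N} (hx : x ∈ genSet 𝓕)
    (hco : ∀ f, (∀ s, f ∉ blockSupp F (ω s)) → co F f x = 0) :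
    ∃ s, x ∈ blockGens (c s) (blockVec F (ω s)) := by
  have hh : x ∈ symHull 𝓕 := by
    intro m hm
    rw [apply_eq_sum_co (HB.basis H) m x]
    refine Finset.sum_eq_zero fun f _ => ?_
    by_cases h : ∃ s, f ∈ blockSupp F (ω s)
    · obtain ⟨s, hs⟩ := h
      rw [hm f (HB.sym s f (mem_blockSupp.1 hs)), smul_zero]
    · push Not at h
      rw [hco f h, zero_smul]
  rcases HB.classify_blockGens H hx hh with h | h | h
  · exact h
  · obtain ⟨f, hf, hne⟩ := HB.rest_ne_zero H h
    exact absurd (hco f hf) hne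
  · obtain ⟨f, hf, hne⟩ := HB.rest_ne_zero H h
    rw [map_neg, hco f hf, neg_zero] at hne
    exact absurd rfl hne

include HB H in
theorem mem_blockGens_of_co {s : σ} {x : N} (hx : x ∈ genSet 𝓕)
    (hco : ∀ f, f ∉ blockSupp F (ω s) → co F f x = 0) :
    x ∈ blockGens (c s) (blockVec F (ω s)) := by
  obtain ⟨t, ht⟩ := HB.exists_mem_blockGens H hx fun f hf => hco f (hf s)
  by_cases hst : s = t
  · rwa [hst]
  · refine absurd (eq_zero_of_co (HB.basis H) fun f _ => ?_) (H.ne_zero_of_mem_genSet hx)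
    by_cases hf : f ∈ blockSupp F (ω s)
    · exact HB.co_blockGens H ht (HB.notMem_blockSupp hst hf)
    · exact hco f hf

open Classical in
include HB H in
theorem ncard_blockGens (s : σ) : (blockGens (c s) (blockVec F (ω s))).ncard =
    2 * (blockSupp F (ω s)).card + if c s then 2 else 1 := by
  have hb := HB.basis H
  set C := blockSupp F (ω s) with hC
  have hCF : C ⊆ F := blockSupp_subset
  have hdisj : Disjoint C (C.image Neg.neg) := by
    rw [Finset.disjoint_left]
    intro x hx hx'
    obtain ⟨y, hy, rfl⟩ := Finset.mem_image.1 hx'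
    exact neg_notMem_basis hb (hCF hy) (hCF hx)
  have hcard : (C ∪ C.image Neg.neg).card = 2 * C.card := by
    rw [Finset.card_union_of_disjoint hdisj, Finset.card_image_of_injective _ neg_injective]
    omega
  have h0 := HB.hgt_eq s
  have hmem : ∀ x, x ∈ C ∪ C.image Neg.neg ↔ x ∈ C ∨ -x ∈ C := fun x => by
    rw [Finset.mem_union, Finset.mem_image]
    refine or_congr_right ⟨?_, fun h => ⟨-x, h, neg_neg x⟩⟩
    rintro ⟨y, hy, rfl⟩
    rwa [neg_neg]
  have hω : ω s ∉ C := fun h => by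
    rw [hgt_of_mem hb (hCF h)] at h0; omega
  have hω' : -ω s ∉ C := fun h => by
    have := hgt_of_mem hb (hCF h)
    rw [map_neg, h0] at this; omega
  have h1 : ω s ∉ C ∪ C.image Neg.neg := fun h => ((hmem _).1 h).elim hω hω'
  have h2 : -ω s ∉ C ∪ C.image Neg.neg := fun h =>
    ((hmem _).1 h).elim hω' (by rw [neg_neg]; exact hω)
  have hne := ne_neg_of_ne_zero hb (H.ne_zero_of_mem_genSet (HB.gen s))
  split_ifs with hc
  · have : blockGens (c s) (blockVec F (ω s)) =
        (insert (ω s) (insert (-ω s) (C ∪ C.image Neg.neg)) : Finset N) := by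
      ext y
      rw [HB.mem_blockGens H, Finset.mem_coe, Finset.mem_insert, Finset.mem_insert, hmem]
      simp only [hc, true_and]
      rfl
    rw [this, Set.ncard_coe_finset, Finset.card_insert_of_notMem, Finset.card_insert_of_notMem h2,
      hcard]
    rw [Finset.mem_insert, not_or]
    exact ⟨hne, h1⟩
  · have : blockGens (c s) (blockVec F (ω s)) =
        (insert (ω s) (C ∪ C.image Neg.neg) : Finset N) := by
      ext y
      rw [HB.mem_blockGens H, Finset.mem_coe, Finset.mem_insert, hmem]
      simp only [hc, false_and, false_or]
      rfl
    rw [this, Set.ncard_coe_finset, Finset.card_insert_of_notMem h1, hcard]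

end IsBlockSystem

end BlockSystemFacts

/-! ### The direct sum decomposition and the count of generators. -/

section Decomposition

variable {X : ToricVariety.{u}} {𝓕 : Set (Finset X.N)} {F T : Finset X.N} {σ : Type*}
  {c : σ → Prop} {ω : σ → X.N}

theorem symSpan_eq (hX : X.gens = genSet 𝓕) :
    X.symSpan = Submodule.span ℚ (toNQ '' symSet 𝓕) := by
  unfold ToricVariety.symSpan
  rw [hX]
  rfl

theorem mem_symHull_of_mem_symSpan (hX : X.gens = genSet 𝓕) {x : X.N} (hx : toNQ x ∈ X.symSpan) :
    x ∈ symHull 𝓕 := by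
  intro m hm
  rw [symSpan_eq hX] at hx
  have : Submodule.span ℚ (toNQ '' symSet 𝓕) ≤ LinearMap.ker (extQ m) := by
    rw [Submodule.span_le]
    rintro _ ⟨s, hs, rfl⟩
    rw [SetLike.mem_coe, LinearMap.mem_ker, extQ_toNQ, hm s hs]
    rfl
  have h := this hx
  rwa [LinearMap.mem_ker, extQ_toNQ, Int.cast_eq_zero] at h

namespace IsBlockSystem

/-- The span of the support of a block. -/
noncomputable abbrev blockSpan (F : Finset X.N) (w : X.N) : Submodule ℚ (NQ X.N) :=
  Submodule.span ℚ (toNQ '' (blockSupp F w : Set X.N))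

variable (HB : IsBlockSystem 𝓕 F c ω T) (H : IsFacetSystem 𝓕 fun _ => 1)
  (hX : X.gens = genSet 𝓕)
include HB H

theorem finrank_blockSpan (s : σ) :
    Module.finrank ℚ (blockSpan F (ω s)) = (blockSupp F (ω s)).card :=
  finrank_span_toNQ (HB.basis H) blockSupp_subset

theorem mem_latticeIn_blockSpan (s : σ) (x : X.N) :
    x ∈ latticeIn (blockSpan F (ω s)) ↔ ∀ f, f ∉ blockSupp F (ω s) → co F f x = 0 :=
  toNQ_mem_span_iff (HB.basis H) blockSupp_subset

include hX in
theorem gensIn_blockSpan (s : σ) :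
    X.gensIn (blockSpan F (ω s)) = blockGens (c s) (blockVec F (ω s)) := by
  ext x
  constructor
  · rintro ⟨h1, h2⟩
    exact HB.mem_blockGens_of_co H (hX ▸ h1) ((HB.mem_latticeIn_blockSpan H s x).1 h2)
  · intro hx
    exact ⟨hX ▸ HB.blockGens_subset H hx,
      (HB.mem_latticeIn_blockSpan H s x).2 fun f hf => HB.co_blockGens H hx hf⟩

omit H in
theorem extQ_rest {v : NQ X.N} (hv : v ∈ Submodule.span ℚ (toNQ '' (T : Set X.N))) {s : σ} {f : X.N}
    (hf : f ∈ blockSupp F (ω s)) : extQ (co F f) v = 0 := by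
  have : Submodule.span ℚ (toNQ '' (T : Set X.N)) ≤ LinearMap.ker (extQ (co F f)) := by
    rw [Submodule.span_le]
    rintro _ ⟨t, ht, rfl⟩
    rw [SetLike.mem_coe, LinearMap.mem_ker, extQ_toNQ, HB.rest_co t ht s f (mem_blockSupp.1 hf)]
    rfl
  exact this hv

/-- The blocks have disjoint supports, and vectors in the span of `T` have no coordinate in any of
them. -/
theorem iSupIndep_spans : iSupIndep fun o : σ ⊕ Unit => Sum.elim (fun s => blockSpan F (ω s))
    (fun _ => Submodule.span ℚ (toNQ '' (T : Set X.N))) o := by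
  refine iSupIndep_of_coordinates (HB.basis H) (Sum.elim (fun s => (blockSupp F (ω s) : Set X.N))
    fun _ => {f | ∀ s, f ∉ blockSupp F (ω s)}) ?_ _ ?_
  · rintro (s | _) (t | _) hst f hf
    · exact HB.notMem_blockSupp (fun e => hst (congrArg _ e)) hf
    · exact fun h => h s hf
    · exact hf t
    · exact absurd rfl hst
  · rintro (s | _) x hx f hf
    · exact (mem_span_toNQ_iff (HB.basis H) blockSupp_subset).1 hx f hf
    · have : ∃ s, f ∈ blockSupp F (ω s) := by
        by_contra! h
        exact hf h
      obtain ⟨s, hs⟩ := this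
      exact HB.extQ_rest hx hs

include hX

theorem mem_gensIn_symSpan {x : X.N} (hx : x ∈ X.gensIn X.symSpan) :
    (∃ s, x ∈ X.gensIn (blockSpan F (ω s))) ∨
      x ∈ X.gensIn (Submodule.span ℚ (toNQ '' (T : Set X.N))) := by
  rcases HB.classify_blockGens H (hX ▸ hx.1) (mem_symHull_of_mem_symSpan hX hx.2) with
    ⟨s, h⟩ | h | h
  · exact Or.inl ⟨s, by rwa [HB.gensIn_blockSpan H hX]⟩
  · exact Or.inr ⟨hx.1, Submodule.subset_span ⟨x, h, rfl⟩⟩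
  · refine Or.inr ⟨hx.1, ?_⟩
    rw [← neg_neg x, toNQ_neg]
    exact Submodule.neg_mem _ (Submodule.subset_span ⟨_, h, rfl⟩)

theorem iSup_spans : ⨆ o : σ ⊕ Unit, Sum.elim (fun s => blockSpan F (ω s))
    (fun _ => Submodule.span ℚ (toNQ '' (T : Set X.N))) o = X.symSpan := by
  rw [symSpan_eq hX]
  apply le_antisymm
  · refine iSup_le ?_
    rintro (s | _)
    · refine Submodule.span_mono (Set.image_mono fun f hf => ?_)
      exact HB.sym s f (mem_blockSupp.1 hf)
    · exact Submodule.span_mono (Set.image_mono fun t ht => HB.rest_sym t ht)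
  · rw [Submodule.span_le]
    rintro _ ⟨x, hx, rfl⟩
    have hx' : x ∈ X.gensIn X.symSpan := by
      refine ⟨hX ▸ hx.1, ?_⟩
      rw [symSpan_eq hX]
      exact Submodule.subset_span ⟨x, hx, rfl⟩
    rcases HB.mem_gensIn_symSpan H hX hx' with ⟨s, h⟩ | h
    · exact Submodule.mem_iSup_of_mem (Sum.inl s) h.2
    · exact Submodule.mem_iSup_of_mem (Sum.inr ()) h.2

theorem gensIn_rest :
    X.gensIn (Submodule.span ℚ (toNQ '' (T : Set X.N))) = {x | x ∈ T ∨ -x ∈ T} := by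
  ext x
  constructor
  · rintro ⟨h1, h2⟩
    have hle : Submodule.span ℚ (toNQ '' (T : Set X.N)) ≤ X.symSpan := by
      rw [← HB.iSup_spans H hX]
      exact le_iSup (Sum.elim (fun s => blockSpan F (ω s))
        (fun _ => Submodule.span ℚ (toNQ '' (T : Set X.N)))) (Sum.inr ())
    have h1' : x ∈ genSet 𝓕 := hX ▸ h1
    rcases HB.classify_blockGens H h1' (mem_symHull_of_mem_symSpan hX (hle h2)) with ⟨s, h⟩ | h
    · refine absurd (eq_zero_of_co (HB.basis H) fun f _ => ?_) (H.ne_zero_of_mem_genSet h1')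
      by_cases hf : f ∈ blockSupp F (ω s)
      · have := HB.extQ_rest h2 hf
        rwa [extQ_toNQ, Int.cast_eq_zero] at this
      · exact HB.co_blockGens H h hf
    · exact h
  · rintro (h | h)
    · exact ⟨hX ▸ (HB.rest_sym x h).1, Submodule.subset_span ⟨x, h, rfl⟩⟩
    · refine ⟨hX ▸ ?_, ?_⟩
      · have := (HB.rest_sym _ h).2
        rwa [neg_neg] at this
      · rw [← neg_neg x, toNQ_neg]
        exact Submodule.neg_mem _ (Submodule.subset_span ⟨_, h, rfl⟩)

theorem ncard_gensIn_rest :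
    (X.gensIn (Submodule.span ℚ (toNQ '' (T : Set X.N)))).ncard =
      2 * Module.finrank ℚ (Submodule.span ℚ (toNQ '' (T : Set X.N))) := by
  classical
  have h1 : X.gensIn (Submodule.span ℚ (toNQ '' (T : Set X.N))) =
      (T ∪ T.image Neg.neg : Finset X.N) := by
    rw [HB.gensIn_rest H hX]
    ext x
    rw [Finset.mem_coe, Finset.mem_union, Finset.mem_image]
    refine or_congr_right ⟨fun h => ⟨-x, h, neg_neg x⟩, ?_⟩
    rintro ⟨y, hy, rfl⟩
    rwa [neg_neg]
  have hdisj : Disjoint T (T.image Neg.neg) := by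
    rw [Finset.disjoint_left]
    intro x hx hx'
    obtain ⟨y, hy, rfl⟩ := Finset.mem_image.1 hx'
    exact HB.rest_neg y hy hx
  have h2 := finrank_span_eq_card HB.rest_indep
  have h3 : Set.range (fun t : T => toNQ (t : X.N)) = toNQ '' (T : Set X.N) := by
    ext x
    simp
  rw [h3, Fintype.card_coe] at h2
  rw [h1, Set.ncard_coe_finset, h2, Finset.card_union_of_disjoint hdisj,
    Finset.card_image_of_injective _ neg_injective]
  omega

theorem gensIn_symSpan : X.gensIn X.symSpan = (⋃ s, X.gensIn (blockSpan F (ω s))) ∪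
    X.gensIn (Submodule.span ℚ (toNQ '' (T : Set X.N))) := by
  ext x
  constructor
  · intro hx
    rcases HB.mem_gensIn_symSpan H hX hx with h | h
    · exact Or.inl (Set.mem_iUnion.2 h)
    · exact Or.inr h
  · rw [← HB.iSup_spans H hX]
    rintro (h | h)
    · obtain ⟨s, h⟩ := Set.mem_iUnion.1 h
      exact ⟨h.1, Submodule.mem_iSup_of_mem (Sum.inl s) h.2⟩
    · exact ⟨h.1, Submodule.mem_iSup_of_mem (Sum.inr ()) h.2⟩

end IsBlockSystem

end Decomposition

/-! ### The fan as a bundle over a star. -/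

section StarBundle

variable {N M L : Type*} [AddCommGroup N] [AddCommGroup M] [AddCommGroup L]
  {𝓕 : Set (Finset N)} {S F₀ : Finset N}

open Classical in
/-- If the part in `S` of the maximal cones containing `S` may be replaced by any facet of the
fiber, then the fan is that of a bundle over the star of `S`. -/
theorem eq_bundleFacets_star (H : IsFacetSystem 𝓕 fun _ => 1) {p : N →ₗ[ℤ] M}
    (hp : IsQuotientBy S p) (hrev : IsReversible 𝓕 S) (hF₀ : F₀ ∈ 𝓕) (hS₀ : S ⊆ F₀)
    {j : L →ₗ[ℤ] N} (hj : Function.Injective j) (hex : ∀ x, p x = 0 ↔ ∃ y, j y = x)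
    {𝓔 : Set (Finset L)} (HE : IsFacetSystem 𝓔 fun _ => 1)
    (hrep : ∀ E ∈ 𝓔, ∀ F ∈ 𝓕, S ⊆ F →
      ∃ F' ∈ 𝓕, E.image j ⊆ F' ∧ ∀ x ∈ F, x ∉ S → x ∈ F') :
    𝓕 = bundleFacets j (starLift 𝓕 p) 𝓔 (starFacets 𝓕 S p) := by
  have HR := H.star hp hrev hF₀ hS₀
  have hl : ∀ R ∈ starFacets 𝓕 S p, ∀ r ∈ R, p (starLift 𝓕 p r) = r := fun R hR r hr =>
    (starLift_spec_of_mem hR hr).2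
  -- The bundle fan is complete, so it is enough that its maximal cones belong to `𝓕`.
  refine H.eq_of_subset ?_ (bundle_cover hj hex HE HR hl)
  intro G hG
  obtain ⟨a, HB⟩ := exists_bundle_isFacetSystem hj hex HE HR hl
  have hb := HB.basis G hG
  obtain ⟨E, hE, _, ⟨F, hF, hS, rfl⟩, rfl⟩ := hG
  rw [image_starLift H hp hrev hF hS] at hb ⊢
  obtain ⟨F', hF', h1, h2⟩ := hrep E hE F hF hS
  rw [subset_basis_eq hb (H.basis F' hF') (Finset.union_subset h1 fun x hx =>
    h2 x (Finset.mem_sdiff.1 hx).1 (Finset.mem_sdiff.1 hx).2)]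
  exact hF'

theorem coordProj_eq_zero_iff [DecidableEq N] {F S : Finset N} (x : N) :
    coordProj F (F \ S) x = 0 ↔ ∀ f, f ∉ S → co F f x = 0 := by
  constructor
  · intro h f hf
    by_cases hfF : f ∈ F
    · exact congrFun h ⟨f, Finset.mem_sdiff.2 ⟨hfF, hf⟩⟩
    · rw [co_of_notMem hfF]; rfl
  · intro h
    funext f
    exact h f (Finset.mem_sdiff.1 f.2).2

theorem exists_quotient {N : Type u} [AddCommGroup N] {F S : Finset N} (hF : IsLatticeBasis F)
    (hS : S ⊆ F) : ∃ (M : Type u) (_ : AddCommGroup M) (_ : Module.Free ℤ M)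
      (_ : Module.Finite ℤ M) (p : N →ₗ[ℤ] M), IsQuotientBy S p ∧
      ∀ x, p x = 0 ↔ ∀ f, f ∉ S → co F f x = 0 := by
  classical
  exact ⟨(F \ S : Finset N) → ℤ, inferInstance, inferInstance, inferInstance, coordProj F (F \ S),
    isQuotientBy_coordProj hF hS, coordProj_eq_zero_iff⟩

end StarBundle

/-! ### Fibers indexed by a disjoint union. -/

section SumFamilies

variable {ι κ : Type} [Fintype ι] [Fintype κ] {V : ι ⊕ κ → ToricVariety.{u}}

/-- A family on `ι ⊕ κ` equals the one reassembled from its two restrictions only propositionally,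
so the statement is transported along that equality. -/
theorem isToricBundle_sumElim {X W : ToricVariety.{u}} {P : ToricMorphism X W}
    {v : ∀ s, (V s).N →ₗ[ℤ] X.N} (h : IsToricBundle P (ToricVariety.pi V) (sumMap V v)) :
    IsToricBundle P
      (ToricVariety.pi (Sum.elim (fun i => V (Sum.inl i)) fun k => V (Sum.inr k)))
      (sumMap (Sum.elim (fun i => V (Sum.inl i)) fun k => V (Sum.inr k))
        (sumFamily (fun i => v (Sum.inl i)) fun k => v (Sum.inr k))) := by
  have key : ∀ (V' : ι ⊕ κ → ToricVariety.{u}) (_ : V = V') (v' : ∀ s, (V' s).N →ₗ[ℤ] X.N)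
      (_ : HEq v v'), IsToricBundle P (ToricVariety.pi V') (sumMap V' v') := by
    rintro _ rfl _ hv
    cases hv
    exact h
  refine key _ (funext fun s => ?_) _ (Function.hfunext rfl ?_)
  · cases s <;> rfl
  · rintro s _ rfl
    cases s <;> rfl

variable {N M P : Type u} [AddCommGroup N] [AddCommGroup M] {v : ∀ s, (V s).N →ₗ[ℤ] N}

theorem exists_sumMap_eq_add (z : (ToricVariety.pi V).N) :
    ∃ (y : (ToricVariety.pi fun i => V (Sum.inl i)).N)
      (y' : (ToricVariety.pi fun k => V (Sum.inr k)).N), sumMap V v z =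
    sumMap (fun i => V (Sum.inl i)) (fun i => v (Sum.inl i)) y +
    sumMap (fun k => V (Sum.inr k)) (fun k => v (Sum.inr k)) y' := by
  let z' : ∀ s, (V s).N := z
  refine ⟨fun i => z' (Sum.inl i), fun k => z' (Sum.inr k), ?_⟩
  rw [sumMap_apply]
  refine (Fintype.sum_sum_type _).trans ?_
  exact congrArg₂ (· + ·) (sumMap_apply _).symm (sumMap_apply _).symm

theorem sumMap_comp {ι : Type} [Fintype ι] {V : ι → ToricVariety.{u}}
    {v : ∀ s, (V s).N →ₗ[ℤ] N} (p : N →ₗ[ℤ] M) (z : (ToricVariety.pi V).N) :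
    sumMap V (fun i => p ∘ₗ v i) z = p (sumMap V v z) := by
  rw [sumMap_apply, sumMap_apply, map_sum]
  rfl

/-- Splitting off the first part of the fiber of a bundle. -/
theorem bundleFacets_sum {𝓔 : ∀ s, Set (Finset (V s).N)} {𝓡 : Set (Finset P)} {p : N →ₗ[ℤ] M}
    {l : P → N} {l' : M → N}
    (h1 : ∀ k, ∀ E ∈ 𝓔 (Sum.inr k), ∀ e ∈ E, l' (p (v (Sum.inr k) e)) = v (Sum.inr k) e)
    (h2 : ∀ R ∈ 𝓡, ∀ r ∈ R, l' (p (l r)) = l r) :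
    bundleFacets (sumMap V v) l (piFacets 𝓔) 𝓡 =
      bundleFacets (sumMap (fun i => V (Sum.inl i)) fun i => v (Sum.inl i)) l'
        (piFacets fun i => 𝓔 (Sum.inl i))
        (bundleFacets (sumMap (fun k => V (Sum.inr k)) fun k => p ∘ₗ v (Sum.inr k))
          (fun r => p (l r)) (piFacets fun k => 𝓔 (Sum.inr k)) 𝓡) := by
  classical
  have key : ∀ (e : ∀ s, Finset (V s).N) (_ : ∀ s, e s ∈ 𝓔 s) (R : Finset P) (_ : R ∈ 𝓡),
      (Finset.univ.biUnion fun s => (e s).image (v s)) ∪ R.image l =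
      (Finset.univ.biUnion fun i => (e (Sum.inl i)).image (v (Sum.inl i))) ∪
        ((Finset.univ.biUnion fun k => (e (Sum.inr k)).image (p ∘ₗ v (Sum.inr k))) ∪
          R.image fun r => p (l r)).image l' := by
    intro e he R hR
    ext x
    simp only [Finset.mem_union, Finset.mem_biUnion, Finset.mem_univ, true_and, Finset.mem_image,
      Sum.exists, or_and_right, exists_or, LinearMap.comp_apply, or_assoc]
    refine or_congr_right (or_congr ?_ ?_)
    · constructor
      · rintro ⟨k, y, hy, rfl⟩
        exact ⟨_, ⟨k, y, hy, rfl⟩, h1 k _ (he _) y hy⟩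
      · rintro ⟨_, ⟨k, y, hy, rfl⟩, rfl⟩
        exact ⟨k, y, hy, (h1 k _ (he _) y hy).symm⟩
    · constructor
      · rintro ⟨y, hy, rfl⟩
        exact ⟨_, ⟨y, hy, rfl⟩, h2 R hR y hy⟩
      · rintro ⟨_, ⟨y, hy, rfl⟩, rfl⟩
        exact ⟨y, hy, (h2 R hR y hy).symm⟩
  ext G
  rw [mem_bundleFacets_sumMap, mem_bundleFacets_sumMap]
  constructor
  · rintro ⟨e, he, R, hR, rfl⟩
    exact ⟨fun i => e (Sum.inl i), fun i => he _, _, mem_bundleFacets_sumMap.2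
      ⟨fun k => e (Sum.inr k), fun k => he _, R, hR, rfl⟩, key e he R hR⟩
  · rintro ⟨e, he, R', hR', rfl⟩
    obtain ⟨e', he', R, hR, rfl⟩ := mem_bundleFacets_sumMap.1 hR'
    have h : ∀ s, (Sum.rec e e' s : Finset (V s).N) ∈ 𝓔 s := by
      rintro (i | k)
      · exact he i
      · exact he' k
    exact ⟨_, h, R, hR, (key _ h R hR).symm⟩

end SumFamilies

/-! ### The diagram of fibrations. -/

section Diagram

variable {X : ToricVariety.{u}} {𝓕 : Set (Finset X.N)} {F T : Finset X.N} {a b : ℕ}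
  {ω : Fin a ⊕ Fin b → X.N} {V : Fin a ⊕ Fin b → ToricVariety.{u}}
  {v : ∀ s, (V s).N →ₗ[ℤ] X.N} {𝓔 : ∀ s, Set (Finset (V s).N)}

/-- The fibrations of a smooth toric Fano variety over toric Fano varieties, up to isomorphism in
codimension 1, induced by its Del Pezzo and pseudo Del Pezzo blocks. -/
theorem IsBlockSystem.exists_diagram
    (HB : IsBlockSystem 𝓕 F (fun s : Fin a ⊕ Fin b => s.isLeft = true) ω T)
    (HX : X.HasFacets 𝓕) (H : IsFacetSystem 𝓕 fun _ => 1)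
    (hV : ∀ s, IsBlockVariety F (s.isLeft = true) (ω s) (V s) (v s) (𝓔 s)) :
    ∃ (X' Z Z' W : ToricVariety.{u})
      (φ : ToricBirationalMap X X') (ψ : ToricBirationalMap Z Z')
      (p : ToricMorphism X Z) (p' : ToricMorphism X' Z')
      (q : ToricMorphism Z' W) (r : ToricMorphism X' W),
      (∀ x, p'.toLin (φ x) = ψ (p.toLin x)) ∧
      (∀ x, r.toLin x = q.toLin (p'.toLin x)) ∧
      (X.IsProjective ∧ X'.IsSmooth ∧ X'.IsProjective ∧ Z.IsSmooth ∧ Z.IsProjective ∧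
        Z'.IsSmooth ∧ Z'.IsProjective ∧ W.IsSmooth ∧ W.IsProjective) ∧
      Z.IsFano ∧ W.IsFano ∧
      φ.IsIsoInCodimOne ∧ ψ.IsIsoInCodimOne ∧
      IsToricBundle p (ToricVariety.pi fun i => V (Sum.inl i))
        (sumMap (fun i => V (Sum.inl i)) fun i => v (Sum.inl i)) ∧
      IsToricBundle p' (ToricVariety.pi fun i => V (Sum.inl i))
        (sumMap (fun i => V (Sum.inl i)) fun i => φ.toLinearMap ∘ₗ v (Sum.inl i)) ∧
      IsToricBundle q (ToricVariety.pi fun k => V (Sum.inr k))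
        (sumMap (fun k => V (Sum.inr k))
          fun k => p'.toLin ∘ₗ φ.toLinearMap ∘ₗ v (Sum.inr k)) ∧
      IsToricBundle r (ToricVariety.pi V) (sumMap V fun s => φ.toLinearMap ∘ₗ v s) := by
  classical
  have hb := HB.basis H
  let SA : Finset X.N := Finset.univ.biUnion fun i => blockSupp F (ω (Sum.inl i))
  let S : Finset X.N := Finset.univ.biUnion fun s => blockSupp F (ω s)
  have mem_SA : ∀ x, x ∈ SA ↔ ∃ i, x ∈ blockSupp F (ω (Sum.inl i)) := fun x => by simp [SA]
  have mem_S : ∀ x, x ∈ S ↔ ∃ s, x ∈ blockSupp F (ω s) := fun x => by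
    simp only [S, Finset.mem_biUnion, Finset.mem_univ, true_and]
  have hSAF : SA ⊆ F := fun x hx => by
    obtain ⟨i, hi⟩ := (mem_SA x).1 hx
    exact blockSupp_subset hi
  have hSF : S ⊆ F := fun x hx => by
    obtain ⟨i, hi⟩ := (mem_S x).1 hx
    exact blockSupp_subset hi
  have hSAS : SA ⊆ S := fun x hx => by
    obtain ⟨i, hi⟩ := (mem_SA x).1 hx
    exact (mem_S x).2 ⟨_, hi⟩
  have revA : IsReversible 𝓕 SA := HB.isReversible H (Finset.univ.map Function.Embedding.inl)
    fun x => by simp [mem_SA]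
  have rev : IsReversible 𝓕 S := HB.isReversible H Finset.univ fun x => by
    rw [mem_S]; simp only [Finset.mem_univ, true_and]
  obtain ⟨MZ, _, _, _, p, hp, p_zero⟩ := exists_quotient hb hSAF
  obtain ⟨MW, _, _, _, r, hr, r_zero⟩ := exists_quotient hb hSF
  obtain ⟨t, ht⟩ := hp.exists_section
  -- The choice of section is immaterial, because the kernel of `p` is contained in that of `r`.
  let q : MZ →ₗ[ℤ] MW := r ∘ₗ t
  have hqp : ∀ x, q (p x) = r x := fun x => by
    rw [← sub_eq_zero, LinearMap.comp_apply, ← map_sub, r_zero]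
    exact fun f hf => (p_zero _).1 (by rw [map_sub, ht, sub_self]) f fun h => hf (hSAS h)
  have HZ := H.star hp revA HB.mem hSAF
  have HW := H.star hr rev HB.mem hSF
  let lZ := starLift 𝓕 p
  let lW := starLift 𝓕 r
  have lZ_apply : ∀ x ∈ genSet 𝓕, p x ≠ 0 → lZ (p x) = x := fun x hx h =>
    starLift_apply H hp revA HB.mem hSAF hx h
  have lZ_spec : ∀ R ∈ starFacets 𝓕 SA p, ∀ z ∈ R, lZ z ∈ genSet 𝓕 ∧ p (lZ z) = z :=
    fun R hR z hz => starLift_spec_of_mem hR hz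
  have lW_spec : ∀ R ∈ starFacets 𝓕 S r, ∀ z ∈ R, lW z ∈ genSet 𝓕 ∧ r (lW z) = z :=
    fun R hR z hz => starLift_spec_of_mem hR hz
  have gen_v : ∀ s, ∀ E ∈ 𝓔 s, ∀ e ∈ E, v s e ∈ blockGens (s.isLeft = true) (blockVec F (ω s)) :=
    fun s E hE e he => ((hV s).gens _).1 ⟨E, hE, e, he, rfl⟩
  have gen_v' : ∀ s, ∀ E ∈ 𝓔 s, ∀ e ∈ E, v s e ∈ genSet 𝓕 := fun s E hE e he =>
    HB.blockGens_subset H (gen_v s E hE e he)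
  have co_v : ∀ s y f, f ∉ blockSupp F (ω s) → co F f (v s y) = 0 := fun s y f hf =>
    ((hV s).mem_range _).1 ⟨y, rfl⟩ f hf
  -- the three fibers
  have injA : Function.Injective (sumMap (fun i => V (Sum.inl i)) fun i => v (Sum.inl i)) :=
    sumMap_injective hb (C := fun i => blockSupp F (ω (Sum.inl i)))
      (fun s t hst f hf => HB.notMem_blockSupp (fun e => hst (Sum.inl_injective e)) hf)
      (fun s => (hV _).mem_range) fun s => (hV _).injective
  have injB : Function.Injective (sumMap (fun k => V (Sum.inr k)) fun k => v (Sum.inr k)) :=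
    sumMap_injective hb (C := fun k => blockSupp F (ω (Sum.inr k)))
      (fun s t hst f hf => HB.notMem_blockSupp (fun e => hst (Sum.inr_injective e)) hf)
      (fun s => (hV _).mem_range) fun s => (hV _).injective
  have inj : Function.Injective (sumMap V v) :=
    sumMap_injective hb (C := fun s => blockSupp F (ω s))
      (fun s t hst f hf => HB.notMem_blockSupp hst hf)
      (fun s => (hV _).mem_range) fun s => (hV _).injective
  have exA : ∀ x, p x = 0 ↔
      ∃ y, sumMap (fun i => V (Sum.inl i)) (fun i => v (Sum.inl i)) y = x := fun x => by
    rw [p_zero, exists_sumMap_eq_iff hb (C := fun i => blockSupp F (ω (Sum.inl i)))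
      (fun s => (hV _).mem_range)
      (fun s t hst f hf => HB.notMem_blockSupp (fun e => hst (Sum.inl_injective e)) hf)]
    simp only [mem_SA, not_exists]
  have ex : ∀ x, r x = 0 ↔ ∃ y, sumMap V v y = x := fun x => by
    rw [r_zero, exists_sumMap_eq_iff hb (C := fun s => blockSupp F (ω s))
      (fun s => (hV _).mem_range) (fun s t hst f hf => HB.notMem_blockSupp hst hf)]
    simp only [mem_S, not_exists]
  have injB' : Function.Injective
      (sumMap (fun k => V (Sum.inr k)) fun k => p ∘ₗ v (Sum.inr k)) := by
    rw [← LinearMap.ker_eq_bot, LinearMap.ker_eq_bot']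
    intro z hz
    rw [sumMap_comp, p_zero] at hz
    refine injB ((eq_zero_of_co hb fun f _ => ?_).trans (map_zero _).symm)
    by_cases hf : f ∈ SA
    · obtain ⟨i, hi⟩ := (mem_SA f).1 hf
      rw [sumMap_apply, map_sum]
      exact Finset.sum_eq_zero fun k _ => co_v _ _ f (HB.notMem_blockSupp Sum.inl_ne_inr hi)
    · exact hz f hf
  have exB' : ∀ z, q z = 0 ↔
      ∃ y, sumMap (fun k => V (Sum.inr k)) (fun k => p ∘ₗ v (Sum.inr k)) y = z := fun z => by
    constructor
    · intro hz
      obtain ⟨y, hy⟩ := (ex _).1 hz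
      obtain ⟨y₁, y₂, e⟩ := exists_sumMap_eq_add (v := v) y
      refine ⟨y₂, (sumMap_comp p y₂).trans ?_⟩
      rw [← ht z, ← hy, e, map_add, (exA _).2 ⟨y₁, rfl⟩, zero_add]
    · rintro ⟨y, rfl⟩
      rw [sumMap_comp, hqp, r_zero]
      intro f hf
      rw [sumMap_apply, map_sum]
      exact Finset.sum_eq_zero fun k _ => co_v _ _ f fun h => hf ((mem_S f).2 ⟨_, h⟩)
  have HA := IsFacetSystem.pi fun i => (hV (Sum.inl i)).system
  have HBB := IsFacetSystem.pi fun k => (hV (Sum.inr k)).system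
  have HAB := IsFacetSystem.pi fun s => (hV s).system
  -- the fan of `Z'`
  have hlZ' : ∀ R ∈ starFacets 𝓕 S r, ∀ z ∈ R, q (p (lW z)) = z := fun R hR z hz =>
    (hqp _).trans (lW_spec R hR z hz).2
  -- `Z'` and `X'` are built over the same base `W` with compatible lifts: those of `Z'` are the
  -- projections of those of `X'`. This makes `X'` a bundle over `Z'` as well.
  obtain ⟨aZ, HZ'⟩ := exists_bundle_isFacetSystem (l := fun z => p (lW z)) injB' exB' HBB HW hlZ'
  obtain ⟨aX, HX'⟩ := exists_bundle_isFacetSystem inj ex HAB HW fun R hR z hz =>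
    (lW_spec R hR z hz).2
  set 𝓧' := bundleFacets (sumMap V v) lW (piFacets 𝓔) (starFacets 𝓕 S r) with h𝓧'
  set 𝓩' := bundleFacets (sumMap (fun k => V (Sum.inr k)) fun k => p ∘ₗ v (Sum.inr k))
    (fun z => p (lW z)) (piFacets fun k => 𝓔 (Sum.inr k)) (starFacets 𝓕 S r) with h𝓩'
  have hZ'_gen : ∀ R ∈ 𝓩', ∀ z ∈ R, ∃ x ∈ genSet 𝓕, p x = z := by
    intro R hR z hz
    obtain ⟨e, he, R₁, hR₁, rfl⟩ := mem_bundleFacets_sumMap.1 hR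
    rcases Finset.mem_union.1 hz with hz | hz
    · obtain ⟨k, -, hz⟩ := Finset.mem_biUnion.1 hz
      obtain ⟨y, hy, rfl⟩ := Finset.mem_image.1 hz
      exact ⟨_, gen_v' _ _ (he k) y hy, rfl⟩
    · obtain ⟨y, hy, rfl⟩ := Finset.mem_image.1 hz
      exact ⟨_, (lW_spec R₁ hR₁ y hy).1, rfl⟩
  have lZ_spec' : ∀ R ∈ 𝓩', ∀ z ∈ R, lZ z ∈ genSet 𝓕 ∧ p (lZ z) = z := by
    intro R hR z hz
    obtain ⟨x, hx, rfl⟩ := hZ'_gen R hR z hz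
    exact starLift_spec hx
  have hX'eq : 𝓧' = bundleFacets (sumMap (fun i => V (Sum.inl i)) fun i => v (Sum.inl i)) lZ
      (piFacets fun i => 𝓔 (Sum.inl i)) 𝓩' := by
    refine bundleFacets_sum (fun k E hE e he => ?_) fun R hR z hz => ?_
    · have hg := gen_v' _ E hE e he
      refine lZ_apply _ hg fun h => H.ne_zero_of_mem_genSet hg (eq_zero_of_co hb fun f _ => ?_)
      by_cases hf : f ∈ SA
      · obtain ⟨i, hi⟩ := (mem_SA f).1 hf
        exact co_v _ _ f (HB.notMem_blockSupp Sum.inl_ne_inr hi)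
      · exact (p_zero _).1 h f hf
    · refine lZ_apply _ (lW_spec R hR z hz).1 fun h => ?_
      refine ne_zero_of_mem_basis (HW.basis R hR) hz ?_
      rw [← hlZ' R hR z hz, h, map_zero]
  -- For the Del Pezzo blocks `X` itself is a bundle; the facets `E'` at the pseudo Del Pezzo
  -- indices are arbitrary fillers, never inserted into a cone.
  have h𝓕 : 𝓕 = bundleFacets (sumMap (fun i => V (Sum.inl i)) fun i => v (Sum.inl i)) lZ
      (piFacets fun i => 𝓔 (Sum.inl i)) (starFacets 𝓕 SA p) := by
    refine eq_bundleFacets_star H hp revA HB.mem hSAF injA exA HA ?_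
    rintro _ ⟨e, he, rfl⟩ F₁ hF₁ hS₁
    choose E' hE' using fun s => (hV s).system.nonempty
    obtain ⟨F₂, hF₂, h1, h2⟩ := HB.exists_replace_blocks H
      (Finset.univ.map (Function.Embedding.inl : Fin a ↪ Fin a ⊕ Fin b)) (by simp)
      (E := Sum.rec (fun i => (e i).image (v (Sum.inl i)))
        fun k => (E' (Sum.inr k)).image (v (Sum.inr k)))
      (by
        rintro (i | k)
        · exact (hV _).image_mem _ (he i)
        · exact (hV _).image_mem _ (hE' _))
      hF₁ (by
        intro s hs
        obtain ⟨i, -, rfl⟩ := Finset.mem_map.1 hs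
        exact fun x hx => hS₁ ((mem_SA x).2 ⟨i, hx⟩))
    refine ⟨F₂, hF₂, ?_, fun x hx hn => h2 x hx fun s hs h => ?_⟩
    · rw [image_sumMap e _ rfl]
      refine Finset.biUnion_subset.2 fun i _ => ?_
      exact h1 (Sum.inl i) (Finset.mem_map_of_mem _ (Finset.mem_univ i))
    · obtain ⟨i, -, rfl⟩ := Finset.mem_map.1 hs
      exact hn ((mem_SA x).2 ⟨i, h⟩)
  -- A generator of `X` killed by `r` belongs to a block, hence to the fiber; any other one lies in
  -- a maximal cone containing `S` and so is the lift of a generator of `W`.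
  have gen_X' : ∀ x, x ∈ genSet 𝓧' ↔ x ∈ genSet 𝓕 := by
    intro x
    constructor
    · rintro ⟨G, hG, hx⟩
      obtain ⟨e, he, R, hR, rfl⟩ := mem_bundleFacets_sumMap.1 hG
      rcases Finset.mem_union.1 hx with hx | hx
      · obtain ⟨s, -, hx⟩ := Finset.mem_biUnion.1 hx
        obtain ⟨y, hy, rfl⟩ := Finset.mem_image.1 hx
        exact gen_v' s _ (he s) y hy
      · obtain ⟨y, hy, rfl⟩ := Finset.mem_image.1 hx
        exact (lW_spec R hR y hy).1
    · intro hx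
      choose E' hE' using fun s => (hV s).system.nonempty
      by_cases h0 : r x = 0
      · obtain ⟨s, hs⟩ := HB.exists_mem_blockGens H hx fun f hf =>
          (r_zero x).1 h0 f fun h => by
            obtain ⟨s, hs⟩ := (mem_S f).1 h
            exact hf s hs
        obtain ⟨E, hE, y, hy, rfl⟩ := ((hV s).gens x).2 hs
        obtain ⟨R, hR⟩ := HW.nonempty
        refine ⟨_, mem_bundleFacets_sumMap.2 ⟨Function.update E' s E, fun t => ?_, R, hR, rfl⟩,
          Finset.mem_union_left _ (Finset.mem_biUnion.2 ⟨s, Finset.mem_univ s, ?_⟩)⟩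
        · by_cases hts : t = s
          · subst hts; rwa [Function.update_self]
          · rw [Function.update_of_ne hts]; exact hE' t
        · rw [Function.update_self]
          exact Finset.mem_image_of_mem _ hy
      · obtain ⟨G, hG, hS, hxG, -⟩ := H.exists_mem_star hr rev HB.mem hSF hx hx rfl h0
        refine ⟨_, mem_bundleFacets_sumMap.2 ⟨E', hE', _, ⟨G, hG, hS, rfl⟩, rfl⟩,
          Finset.mem_union_right _ ?_⟩
        rw [image_starLift H hr rev hG hS]
        exact Finset.mem_sdiff.2 ⟨hxG, fun h => h0 (hr.map_eq_zero h)⟩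
  have hpA : ∀ y, p (sumMap (fun i => V (Sum.inl i)) (fun i => v (Sum.inl i)) y) = 0 := fun y =>
    (exA _).2 ⟨y, rfl⟩
  have hX : X.HasFacets (bundleFacets (sumMap (fun i => V (Sum.inl i)) fun i => v (Sum.inl i)) lZ
      (piFacets fun i => 𝓔 (Sum.inl i)) (starFacets 𝓕 SA p)) := h𝓕 ▸ HX
  have hX'2 : HX'.variety.HasFacets 𝓧' := HX'.hasFacets_variety
  have hX'1 : HX'.variety.HasFacets
      (bundleFacets (sumMap (fun i => V (Sum.inl i)) fun i => v (Sum.inl i)) lZ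
      (piFacets fun i => 𝓔 (Sum.inl i)) 𝓩') := hX'eq ▸ hX'2
  have hZ : HZ.variety.HasFacets (starFacets 𝓕 SA p) := HZ.hasFacets_variety
  have hZ' : HZ'.variety.HasFacets 𝓩' := HZ'.hasFacets_variety
  have hW : HW.variety.HasFacets (starFacets 𝓕 S r) := HW.hasFacets_variety
  have hFA := hasFacets_pi fun i => (hV (Sum.inl i)).hasFacets
  have hFB := hasFacets_pi fun k => (hV (Sum.inr k)).hasFacets
  have hFAB := hasFacets_pi fun s => (hV s).hasFacets
  let P : ToricMorphism X HZ.variety :=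
    ⟨p, bundle_map_le hX hZ hpA fun R hR z hz => (lZ_spec R hR z hz).2⟩
  let P' : ToricMorphism HX'.variety HZ'.variety :=
    ⟨p, bundle_map_le hX'1 hZ' hpA fun R hR z hz => (lZ_spec' R hR z hz).2⟩
  let Q : ToricMorphism HZ'.variety HW.variety :=
    ⟨q, bundle_map_le hZ' hW (fun y => (exB' _).2 ⟨y, rfl⟩) hlZ'⟩
  let R' : ToricMorphism HX'.variety HW.variety :=
    ⟨r, bundle_map_le hX'2 hW (fun y => (ex _).2 ⟨y, rfl⟩) fun R hR z hz => (lW_spec R hR z hz).2⟩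
  -- Both birational maps are the identity on lattices; only the fans change.
  refine ⟨HX'.variety, HZ.variety, HZ'.variety, HW.variety, LinearEquiv.refl ℤ X.N,
    LinearEquiv.refl ℤ _, P, P', Q, R', fun _ => rfl, fun x => (hqp x).symm,
    ⟨HX.isProjective H, hX'2.isSmooth HX', hX'2.isProjective HX', hZ.isSmooth HZ,
      hZ.isProjective HZ, hZ'.isSmooth HZ', hZ'.isProjective HZ', hW.isSmooth HW,
      hW.isProjective HW⟩, hZ.isFano HZ, hW.isFano HW, ?_, ?_, ?_, ?_, ?_, ?_⟩
  · exact HX.isIsoInCodimOne H hX'2 HX' (LinearEquiv.refl ℤ X.N)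
      (fun G hG x hx => (gen_X' x).2 ⟨G, hG, hx⟩) fun G hG x hx => (gen_X' x).1 ⟨G, hG, hx⟩
  · refine hZ.isIsoInCodimOne HZ hZ' HZ' (LinearEquiv.refl ℤ _) (fun R hR z hz => ?_)
      fun R hR z hz => ?_
    · have h0 : z ≠ 0 := ne_zero_of_mem_basis (HZ.basis R hR) hz
      obtain ⟨h1, h2⟩ := lZ_spec R hR z hz
      obtain ⟨G, hG, hx⟩ := (gen_X' _).2 h1
      rw [hX'eq] at hG
      obtain ⟨E, hE, R₁, hR₁, rfl⟩ := hG
      rcases Finset.mem_union.1 hx with hx | hx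
      · obtain ⟨y, -, hy⟩ := Finset.mem_image.1 hx
        rw [← hy, hpA] at h2
        exact absurd h2.symm h0
      · obtain ⟨z', hz', e⟩ := Finset.mem_image.1 hx
        refine ⟨R₁, hR₁, ?_⟩
        rw [← e, (lZ_spec' R₁ hR₁ z' hz').2] at h2
        exact h2 ▸ hz'
    · have h0 : z ≠ 0 := ne_zero_of_mem_basis (HZ'.basis R hR) hz
      obtain ⟨h1, h2⟩ := lZ_spec' R hR z hz
      obtain ⟨G, hG, hS, hx, -⟩ := H.exists_mem_star hp revA HB.mem hSAF h1 h1 rfl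
        (by rwa [h2])
      refine ⟨_, ⟨G, hG, hS, rfl⟩, Finset.mem_image.2 ⟨lZ z, Finset.mem_sdiff.2 ⟨hx, fun h => ?_⟩,
        h2⟩⟩
      exact h0 (h2 ▸ hp.map_eq_zero h)
  · exact isToricBundle_of_bundleFacets hX hFA hZ HZ injA exA
      (fun R hR z hz => (lZ_spec R hR z hz).2) P rfl
  · exact isToricBundle_of_bundleFacets (X := HX'.variety) hX'1 hFA hZ' HZ' injA exA
      (fun R hR z hz => (lZ_spec' R hR z hz).2) P' rfl
  · exact isToricBundle_of_bundleFacets (X := HZ'.variety) (Z := HW.variety)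
      (l := fun z => p (lW z)) hZ' hFB hW HW injB' exB' hlZ' Q rfl
  · exact isToricBundle_of_bundleFacets (X := HX'.variety) hX'2 hFAB hW HW inj ex
      (fun R hR z hz => (lW_spec R hR z hz).2) R' rfl

end Diagram

/-! ### Assembly of the decomposition and the diagram. -/

theorem theorem3 (X : ToricVariety.{u}) (hsmooth : X.IsSmooth) (hfano : X.IsFano) :
    ∃ (a b : ℕ) (A : Fin a → Submodule ℚ (NQ X.N)) (B : Fin b → Submodule ℚ (NQ X.N))
      (K : Submodule ℚ (NQ X.N)),
      -- the direct sum decomposition of `H`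
      iSupIndep (Sum.elim (Sum.elim A B) (fun _ : Unit => K)) ∧
      (⨆ s, Sum.elim (Sum.elim A B) (fun _ : Unit => K) s) = X.symSpan ∧
      (∀ i, 0 < Module.finrank ℚ (A i)) ∧ (∀ k, 0 < Module.finrank ℚ (B k)) ∧
      -- the generators in `H` lie in the summands
      X.gensIn X.symSpan = (⋃ i, X.gensIn (A i)) ∪ (⋃ k, X.gensIn (B k)) ∪ X.gensIn K ∧
      -- the numbers of generators
      (∀ i, (X.gensIn (A i)).ncard = 2 * (Module.finrank ℚ (A i) + 1)) ∧
      (∀ k, (X.gensIn (B k)).ncard = 2 * Module.finrank ℚ (B k) + 1) ∧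
      (X.gensIn K).ncard = 2 * Module.finrank ℚ K ∧
      -- the factors of the fibers, with lattices the `N ∩ H_i` and the `N ∩ H̃_k`
      ∃ (V : Fin a → ToricVariety.{u}) (v : ∀ i, (V i).N →ₗ[ℤ] X.N)
        (U : Fin b → ToricVariety.{u}) (w : ∀ k, (U k).N →ₗ[ℤ] X.N),
        (∀ i, IsDelPezzo (Module.finrank ℚ (A i)) (V i) ∧
          Function.Injective (v i) ∧ LinearMap.range (v i) = latticeIn (A i)) ∧
        (∀ k, IsPseudoDelPezzo (Module.finrank ℚ (B k)) (U k) ∧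
          Function.Injective (w k) ∧ LinearMap.range (w k) = latticeIn (B k)) ∧
        -- the diagram
        ∃ (X' Z Z' W : ToricVariety.{u})
          (φ : ToricBirationalMap X X') (ψ : ToricBirationalMap Z Z')
          (p : ToricMorphism X Z) (p' : ToricMorphism X' Z')
          (q : ToricMorphism Z' W) (r : ToricMorphism X' W),
          (∀ x, p'.toLin (φ x) = ψ (p.toLin x)) ∧
          (∀ x, r.toLin x = q.toLin (p'.toLin x)) ∧
          (X.IsProjective ∧ X'.IsSmooth ∧ X'.IsProjective ∧ Z.IsSmooth ∧ Z.IsProjective ∧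
            Z'.IsSmooth ∧ Z'.IsProjective ∧ W.IsSmooth ∧ W.IsProjective) ∧
          Z.IsFano ∧ W.IsFano ∧
          φ.IsIsoInCodimOne ∧ ψ.IsIsoInCodimOne ∧
          IsToricBundle p (ToricVariety.pi V) (sumMap V v) ∧
          IsToricBundle p' (ToricVariety.pi V) (sumMap V fun i => φ.toLinearMap ∘ₗ v i) ∧
          IsToricBundle q (ToricVariety.pi U)
            (sumMap U fun k => p'.toLin ∘ₗ φ.toLinearMap ∘ₗ w k) ∧
          IsToricBundle r (ToricVariety.pi (Sum.elim V U))
            (sumMap (Sum.elim V U)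
              (sumFamily (fun i => φ.toLinearMap ∘ₗ v i) (fun k => φ.toLinearMap ∘ₗ w k))) := by
  have H : IsFacetSystem X.facets fun _ => 1 :=
    ToricVariety.isFacetSystem_facets hsmooth hfano.1 hfano.2
  have HX : X.HasFacets X.facets := ToricVariety.hasFacets_facets hsmooth hfano.1
  have hX : X.gens = genSet X.facets := Set.ext fun x => HX.mem_gens_iff H
  obtain ⟨F, a, b, ω, T, HB⟩ := H.exists_isBlockSystem
  have hb := HB.basis H
  choose V v 𝓔 hV using fun s => exists_isBlockVariety hb (HB.coord s) (HB.hgt_eq s)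
    (H.ne_zero_of_mem_genSet (HB.gen s)) (s.isLeft = true)
  have hpos : ∀ s, 0 < (blockSupp F (ω s)).card := fun s => by
    by_cases hs : s.isLeft = true
    · exact ((hV s).isDelPezzo hs).2.2.1
    · exact ((hV s).isPseudoDelPezzo hs).2.2.1
  have hcard := fun s => HB.ncard_blockGens H s
  have hgens := fun s => HB.gensIn_blockSpan H hX s
  have hrank := fun s => HB.finrank_blockSpan H s
  have hrange : ∀ s, LinearMap.range (v s) = latticeIn (IsBlockSystem.blockSpan F (ω s)) :=
    fun s => by
      ext x
      rw [(hV s).mem_range, HB.mem_latticeIn_blockSpan H]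
  have helim : (Sum.elim (fun i => IsBlockSystem.blockSpan F (ω (Sum.inl i)))
      fun k => IsBlockSystem.blockSpan F (ω (Sum.inr k))) =
      fun s => IsBlockSystem.blockSpan F (ω s) := by
    funext s
    cases s <;> rfl
  obtain ⟨X', Z, Z', W, φ, ψ, p, p', q, r, h1, h2, h3, h4, h5, h6, h7, h8, h9, h10, h11⟩ :=
    HB.exists_diagram HX H hV
  refine ⟨a, b, fun i => IsBlockSystem.blockSpan F (ω (Sum.inl i)),
    fun k => IsBlockSystem.blockSpan F (ω (Sum.inr k)),
    Submodule.span ℚ (toNQ '' (T : Set X.N)), ?_, ?_, ?_, ?_, ?_, ?_, ?_,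
    HB.ncard_gensIn_rest H hX, fun i => V (Sum.inl i), fun i => v (Sum.inl i),
    fun k => V (Sum.inr k), fun k => v (Sum.inr k), ?_, ?_,
    X', Z, Z', W, φ, ψ, p, p', q, r, h1, h2, h3, h4, h5, h6, h7, h8, h9, h10, ?_⟩
  · rw [helim]
    exact HB.iSupIndep_spans H
  · rw [helim]
    exact HB.iSup_spans H hX
  · intro i
    rw [hrank]
    exact hpos _
  · intro k
    rw [hrank]
    exact hpos _
  · rw [HB.gensIn_symSpan H hX]
    congr 1
    ext x
    simp only [Set.mem_iUnion, Set.mem_union, Sum.exists]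
  · intro i
    rw [hgens, hcard, hrank, if_pos (by simp)]
    ring
  · intro k
    rw [hgens, hcard, hrank, if_neg (by simp)]
  · intro i
    refine ⟨?_, (hV _).injective, hrange _⟩
    rw [hrank]
    exact (hV (Sum.inl i)).isDelPezzo rfl
  · intro k
    refine ⟨?_, (hV _).injective, hrange _⟩
    rw [hrank]
    exact (hV (Sum.inr k)).isPseudoDelPezzo (by simp)
  · exact isToricBundle_sumElim h11
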